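/- **Setting.** The security parameter $n$ ranges over the powers of $2$; logarithms are to base $2$. Parameters, as functions of $n$: a prime $q\equiv 3 \pmod 8$, a real $\sigma>0$ with $\sigma=\Omega(n)$, an integer $\mu\ge\log^2 n$, and an integer $t^*\ge 0$. All algorithms are given $n$ (in unary) and a description of the parameters; the description has length polynomial in $n$, and $q$, $\mu$ and $\lfloor\eta_t\rfloor$ (see below) can be computed from it and $t$ in polynomial time. PPT means probabilistic polynomial time, and "negligible" means negligible in $n$. Let $R=\mathbb Z[x]/(x^n+1)$ and $R_q=\mathbb Z_q[x]/(x^n+1)$. Let $\|\cdot\|_\infty$ be the maximal absolute value of a coefficient, where elements of $\mathbb Z_q$ are represented in $[-(q-1)/2,(q-1)/2]$. Let $D_{R,\sigma}$ be the distribution on $R$ with independent coefficients, each of them equal to $y\in\mathbb Z$ with probability proportional to $e^{-\pi y^2/\sigma^2}$. Put $$\mathcal C=\{c\in R:\|c\|_\infty\le\log n,\ \deg c<n/2\},\quad \mathcal Y=\{y\in R:\|y\|_\infty\le n^{1.5}\sigma\log^3 n\},\quad \mathcal Z=\{z\in R:\|z\|_\infty\le (n-1)n^{1/2}\sigma\log^3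 n\},$$ $$\eta_t=5\sigma n^2\sqrt{t\mu}\,\log^6 n,\qquad \beta_{t}=16\,\eta_{t}\sqrt n\,\log^2 n .$$ **Assumptions.** *Ring-LWE$_{q,\sigma,2n}$*: no PPT algorithm distinguishes $(a,as+e)$ from $(a,b)$ with non-negligible advantage, where $a,b\leftarrow R_q$ are uniform and $s,e\leftarrow D_{R,\sigma}$. *Ring-SIS$_{3,q,\beta}$*: given uniform $a_1,a_2,a_3\leftarrow R_q$, each PPT algorithm finds with negligible probability only $(t_1,t_2,t_3)\in R^3\setminus\{0\}$ with $\|t_i\|_\infty\le\beta$ and $a_1t_1+a_2t_2+a_3t_3=0$ in $R_q$. **Scheme.** Setup: uniform $a\leftarrow R_q^*$. Key generation: $s_1,s_2\leftarrow D_{R,\sigma}$; the private key is $(s_1,s_2)$, the public key is $u=as_1+s_2\in R_q$. The prover samples uniform $\mathbf y_1,\mathbf y_2\leftarrow\mathcal Y^\mu$ and sends $\mathbf v=a\mathbf y_1+\mathbf y_2$. The verifier sends a uniform $c\leftarrow\mathcal C$. The prover puts $z_{bj}=s_bc+y_{bj}$ and $A=\{j: z_{1j},z_{2j}\in\mathcal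 Z\}$; it aborts if $A=\emptyset$; otherwise it picks a uniform $j^*\leftarrow A$ and sends $z_b=z_{bj^*}+\sum_{j\ne j^*}y_{bj}$ for $b=1,2$. The verification algorithm $V_t$ accepts if and only if $\sum_{j=1}^{\mu}v_j=az_1+z_2-uc$ in $R_q$ and $\|z_1\|_\infty,\|z_2\|_\infty\le\eta_t$. **$t^*$-security.** (i) Correctness: for all $1\le t\le t^*$, the verifier $V_t$ accepts the honest prover except with negligible probability. (ii) Security: each PPT attacker that always takes part with $t\le t^*$ public keys ($t$ may be chosen during the attack) succeeds with negligible probability in the following experiment. Let $a$ and $u_1$ be a system parameter and an honestly generated public key; on input $(a,u_1)$ the attacker outputs a state and $u_2,\dots,u_t\in R_q$; then $\lambda_1,\dots,\lambda_t\leftarrow\mathcal C$ are sampled uniformly and, given its state and the $\lambda_i$, the attacker outputs a state and $\mathbf v\in R_q^\mu$; then $c\leftarrow\mathcal C$ is sampled uniformly and, given its state and $c$, the attacker outputs $(z_1,z_2)\in R_q^2$. It succeeds if $V_t$ accepts $(\mathbf v,c,(z_1,z_2))$ for the aggregated public key $\overline u=\sum_{i=1}^t\lambda_iu_i$. **Lemma.**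 Under the ring-LWE$_{q,\sigma,2n}$ and ring-SIS$_{3,q,\beta_{t^*}}$ assumptions, the scheme is $t^*$-secure. -/

import Mathlib

open Polynomial Filter

noncomputable section

namespace LatticeID

/-! ## Probabilistic polynomial time

The machine model is a first-order language of while-programs over finite binary trees whose leaves
are integers.  Every elementary operation is charged one unit plus the bit-size of the datum it is
applied to (logarithmic cost), and there is an operation that samples a uniform element of
`{0, ..., k-1}`.  -/

/-- Data: binary trees with integer leaves. -/
inductive Val : Type
  | num (z : ℤ)
  | pair (a b : Val)

namespace Val

/-- Bit-size of a datum. -/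
def size : Val → ℕ
  | num z => 1 + z.natAbs.size
  | pair a b => 1 + a.size + b.size

def fst : Val → Val
  | num _ => num 0
  | pair a _ => a

def snd : Val → Val
  | num _ => num 0
  | pair _ b => b

/-- The integer at a leaf (`0` at an inner node). -/
def toInt : Val → ℤ
  | num z => z
  | pair _ _ => 0

/-- Conditions: a datum counts as true unless it is the leaf `0`. -/
def truth : Val → Bool
  | num z => decide (z ≠ 0)
  | pair _ _ => true

/-- Lists are coded as `x₁ :: x₂ :: ... ↦ pair x₁ (pair x₂ (... (num 0)))`. -/
def ofList : List Val → Val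
  | [] => num 0
  | a :: l => pair a (ofList l)

def toList : Val → List Val
  | num _ => []
  | pair a b => a :: toList b

end Val

/-- The deterministic elementary operations.  The arithmetical ones act on a pair of integers. -/
inductive Prim : Type
  | id | fst | snd | isPair | add | sub | mul | div | le
  | const (z : ℤ)

def Prim.eval : Prim → Val → Val
  | .id, v => v
  | .fst, v => v.fst
  | .snd, v => v.snd
  | .isPair, .num _ => .num 0
  | .isPair, .pair _ _ => .num 1
  | .add, v => .num (v.fst.toInt + v.snd.toInt)
  | .sub, v => .num (v.fst.toInt - v.snd.toInt)
  | .mul, v => .num (v.fst.toInt * v.snd.toInt)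
  | .div, v => .num (v.fst.toInt / v.snd.toInt)
  | .le, v => .num (if v.fst.toInt ≤ v.snd.toInt then 1 else 0)
  | .const z, _ => .num z

/-- Programs.  `rand` maps the leaf `k ≥ 1` to a uniform element of `{0, ..., k-1}`;
`comp f g` runs `f` and then `g`; `pair f g` runs both on the same input and pairs the results;
`loop c f` is "while `c` holds of the current datum, replace it by the result of `f`". -/
inductive Prog : Type
  | prim (o : Prim)
  | rand
  | comp (f g : Prog)
  | pair (f g : Prog)
  | ite (c f g : Prog)
  | loop (c f : Prog)

/-- Result of a run with bounded time: either `none` (time exceeded), or the output together with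
the time that is left. -/
abbrev Outcome := Option (Val × ℕ)

/-- Pay `k` units and return `w`. -/
def charge (k : ℕ) (w : Val) (T : ℕ) : Outcome :=
  if k ≤ T then some (w, T - k) else none

/-- Continue a run, if it has not exceeded its time. -/
def andThen (x : PMF Outcome) (f : Val → ℕ → PMF Outcome) : PMF Outcome :=
  x.bind fun o => match o with
    | none => PMF.pure none
    | some (w, T) => f w T

/-- The uniform distribution on the leaves `0, ..., k-1` (the leaf `0` if `k = 0`). -/
def randNum : ℕ → PMF Val
  | 0 => PMF.pure (.num 0)
  | m + 1 => (PMF.uniformOfFintype (Fin (m + 1))).map fun i => .num ((i : ℕ) : ℤ)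

/-- At most `m` rounds of a while-loop. -/
def rounds (c f : Val → ℕ → PMF Outcome) : ℕ → Val → ℕ → PMF Outcome
  | 0, _, _ => PMF.pure none
  | m + 1, v, T => andThen (c v T) fun b T' =>
      if b.truth then andThen (f v T') (rounds c f m) else PMF.pure (some (v, T'))

/-- `exec P v T` is the run of `P` on input `v` with `T` units of time available.  Every round of
a loop costs at least one unit, so that `T + 1` rounds are never completed. -/
def exec : Prog → Val → ℕ → PMF Outcome
  | .prim o, v, T => PMF.pure (charge (1 + v.size) (o.eval v) T)
  | .rand, v, T => (randNum v.toInt.toNat).map fun w => charge (1 + v.size) w T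
  | .comp f g, v, T => andThen (exec f v T) (exec g)
  | .pair f g, v, T => andThen (exec f v T) fun a T' =>
      andThen (exec g v T') fun b T'' => PMF.pure (some (.pair a b, T''))
  | .ite c f g, v, T => andThen (exec c v T) fun b T' =>
      if b.truth then exec f v T' else exec g v T'
  | .loop c f, v, T => rounds (exec c) (exec f) (T + 1) v T

/-- A probabilistic polynomial-time algorithm: a program that, whatever its coins, halts on input
`(n, x)` within a time that is polynomial in the security parameter `n` and the size of `x`
(that is, in the length of `x` and of `n` written in unary). -/
structure PPT where
  prog : Prog
  bound : ℕ[X]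
  halts : ∀ (n : ℕ) (x : Val),
    none ∉ (exec prog (.pair (.num n) x) (bound.eval (n + x.size))).support

/-- The output distribution of an algorithm on security parameter `n` and input `x`. -/
def PPT.run (A : PPT) (n : ℕ) (x : Val) : PMF Val :=
  (exec A.prog (.pair (.num n) x) (A.bound.eval (n + x.size))).map fun o =>
    match o with
    | none => .num 0
    | some (w, _) => w

/-! ## Sampling -/

open Classical in
/-- The uniform distribution on a finite nonempty set (it is used for no other sets). -/
def uniformOn {α : Type*} [Inhabited α] (S : Set α) : PMF α :=
  if h : ∃ hS : S.Finite, hS.toFinset.Nonempty then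
    PMF.uniformOfFinset h.choose.toFinset h.choose_spec
  else PMF.pure default

/-- `m` independent samples of `p`. -/
def iid {α : Type*} (p : PMF α) : (m : ℕ) → PMF (Fin m → α)
  | 0 => PMF.pure Fin.elim0
  | m + 1 => p.bind fun a => (iid p m).map fun f => (Fin.cons a f : Fin (m + 1) → α)

/-- The weight `exp (-π y² / σ²)`. -/
def gaussWeight (σ : ℝ) (y : ℤ) : ENNReal :=
  ENNReal.ofReal (Real.exp (-Real.pi * (y : ℝ) ^ 2 / σ ^ 2))

open Classical in
/-- The discrete Gaussian distribution on `ℤ`, for `σ > 0` (when the weights are summable). -/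
def gaussInt (σ : ℝ) : PMF ℤ :=
  if h : (∑' y, gaussWeight σ y) ≠ 0 ∧ (∑' y, gaussWeight σ y) ≠ ⊤ then
    PMF.normalize (gaussWeight σ) h.1 h.2
  else PMF.pure 0

/-! ## The rings `R = ℤ[x]/(xⁿ+1)` and `R_q = ℤ_q[x]/(xⁿ+1)` -/

section Ring

variable (A : Type) [CommRing A] (n : ℕ)

/-- `A[x]/(xⁿ+1)`. -/
def Cyc : Type := AdjoinRoot (X ^ n + 1 : A[X])

instance : CommRing (Cyc A n) := inferInstanceAs (CommRing (AdjoinRoot (X ^ n + 1 : A[X])))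

instance : Inhabited (Cyc A n) := ⟨0⟩

end Ring

/-- The ring `R`. -/
abbrev Rz (n : ℕ) : Type := Cyc ℤ n

/-- The ring `R_q`. -/
abbrev Rq (q n : ℕ) : Type := Cyc (ZMod q) n

/-- The element `∑ v_i x^i`. -/
def ofCoeffs {A : Type} [CommRing A] {n : ℕ} (v : Fin n → A) : Cyc A n :=
  AdjoinRoot.mk (X ^ n + 1 : A[X]) (∑ i, C (v i) * X ^ (i : ℕ))

/-- The coefficients `u_0, ..., u_{n-1}` of `u = ∑ u_i x^i`. -/
def coeffs {A : Type} [CommRing A] {n : ℕ} [NeZero n] (u : Cyc A n) (i : Fin n) : A :=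
  (AdjoinRoot.modByMonicHom (g := (X ^ n + 1 : A[X]))
    (by simpa using monic_X_pow_add_C (1 : A) (NeZero.ne n)) u).coeff i

/-- Reduction modulo `q`, from `R` to `R_q`. -/
def red (q : ℕ) {n : ℕ} : Rz n →+* Rq q n :=
  AdjoinRoot.map (Int.castRingHom (ZMod q)) (X ^ n + 1) (X ^ n + 1) (by simp)

/-- `‖u‖_∞ ≤ B` in `R`. -/
def NormLe {n : ℕ} [NeZero n] (u : Rz n) (B : ℝ) : Prop :=
  ∀ i : Fin n, |((coeffs u i : ℤ) : ℝ)| ≤ B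

/-- `‖u‖_∞ ≤ B` in `R_q`, for the representatives of the coefficients in
`[-(q-1)/2, (q-1)/2]`. -/
def NormLeQ {q n : ℕ} [NeZero n] (u : Rq q n) (B : ℝ) : Prop :=
  ∀ i : Fin n, |((coeffs u i).valMinAbs : ℝ)| ≤ B

/-- The distribution `D_{R,σ}`: independent coefficients distributed as `D_{ℤ,σ}`. -/
def gaussR (n : ℕ) (σ : ℝ) : PMF (Rz n) := (iid (gaussInt σ) n).map ofCoeffs

/-! Coding of ring elements as lists of `n` integers; for `R_q`, these are the representatives in
`[-(q-1)/2, (q-1)/2]`.  Decoding is total: missing entries of a list are read as `0`. -/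

def encZ {n : ℕ} [NeZero n] (u : Rz n) : Val :=
  .ofList (List.ofFn fun i => .num (coeffs u i))

def encQ {q n : ℕ} [NeZero n] (u : Rq q n) : Val :=
  .ofList (List.ofFn fun i => .num (coeffs u i).valMinAbs)

def decZ (n : ℕ) (w : Val) : Rz n :=
  ofCoeffs fun i => (w.toList.getD i (.num 0)).toInt

def decQ (q n : ℕ) (w : Val) : Rq q n :=
  ofCoeffs fun i => ((w.toList.getD i (.num 0)).toInt : ZMod q)

/-! ## Parameters -/

/-- The parameters, as functions of the security parameter `n`, with a string `desc n` by which
they are made known to all algorithms. -/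
structure Params where
  q : ℕ → ℕ
  μ : ℕ → ℕ
  σ : ℕ → ℝ
  desc : ℕ → Val

/-- Logarithms are to the base 2. -/
def lg (n : ℕ) : ℝ := Real.logb 2 n

/-- `η_t = 5 σ n² √(t μ) log⁶ n`. -/
def Params.eta (P : Params) (n t : ℕ) : ℝ :=
  5 * P.σ n * (n : ℝ) ^ 2 * Real.sqrt (t * P.μ n) * lg n ^ 6

/-- `β_t = 16 η_t √n log² n`. -/
def Params.beta (P : Params) (n t : ℕ) : ℝ :=
  16 * P.eta n t * Real.sqrt n * lg n ^ 2

/-- The parameters are efficient: their description has polynomial length, and from it one can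
compute in polynomial time the data `q`, `μ`, `⌊η_t⌋` that the verification algorithm `V_t` uses
(the norm of a ring element is at most `η_t` if and only if it is at most `⌊η_t⌋`). -/
def Params.Efficient (P : Params) : Prop :=
  (∃ p : ℕ[X], ∀ k : ℕ, (P.desc (2 ^ k)).size ≤ p.eval (2 ^ k)) ∧
  ∃ V : PPT, ∀ k t : ℕ, V.run (2 ^ k) (.pair (P.desc (2 ^ k)) (.num t)) =
    PMF.pure (.ofList [.num (P.q (2 ^ k)), .num (P.μ (2 ^ k)), .num ⌊P.eta (2 ^ k) t⌋])

/-- `f k` is negligible as a function of the security parameter `n = 2 ^ k`; the security parameter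
ranges over the powers of 2. -/
def Negligible (f : ℕ → ℝ) : Prop :=
  Asymptotics.SuperpolynomialDecay atTop (fun k : ℕ => (2 : ℝ) ^ k) f

/-- The probability that an experiment returns `true`. -/
def prob (p : PMF Bool) : ℝ := (p true).toReal

/-! ## Ring-LWE and ring-SIS -/

/-- The run of `D` on a sample `(a, as+e)`: does it answer `1`? -/
def lweReal (P : Params) (D : PPT) (n : ℕ) [NeZero n] : PMF Bool :=
  (gaussR n (P.σ n)).bind fun s =>
  (uniformOn (Set.univ : Set (Rq (P.q n) n))).bind fun a =>
  (gaussR n (P.σ n)).bind fun e =>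
  (D.run n (.pair (P.desc n) (.pair (encQ a) (encQ (a * red _ s + red _ e))))).map fun w =>
    decide (w.toInt = 1)

/-- The run of `D` on a uniform pair `(a, b)`: does it answer `1`? -/
def lweIdeal (P : Params) (D : PPT) (n : ℕ) [NeZero n] : PMF Bool :=
  (uniformOn (Set.univ : Set (Rq (P.q n) n))).bind fun a =>
  (uniformOn (Set.univ : Set (Rq (P.q n) n))).bind fun b =>
  (D.run n (.pair (P.desc n) (.pair (encQ a) (encQ b)))).map fun w => decide (w.toInt = 1)

/-- The ring-LWE assumption: no algorithm distinguishes the two with non-negligible advantage. -/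
def RingLWE (P : Params) : Prop :=
  ∀ D : PPT, Negligible fun k =>
    |prob (lweReal P D (2 ^ k)) - prob (lweIdeal P D (2 ^ k))|

open Classical in
/-- The ring-SIS experiment with `m` uniform elements of `R_q` and norm bound `β`. -/
def sisExp (P : Params) (m : ℕ) (β : ℝ) (S : PPT) (n : ℕ) [NeZero n] : PMF Bool :=
  (iid (uniformOn (Set.univ : Set (Rq (P.q n) n))) m).bind fun a =>
  (S.run n (.pair (P.desc n) (.ofList (List.ofFn fun i => encQ (a i))))).map fun w =>
    let t : Fin m → Rz n := fun i => decZ n (w.toList.getD i (.num 0))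
    decide (t ≠ 0 ∧ (∀ i, NormLe (t i) β) ∧ ∑ i, a i * red _ (t i) = 0)

/-- The ring-SIS assumption: each algorithm finds a nonzero solution of norm at most `β` with
negligible probability only. -/
def RingSIS (P : Params) (m : ℕ) (β : ℕ → ℝ) : Prop :=
  ∀ S : PPT, Negligible fun k =>
    prob (sisExp P m (β (2 ^ k)) S (2 ^ k))

/-! ## The identification scheme -/

/-- The challenge set `𝒞` : `‖c‖_∞ ≤ log n` and `deg c < n/2`. -/
def chalSet (n : ℕ) [NeZero n] : Set (Rz n) :=
  {c | NormLe c (lg n) ∧ ∀ i : Fin n, n ≤ 2 * (i : ℕ) → coeffs c i = 0}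

/-- The set `𝒴`. -/
def Params.maskSet (P : Params) (n : ℕ) [NeZero n] : Set (Rz n) :=
  {y | NormLe y ((n : ℝ) ^ (1.5 : ℝ) * P.σ n * lg n ^ 3)}

/-- The set `𝒵`. -/
def Params.respSet (P : Params) (n : ℕ) [NeZero n] : Set (Rz n) :=
  {z | NormLe z (((n : ℝ) - 1) * (n : ℝ) ^ (0.5 : ℝ) * P.σ n * lg n ^ 3)}

/-- `Setup`: the system parameter `a ← R_q^*`. -/
def Params.setup (P : Params) (n : ℕ) : PMF (Rq (P.q n) n) := uniformOn {a | IsUnit a}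

/-- `KeyGen`: the public key `u = a s₁ + s₂` and the private key `(s₁, s₂)`. -/
def Params.keyGen (P : Params) (n : ℕ) (a : Rq (P.q n) n) :
    PMF (Rq (P.q n) n × (Rz n × Rz n)) :=
  (gaussR n (P.σ n)).bind fun s₁ => (gaussR n (P.σ n)).map fun s₂ =>
    (a * red _ s₁ + red _ s₂, (s₁, s₂))

/-- The first move of the prover: the state `(y₁, y₂)` and the committing message
`v = a y₁ + y₂`. -/
def Params.commit (P : Params) (n : ℕ) [NeZero n] (a : Rq (P.q n) n) :
    PMF (((Fin (P.μ n) → Rz n) × (Fin (P.μ n) → Rz n)) × (Fin (P.μ n) → Rq (P.q n) n)) :=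
  (iid (uniformOn (P.maskSet n)) (P.μ n)).bind fun y₁ =>
  (iid (uniformOn (P.maskSet n)) (P.μ n)).map fun y₂ =>
    ((y₁, y₂), fun j => a * red _ (y₁ j) + red _ (y₂ j))

open Classical in
/-- The second move of the prover: `none` if the prover aborts. -/
def Params.respond (P : Params) (n : ℕ) [NeZero n] (s : Rz n × Rz n)
    (y : (Fin (P.μ n) → Rz n) × (Fin (P.μ n) → Rz n)) (c : Rz n) :
    PMF (Option (Rq (P.q n) n × Rq (P.q n) n)) :=
  let z₁ : Fin (P.μ n) → Rz n := fun j => s.1 * c + y.1 j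
  let z₂ : Fin (P.μ n) → Rz n := fun j => s.2 * c + y.2 j
  let J : Finset (Fin (P.μ n)) :=
    Finset.univ.filter fun j => z₁ j ∈ P.respSet n ∧ z₂ j ∈ P.respSet n
  if h : J.Nonempty then
    (PMF.uniformOfFinset J h).map fun j => some
      (red _ (z₁ j + ∑ i ∈ Finset.univ.erase j, y.1 i),
       red _ (z₂ j + ∑ i ∈ Finset.univ.erase j, y.2 i))
  else PMF.pure none

/-- The verification algorithm `V_t` for the (possibly aggregated) public key `u`, committing
message `v`, challenge `c` and response `z`. -/
def Params.Verify (P : Params) (n : ℕ) [NeZero n] (t : ℕ) (a u : Rq (P.q n) n)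
    (v : Fin (P.μ n) → Rq (P.q n) n) (c : Rz n) (z : Rq (P.q n) n × Rq (P.q n) n) : Prop :=
  ∑ j, v j = a * z.1 + z.2 - u * red _ c ∧ NormLeQ z.1 (P.eta n t) ∧ NormLeQ z.2 (P.eta n t)

open Classical in
/-- An execution of the protocol between the honest prover and the verifier `V_t`. -/
def honestRun (P : Params) (n : ℕ) [NeZero n] (t : ℕ) : PMF Bool :=
  (P.setup n).bind fun a =>
  (P.keyGen n a).bind fun key =>
  (P.commit n a).bind fun com =>
  (uniformOn (chalSet n)).bind fun c =>
  (P.respond n key.2 com.1 c).map fun rsp =>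
    match rsp with
    | none => false
    | some z => decide (P.Verify n t a key.1 com.2 c z)

/-- An attacker against the identification scheme: its three moves.  State is passed on from one
move to the next. -/
structure Attacker where
  first : PPT
  second : PPT
  third : PPT

/-- The attacker's input in its first move. -/
def Params.view (P : Params) (n : ℕ) [NeZero n] (a u : Rq (P.q n) n) : Val :=
  .pair (P.desc n) (.pair (encQ a) (encQ u))

/-- The attacker always takes part with at most `t n` public keys, the honest one included, for
each system parameter `a` and honest public key `u`. -/
def Attacker.AtMost (𝒜 : Attacker) (P : Params) (t : ℕ → ℕ) : Prop :=
  ∀ (k : ℕ) (a u : Rq (P.q (2 ^ k)) (2 ^ k)), IsUnit a →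
    ∀ w ∈ (𝒜.first.run (2 ^ k) (P.view (2 ^ k) a u)).support,
      w.snd.toList.length + 1 ≤ t (2 ^ k)

open Classical in
/-- The security experiment.  The first move of the attacker returns a state and the list
`u₂, ..., u_t`, whose length determines `t`; the second one, on that state and `λ₁, ..., λ_t`,
returns a state and a committing message; the third one, on that state and the challenge, returns
the response `(z₁, z₂)`. -/
def idExp (P : Params) (𝒜 : Attacker) (n : ℕ) [NeZero n] : PMF Bool :=
  (P.setup n).bind fun a =>
  (P.keyGen n a).bind fun key =>
  (𝒜.first.run n (P.view n a key.1)).bind fun w₁ =>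
  let u : List (Rq (P.q n) n) := key.1 :: w₁.snd.toList.map (decQ (P.q n) n)
  (iid (uniformOn (chalSet n)) u.length).bind fun l =>
  (𝒜.second.run n (.pair w₁.fst (.ofList (List.ofFn fun i => encZ (l i))))).bind fun w₂ =>
  (uniformOn (chalSet n)).bind fun c =>
  (𝒜.third.run n (.pair w₂.fst (encZ c))).map fun w₃ =>
    decide (P.Verify n u.length a (∑ i, red _ (l i) * u.get i)
      (fun j => decQ (P.q n) n (w₂.snd.toList.getD j (.num 0))) c
      (decQ (P.q n) n w₃.fst, decQ (P.q n) n w₃.snd))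

/-- Correctness of the scheme with verification algorithm `V_t`. -/
def Correct (P : Params) (t : ℕ → ℕ) : Prop :=
  Negligible fun k =>
    1 - prob (honestRun P (2 ^ k) (t (2 ^ k)))

/-- The scheme is `t*`-secure: it is correct for each `1 ≤ t ≤ t*`, and each probabilistic
polynomial-time attacker that takes part with `t ≤ t*` public keys (`t` may be chosen during the
attack) succeeds with negligible probability only. -/
def TSecure (P : Params) (tstar : ℕ → ℕ) : Prop :=
  (∀ t : ℕ → ℕ, (∀ k, 1 ≤ t (2 ^ k) ∧ t (2 ^ k) ≤ tstar (2 ^ k)) → Correct P t) ∧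
  ∀ 𝒜 : Attacker, 𝒜.AtMost P tstar →
    Negligible fun k =>
      prob (idExp P 𝒜 (2 ^ k))

end LatticeID

end

/-! Correctness. Up to negligible probability the secrets satisfy `‖s_b‖ ≤ σ log n`. Each
coefficient of `s_b c` is then a weighted sum of independent symmetric bounded variables (the
coefficients of `c`), so a subgaussian tail bound gives `‖s_b c‖ ≤ √n σ log³ n`. The bounds of `𝒴`
and `𝒵` are `n` times and `n - 1` times this number. Hence each index lies in `A` with probability
at least `(1/16)²`, and as `μ ≥ log² n`, the set `A` is empty with negligible probability only.
Whatever `j*` is, the response equals `s_b c + ∑ y_bj`, and the sum of the masks is short by the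
same tail bound (`expect_fail_le`, `expect_honestRun_le`).

Security. Ring-LWE allows the honest key to be replaced by a uniform `u`; passing between a unit `a`
and a uniform `a` costs a factor 2 and a negligible term (`expect_idExp_le`). The attacker is then
forked twice. Its first move and `λ₂, ..., λ_t` are kept, `λ₁` is drawn twice, and for each `λ₁` the
challenge is drawn twice. By Jensen's inequality all four conversations are accepted with
probability at least the fourth power of the success probability (`success_pow_le`). Subtracting
within a branch eliminates the commitment, and a suitable combination of the two branches eliminates
the keys chosen by the attacker. What remains is a relation `a t₁ + t₂ + u t₃ = 0` with `t₃ = (λ₁' -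
λ₁)(c - c')(d - d')`, where `c, c'` and `d, d'` are the challenges of the two branches.

The relation is nontrivial because `q ≡ 3 mod 8`: then `X^n + 1` has two irreducible factors modulo
`q`, both of degree `n/2`, so a nonzero element of degree less than `n/2` is a unit
(`isUnit_of_coeffs`), in particular each nonzero difference of challenges. The relation is short
because `t₁` and `t₂` multiply responses of one branch by challenges of the other one. These are
independent, so a product gains a factor `√n log² n` over the responses and not `n log n`
(`expect_fork_le`). With `a = a₁/a₂` and `u = a₃/a₂` the relation solves ring-SIS for `(a₁, a₂, a₃)`
(`expect_extraction_le`). That `q` exceeds `4 log n` follows from ring-SIS itself: otherwise `(q, 0,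
0)` would be a short solution.

Machine model. Both reductions have to be programs of the given language. Polynomial time is closed
under composition and under folds whose state grows additively (`PP.comp`, `PP.foldM`). Elements of
`R_q` are stored as single integers by Kronecker substitution, `X ↦ B` into `ℤ/(B^n + 1)`, and the
inverse of a unit `r` is `r^(q^n - 2)`. -/

open Polynomial Filter

noncomputable section

namespace LatticeID

/-! ## Runs of programs within a time bound -/

/-- `Runs P v T p`: on input `v`, the program `P` halts within time `T` and its output has
distribution `p`. -/
def Runs (P : Prog) (v : Val) (T : ℕ) (p : PMF Val) : Prop :=
  ∃ ν : PMF (Val × ℕ), (∀ S, exec P v (T + S) = ν.map fun x => some (x.1, x.2 + S)) ∧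
    ν.map Prod.fst = p

theorem Runs.mono {P : Prog} {v : Val} {T T' : ℕ} {p : PMF Val} (h : Runs P v T p) (hT : T ≤ T') :
    Runs P v T' p := by
  obtain ⟨ν, h1, h2⟩ := h
  obtain ⟨d, rfl⟩ := Nat.exists_eq_add_of_le hT
  refine ⟨ν.map fun x => (x.1, x.2 + d), fun S => ?_, ?_⟩
  · rw [add_assoc, h1, PMF.map_comp]
    congr 1; funext x; simp [add_assoc]
  · rw [PMF.map_comp]; exact h2

theorem andThen_map_some {α : Type*} (ν : PMF α) (g : α → Val × ℕ) (f : Val → ℕ → PMF Outcome) :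
    andThen (ν.map fun x => some (g x)) f = ν.bind fun x => f (g x).1 (g x).2 := by
  simp [andThen, PMF.bind_map, Function.comp_def]

theorem runs_prim (o : Prim) (v : Val) : Runs (.prim o) v (1 + v.size) (PMF.pure (o.eval v)) := by
  refine ⟨PMF.pure (o.eval v, 0), fun S => ?_, by simp [PMF.pure_map]⟩
  simp [exec, charge, PMF.pure_map]

theorem runs_rand (v : Val) : Runs .rand v (1 + v.size) (randNum v.toInt.toNat) := by
  refine ⟨(randNum v.toInt.toNat).map fun w => (w, 0), fun S => ?_, ?_⟩
  · rw [PMF.map_comp]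
    simp [exec, charge, Function.comp_def]
  · rw [PMF.map_comp]; exact PMF.map_id _

theorem bind_congr_support {α β : Type*} (p : PMF α) {f g : α → PMF β}
    (h : ∀ a ∈ p.support, f a = g a) : p.bind f = p.bind g := by
  ext b
  simp only [PMF.bind_apply]
  refine tsum_congr fun a => ?_
  by_cases ha : a ∈ p.support
  · rw [h a ha]
  · rw [PMF.mem_support_iff, not_not] at ha; simp [ha]

/-- Sequential composition of runs, for an arbitrary continuation. -/
theorem runs_seq {E : ℕ → PMF Outcome} {κE : Val → ℕ → PMF Outcome} {T1 T2 : ℕ} {p : PMF Val}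
    {κ : Val → PMF Val}
    (h1 : ∃ ν : PMF (Val × ℕ), (∀ S, E (T1 + S) = ν.map fun x => some (x.1, x.2 + S)) ∧
      ν.map Prod.fst = p)
    (h2 : ∀ w ∈ p.support, ∃ ν : PMF (Val × ℕ),
      (∀ S, κE w (T2 + S) = ν.map fun x => some (x.1, x.2 + S)) ∧ ν.map Prod.fst = κ w) :
    ∃ ν : PMF (Val × ℕ),
      (∀ S, andThen (E (T1 + T2 + S)) κE = ν.map fun x => some (x.1, x.2 + S)) ∧
      ν.map Prod.fst = p.bind κ := by
  classical
  obtain ⟨ν, a1, a2⟩ := h1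
  -- The continuation is controlled only on the support of `p`; elsewhere the leftover distribution
  -- is a dummy of no weight.
  have h2' : ∀ w : Val, ∃ ν' : PMF (Val × ℕ), w ∈ p.support →
      (∀ S, κE w (T2 + S) = ν'.map fun x => some (x.1, x.2 + S)) ∧ ν'.map Prod.fst = κ w := by
    intro w
    by_cases hw : w ∈ p.support
    · obtain ⟨ν', h⟩ := h2 w hw; exact ⟨ν', fun _ => h⟩
    · exact ⟨PMF.pure (w, 0), fun h => absurd h hw⟩
  choose νg hg using h2'
  have hsup : ∀ x ∈ ν.support, x.1 ∈ p.support := by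
    intro x hx
    rw [← a2, PMF.mem_support_map_iff]
    exact ⟨x, hx, rfl⟩
  -- What the first run leaves, `x.2`, is part of the surplus of the second run, so the leftovers
  -- add up. The quantification over all surpluses `S` is what makes this possible.
  refine ⟨ν.bind fun x => (νg x.1).map fun y => (y.1, y.2 + x.2), fun S => ?_, ?_⟩
  · rw [add_assoc, a1, andThen_map_some, PMF.map_bind]
    refine bind_congr_support _ fun x hx => ?_
    have := (hg x.1 (hsup x hx)).1 (S + x.2)
    rw [PMF.map_comp]
    have e : x.2 + (T2 + S) = T2 + (S + x.2) := by ring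
    simp only [e, this]
    congr 1; funext y; simp [add_comm, add_left_comm]
  · rw [PMF.map_bind, ← a2, PMF.bind_map]
    refine bind_congr_support _ fun x hx => ?_
    rw [PMF.map_comp]
    exact (hg x.1 (hsup x hx)).2

theorem runs_comp {f g : Prog} {v : Val} {T1 T2 : ℕ} {p : PMF Val} {κ : Val → PMF Val}
    (h1 : Runs f v T1 p) (h2 : ∀ w ∈ p.support, Runs g w T2 (κ w)) :
    Runs (.comp f g) v (T1 + T2) (p.bind κ) :=
  runs_seq (E := exec f v) (κE := exec g) h1 h2

theorem runs_pair {f g : Prog} {v : Val} {T1 T2 : ℕ} {p q : PMF Val}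
    (h1 : Runs f v T1 p) (h2 : Runs g v T2 q) :
    Runs (.pair f g) v (T1 + T2) (p.bind fun a => q.map fun b => .pair a b) := by
  refine runs_seq (E := exec f v) (κE := fun a T' => andThen (exec g v T') fun b T'' =>
    PMF.pure (some (.pair a b, T''))) h1 fun a _ => ?_
  obtain ⟨ν, a1, a2⟩ := h2
  refine ⟨ν.map fun x => (.pair a x.1, x.2), fun S => ?_, ?_⟩
  · rw [a1, andThen_map_some, PMF.map_comp]; rfl
  · rw [PMF.map_comp, ← a2, PMF.map_comp]; rfl

theorem runs_ite {c f g : Prog} {v : Val} {T1 T2 : ℕ} {pc : PMF Val} {q : Val → PMF Val}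
    (h1 : Runs c v T1 pc)
    (h2 : ∀ b ∈ pc.support, Runs (if b.truth then f else g) v T2 (q b)) :
    Runs (.ite c f g) v (T1 + T2) (pc.bind q) := by
  refine runs_seq (E := exec c v) (κE := fun b T' => if b.truth then exec f v T' else exec g v T')
    h1 fun b hb => ?_
  obtain ⟨ν, a1, a2⟩ := h2 b hb
  refine ⟨ν, fun S => ?_, a2⟩
  rw [← a1]; split_ifs <;> rfl

/-! ### Loops -/

/-- At most `m` rounds of a loop suffice, within time `T`. -/
def RunsRounds (c f : Prog) (m : ℕ) (v : Val) (T : ℕ) (p : PMF Val) : Prop :=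
  ∀ m', m ≤ m' → ∃ ν : PMF (Val × ℕ),
    (∀ S, rounds (exec c) (exec f) m' v (T + S) = ν.map fun x => some (x.1, x.2 + S)) ∧
    ν.map Prod.fst = p

theorem runsRounds_done {c f : Prog} {v b : Val} {T : ℕ} (h : Runs c v T (PMF.pure b))
    (hb : b.truth = false) : RunsRounds c f 1 v T (PMF.pure v) := by
  intro m' hm
  obtain ⟨m, rfl⟩ := Nat.exists_eq_add_of_le' hm
  have := runs_seq (E := exec c v) (T1 := T) (T2 := 0) (κ := fun _ => PMF.pure v) (κE := fun b T' =>
      if b.truth then andThen (exec f v T') (rounds (exec c) (exec f) m)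
        else PMF.pure (some (v, T'))) h (fun w hw => by
      rw [PMF.mem_support_pure_iff] at hw
      subst hw
      exact ⟨PMF.pure (v, 0), fun S => by simp [hb, PMF.pure_map], by simp [PMF.pure_map]⟩)
  simpa [rounds] using this

theorem runsRounds_step {c f : Prog} {v b : Val} {m T1 T2 T3 : ℕ} {p : PMF Val} {κ : Val → PMF Val}
    (h : Runs c v T1 (PMF.pure b)) (hb : b.truth = true) (hf : Runs f v T2 p)
    (hk : ∀ w ∈ p.support, RunsRounds c f m w T3 (κ w)) :
    RunsRounds c f (m + 1) v (T1 + (T2 + T3)) (p.bind κ) := by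
  intro m' hm
  obtain ⟨m'', rfl⟩ := Nat.exists_eq_add_of_le' (le_trans (Nat.le_add_left 1 m) hm)
  have := runs_seq (E := exec c v) (T1 := T1) (T2 := T2 + T3) (κ := fun _ => p.bind κ)
    (κE := fun b T' => if b.truth then andThen (exec f v T') (rounds (exec c) (exec f) m'')
        else PMF.pure (some (v, T'))) h (fun w hw => by
      rw [PMF.mem_support_pure_iff] at hw
      subst hw
      simp only [hb, if_true]
      exact runs_seq (E := exec f v) hf fun w hw => hk w hw m'' (by omega))
  simpa [rounds] using this

/-- With `T + S` units of time a loop is allowed `T + S + 1` rounds, and the distribution that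
`RunsRounds` provides may depend on the number of rounds. It does not: a run that never fails with
`m₁` rounds is unchanged by further rounds, so the distribution for `T + 1` rounds serves for every
`S`. -/
theorem runs_loop {c f : Prog} {v : Val} {m T : ℕ} {p : PMF Val} (h : RunsRounds c f m v T p)
    (hm : m ≤ T + 1) : Runs (.loop c f) v T p := by
  obtain ⟨ν, -, a2⟩ := h m le_rfl
  have key : ∀ S, ∃ ν : PMF (Val × ℕ),
      (∀ S', rounds (exec c) (exec f) (T + S + 1) v (T + S') =
        ν.map fun x => some (x.1, x.2 + S')) ∧ ν.map Prod.fst = p :=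
    fun S => h _ (by omega)
  obtain ⟨ν₀, b1, b2⟩ := key 0
  refine ⟨ν₀, fun S => ?_, b2⟩
  have hfree : ∀ m₁ m₂ v' T', m₁ ≤ m₂ →
      none ∉ (rounds (exec c) (exec f) m₁ v' T').support →
      rounds (exec c) (exec f) m₂ v' T' = rounds (exec c) (exec f) m₁ v' T' := by
    intro m₁
    induction m₁ with
    | zero => intro m₂ v' T' _ hn; simp [rounds] at hn
    | succ m₁ ih =>
      intro m₂ v' T' hle hn
      obtain ⟨m₂, rfl⟩ := Nat.exists_eq_add_of_le' (le_trans (Nat.le_add_left 1 m₁) hle)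
      simp only [rounds, andThen] at hn ⊢
      refine bind_congr_support _ fun o ho => ?_
      rcases o with _ | ⟨b, T1⟩
      · rfl
      · have hn1 : none ∉ ((if b.truth then (exec f v' T1).bind fun o => match o with
            | none => PMF.pure none
            | some (w, T) => rounds (exec c) (exec f) m₁ w T
            else PMF.pure (some (v', T1))) : PMF Outcome).support := by
          intro hh
          exact hn ((PMF.mem_support_bind_iff _ _ _).2 ⟨_, ho, hh⟩)
        by_cases hb : b.truth
        · simp only [hb, if_true] at hn1 ⊢
          refine bind_congr_support _ fun o' ho' => ?_
          rcases o' with _ | ⟨w, T2⟩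
          · rfl
          · refine ih _ _ _ (by omega) fun hh => hn1 ?_
            exact (PMF.mem_support_bind_iff _ _ _).2 ⟨_, ho', hh⟩
        · simp [hb]
  show rounds (exec c) (exec f) (T + S + 1) v (T + S) = _
  rw [hfree (T + 0 + 1) (T + S + 1) v (T + S) (by omega), b1]
  rw [b1]
  simp

/-- Iteration of a random step. -/
def iter (F : Val → PMF Val) : ℕ → Val → PMF Val
  | 0, v => PMF.pure v
  | m + 1, v => (F v).bind (iter F m)

/-- The index of `Inv` is the number of rounds still to come, and `K` bounds the cost of one test
and of one execution of the body. -/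
theorem runs_loop_of_inv {c f : Prog} {F : Val → PMF Val} {K : ℕ} (Inv : ℕ → Val → Prop)
    (h0 : ∀ v, Inv 0 v → ∃ b, Runs c v K (PMF.pure b) ∧ b.truth = false)
    (h1 : ∀ m v, Inv (m + 1) v → ∃ b, Runs c v K (PMF.pure b) ∧ b.truth = true)
    (h2 : ∀ m v, Inv (m + 1) v → Runs f v K (F v))
    (h3 : ∀ m v, Inv (m + 1) v → ∀ w ∈ (F v).support, Inv m w)
    (m : ℕ) (v : Val) (hv : Inv m v) :
    Runs (.loop c f) v ((2 * K + 1) * (m + 1)) (iter F m v) := by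
  have key : ∀ m v, Inv m v → RunsRounds c f (m + 1) v ((2 * K) * m + K) (iter F m v) := by
    intro m
    induction m with
    | zero =>
      intro v hv
      obtain ⟨b, hb, hb'⟩ := h0 v hv
      simpa [iter] using runsRounds_done hb hb'
    | succ m ih =>
      intro v hv
      obtain ⟨b, hb, hb'⟩ := h1 m v hv
      have := runsRounds_step hb hb' (h2 m v hv) (fun w hw => ih w (h3 m v hv w hw))
      have e : 2 * K * (m + 1) + K = K + (K + (2 * K * m + K)) := by ring
      rw [e]; exact this
  -- The time bound is rounded up so that it also dominates the number `m + 1` of rounds, as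
  -- `runs_loop` demands.
  have hle : 2 * K * m + K ≤ (2 * K + 1) * (m + 1) := by nlinarith
  have : RunsRounds c f (m + 1) v ((2 * K + 1) * (m + 1)) (iter F m v) := by
    intro m' hm'
    obtain ⟨d, hd⟩ := Nat.exists_eq_add_of_le hle
    obtain ⟨ν, a1, a2⟩ := key m v hv m' hm'
    refine ⟨ν.map fun x => (x.1, x.2 + d), fun S => ?_, ?_⟩
    · rw [hd, add_assoc, a1, PMF.map_comp]
      congr 1; funext x; simp [add_assoc]
    · rw [PMF.map_comp]; exact a2
  exact runs_loop this (by nlinarith)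

/-! ### Additional time does not matter -/

/-- Add `S` to the time that is left. -/
def Outcome.shift (S : ℕ) : Outcome → Outcome := Option.map fun x => (x.1, x.2 + S)

theorem andThen_shift {x x' : PMF Outcome} {f f' : Val → ℕ → PMF Outcome} {S : ℕ}
    (hn : none ∉ (andThen x f).support)
    (hx : none ∉ x.support → x' = x.map (Outcome.shift S))
    (hf : ∀ w T, none ∉ (f w T).support → f' w (T + S) = (f w T).map (Outcome.shift S)) :
    andThen x' f' = (andThen x f).map (Outcome.shift S) := by
  have hx0 : none ∉ x.support := fun h => hn <| (PMF.mem_support_bind_iff _ _ _).2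
    ⟨none, h, by simp⟩
  rw [hx hx0]
  simp only [andThen, PMF.bind_map, PMF.map_bind]
  refine bind_congr_support _ fun o ho => ?_
  rcases o with _ | ⟨w, T⟩
  · exact absurd ho hx0
  · exact hf w T fun h => hn <| (PMF.mem_support_bind_iff _ _ _).2 ⟨_, ho, h⟩

theorem rounds_shift {c f : Val → ℕ → PMF Outcome} {S : ℕ}
    (hc : ∀ w T, none ∉ (c w T).support → c w (T + S) = (c w T).map (Outcome.shift S))
    (hf : ∀ w T, none ∉ (f w T).support → f w (T + S) = (f w T).map (Outcome.shift S)) :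
    ∀ m m' v T, m ≤ m' → none ∉ (rounds c f m v T).support →
      rounds c f m' v (T + S) = (rounds c f m v T).map (Outcome.shift S) := by
  intro m
  induction m with
  | zero => intro m' v T _ hn; simp [rounds] at hn
  | succ m ih =>
    intro m' v T hm hn
    obtain ⟨m', rfl⟩ := Nat.exists_eq_add_of_le' (le_trans (Nat.le_add_left 1 m) hm)
    simp only [rounds] at hn ⊢
    refine andThen_shift hn (hc v T) fun b T' hn' => ?_
    by_cases hb : b.truth
    · simp only [hb, if_true] at hn' ⊢
      exact andThen_shift hn' (hf v T') fun w T'' h => ih m' w T'' (by omega) h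
    · simp [hb, PMF.pure_map, Outcome.shift]

/-- A `PPT` promises to halt only for the one time budget given by its polynomial. As a subroutine
it runs inside a larger budget, and this lemma transfers the promise. -/
theorem exec_shift (P : Prog) (S : ℕ) : ∀ v T, none ∉ (exec P v T).support →
    exec P v (T + S) = (exec P v T).map (Outcome.shift S) := by
  induction P with
  | prim o =>
    intro v T hn
    simp only [exec, PMF.pure_map, charge] at hn ⊢
    by_cases h : 1 + v.size ≤ T
    · have h' : 1 + v.size ≤ T + S := by omega
      simp only [h, h', if_true, Outcome.shift, Option.map_some]
      congr 3; omega
    · simp [h] at hn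
  | rand =>
    intro v T hn
    simp only [exec, charge] at hn ⊢
    by_cases h : 1 + v.size ≤ T
    · have h' : 1 + v.size ≤ T + S := by omega
      rw [PMF.map_comp]
      congr 1; funext w
      simp only [h, h', if_true, Outcome.shift, Option.map_some, Function.comp]
      congr 2; omega
    · exfalso; apply hn
      obtain ⟨w, hw⟩ := (randNum v.toInt.toNat).support_nonempty
      rw [PMF.mem_support_map_iff]
      exact ⟨w, hw, by simp [h]⟩
  | comp f g hf hg =>
    intro v T hn
    exact andThen_shift hn (hf v T) hg
  | pair f g hf hg =>
    intro v T hn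
    refine andThen_shift hn (hf v T) fun a T' hn' => ?_
    exact andThen_shift hn' (hg v T') fun b T'' _ => by simp [PMF.pure_map, Outcome.shift]
  | ite c f g hc hf hg =>
    intro v T hn
    refine andThen_shift hn (hc v T) fun b T' hn' => ?_
    split_ifs at hn' ⊢
    · exact hf v T' hn'
    · exact hg v T' hn'
  | loop c f hc hf =>
    intro v T hn
    exact rounds_shift hc hf _ _ _ _ (by omega) hn

theorem PPT.runs (A : PPT) (n : ℕ) (x : Val) :
    Runs A.prog (.pair (.num n) x) (A.bound.eval (n + x.size)) (A.run n x) := by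
  have hn := A.halts n x
  -- The default value of `getD` is never met, because `none` has probability zero.
  refine ⟨(exec A.prog (.pair (.num n) x) (A.bound.eval (n + x.size))).map
    fun o => o.getD (.num 0, 0), fun S => ?_, ?_⟩
  · rw [exec_shift _ _ _ _ hn, PMF.map_comp]
    refine bind_congr_support _ fun o ho => ?_
    rcases o with _ | ⟨w, T⟩
    · exact absurd ho hn
    · rfl
  · rw [PMF.map_comp, PPT.run]
    congr 1; funext o
    rcases o with _ | ⟨w, T⟩ <;> rfl

/-- A program with a time bound that is polynomial in `n` and the length of the input. -/
def PPT.ofRuns (P : Prog) (b : ℕ[X]) (F : ℕ → Val → PMF Val)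
    (h : ∀ n x, Runs P (.pair (.num (n : ℕ)) x) (b.eval (n + x.size)) (F n x)) : PPT where
  prog := P
  bound := b
  halts n x := by
    obtain ⟨ν, a1, -⟩ := h n x
    have := a1 0
    rw [add_zero] at this
    rw [this]
    simp

theorem PPT.ofRuns_run (P : Prog) (b : ℕ[X]) (F : ℕ → Val → PMF Val)
    (h : ∀ n x, Runs P (.pair (.num (n : ℕ)) x) (b.eval (n + x.size)) (F n x)) (n : ℕ) (x : Val) :
    (PPT.ofRuns P b F h).run n x = F n x := by
  obtain ⟨ν, a1, a2⟩ := h n x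
  have := a1 0
  rw [add_zero] at this
  simp only [PPT.run, PPT.ofRuns, this, PMF.map_comp]
  exact a2

/-! ### The size of the output -/

theorem Val.one_le_size (v : Val) : 1 ≤ v.size := by
  cases v <;> simp [Val.size, add_assoc]

theorem size_le_of_natAbs_le {a b : ℤ} (h : a.natAbs ≤ b.natAbs) :
    (Val.num a).size ≤ (Val.num b).size := by
  simp only [Val.size]
  exact Nat.add_le_add_left (Nat.size_le_size h) 1

theorem Val.size_toInt_le (v : Val) : v.toInt.natAbs.size ≤ v.size := by
  cases v <;> simp [Val.toInt, Val.size]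

theorem Val.size_fst_le (v : Val) : v.fst.size ≤ v.size := by
  cases v <;> simp [Val.fst, Val.size] <;> omega

theorem Val.size_snd_le (v : Val) : v.snd.size ≤ v.size := by
  cases v <;> simp [Val.snd, Val.size]

theorem Val.size_fst_add_size_snd_le (v : Val) : v.fst.size + v.snd.size ≤ v.size + 2 := by
  cases v <;> simp [Val.fst, Val.snd, Val.size] <;> omega

theorem nat_size_add_le (a b : ℕ) : (a + b).size ≤ a.size + b.size + 1 := by
  rw [Nat.size_le]
  have h1 := Nat.lt_size_self a
  have h2 := Nat.lt_size_self b
  have h3 : 2 ^ a.size ≤ 2 ^ (a.size + b.size) := Nat.pow_le_pow_right (by norm_num) (by omega)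
  have h4 : 2 ^ b.size ≤ 2 ^ (a.size + b.size) := Nat.pow_le_pow_right (by norm_num) (by omega)
  rw [pow_succ]; omega

theorem nat_size_mul_le (a b : ℕ) : (a * b).size ≤ a.size + b.size := by
  rw [Nat.size_le, pow_add]
  exact Nat.mul_lt_mul'' (Nat.lt_size_self a) (Nat.lt_size_self b)

theorem int_size_add_le (a b : ℤ) : (a + b).natAbs.size ≤ a.natAbs.size + b.natAbs.size + 1 :=
  (Nat.size_le_size (Int.natAbs_add_le a b)).trans (nat_size_add_le _ _)

theorem int_size_sub_le (a b : ℤ) : (a - b).natAbs.size ≤ a.natAbs.size + b.natAbs.size + 1 :=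
  (Nat.size_le_size (Int.natAbs_sub_le a b)).trans (nat_size_add_le _ _)

theorem int_size_mul_le (a b : ℤ) : (a * b).natAbs.size ≤ a.natAbs.size + b.natAbs.size := by
  rw [Int.natAbs_mul]; exact nat_size_mul_le _ _

theorem int_size_div_le (a b : ℤ) : (a / b).natAbs.size ≤ a.natAbs.size :=
  Nat.size_le_size (Int.natAbs_ediv_le_natAbs a b)

theorem Prim.exists_size_le (o : Prim) : ∃ K, 1 ≤ K ∧ ∀ v, (o.eval v).size ≤ K * (1 + v.size) := by
  have two : ∀ v : Val, v.fst.toInt.natAbs.size + v.snd.toInt.natAbs.size ≤ v.size + 2 := fun v =>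
    (Nat.add_le_add v.fst.size_toInt_le v.snd.size_toInt_le).trans v.size_fst_add_size_snd_le
  cases o with
  | id => exact ⟨1, le_rfl, fun v => by simp [Prim.eval]⟩
  | fst => exact ⟨1, le_rfl, fun v => by simpa [Prim.eval] using v.size_fst_le.trans (by omega)⟩
  | snd => exact ⟨1, le_rfl, fun v => by simpa [Prim.eval] using v.size_snd_le.trans (by omega)⟩
  | isPair => exact ⟨2, by norm_num, fun v => by cases v <;> simp [Prim.eval, Val.size] <;> omega⟩
  | add => exact ⟨4, by norm_num, fun v => by
      have := two v; have := int_size_add_le v.fst.toInt v.snd.toInt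
      simp only [Prim.eval, Val.size]; omega⟩
  | sub => exact ⟨4, by norm_num, fun v => by
      have := two v; have := int_size_sub_le v.fst.toInt v.snd.toInt
      simp only [Prim.eval, Val.size]; omega⟩
  | mul => exact ⟨4, by norm_num, fun v => by
      have := two v; have := int_size_mul_le v.fst.toInt v.snd.toInt
      simp only [Prim.eval, Val.size]; omega⟩
  | div => exact ⟨4, by norm_num, fun v => by
      have := two v; have := int_size_div_le v.fst.toInt v.snd.toInt
      simp only [Prim.eval, Val.size]; omega⟩
  | le => exact ⟨2, by norm_num, fun v => by
      simp only [Prim.eval]; split_ifs <;> simp [Val.size] <;> omega⟩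
  | const z => exact ⟨1 + (Val.num z).size, by omega, fun v => by
      simp only [Prim.eval]; nlinarith [(Val.num z).one_le_size]⟩

theorem mem_support_andThen {x : PMF Outcome} {f : Val → ℕ → PMF Outcome} {o : Val × ℕ}
    (h : some o ∈ (andThen x f).support) :
    ∃ w T, some (w, T) ∈ x.support ∧ some o ∈ (f w T).support := by
  obtain ⟨o', h1, h2⟩ := (PMF.mem_support_bind_iff _ _ _).1 h
  rcases o' with _ | ⟨w, T⟩
  · simp at h2
  · exact ⟨w, T, h1, h2⟩

/-- The definition of `randNum` unfolds to a sample that is first moved to `ℕ` and then to the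
leaves; here the two steps are merged into a single map. -/
theorem randNum_succ (m : ℕ) : randNum (m + 1) =
    (PMF.uniformOfFintype (Fin (m + 1))).map (fun i : Fin (m + 1) => Val.num ((i : ℕ) : ℤ)) := by
  show ((PMF.uniformOfFintype (Fin (m + 1))).bind fun a => PMF.pure (a : ℕ)).map
    (fun i : ℕ => Val.num (i : ℤ)) = _
  rw [PMF.map_bind]
  simp only [PMF.pure_map]
  rfl

theorem randNum_support {k : ℕ} {w : Val} (h : w ∈ (randNum k).support) :
    ∃ i : ℕ, i ≤ k ∧ w = .num i := by
  cases k with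
  | zero => simp [randNum] at h; exact ⟨0, le_rfl, by simpa using h⟩
  | succ m =>
    rw [randNum_succ, PMF.mem_support_map_iff] at h
    obtain ⟨i, -, rfl⟩ := h
    exact ⟨i, i.2.le, rfl⟩

/-- Each elementary operation pays for the size of its argument, so the time consumed, `T - r`,
exceeds the size of the input and bounds the size of the output up to a constant that depends on the
program only. Without the latter, polynomial time would not be closed under composition. -/
theorem exec_size (P : Prog) : ∃ K, 1 ≤ K ∧ ∀ v T w r, some (w, r) ∈ (exec P v T).support →
    r + 1 + v.size ≤ T ∧ w.size ≤ K * (T - r) := by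
  induction P with
  | prim o =>
    obtain ⟨K, hK, h⟩ := o.exists_size_le
    refine ⟨K, hK, fun v T w r hs => ?_⟩
    simp only [exec, charge, PMF.mem_support_pure_iff] at hs
    split_ifs at hs with hle
    simp only [Option.some.injEq, Prod.mk.injEq] at hs
    obtain ⟨rfl, rfl⟩ := hs
    exact ⟨by omega, (h v).trans (Nat.mul_le_mul_left _ (by omega))⟩
  | rand =>
    refine ⟨1, le_rfl, fun v T w r hs => ?_⟩
    simp only [exec, charge, PMF.mem_support_map_iff] at hs
    obtain ⟨w', hw', hs⟩ := hs
    split_ifs at hs with hle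
    simp only [Option.some.injEq, Prod.mk.injEq] at hs
    obtain ⟨rfl, rfl⟩ := hs
    obtain ⟨i, hi, rfl⟩ := randNum_support hw'
    have h1 : (Val.num i).size ≤ 1 + v.size := by
      simp only [Val.size, Int.natAbs_natCast]
      have := Nat.size_le_size (show i ≤ v.toInt.natAbs by omega)
      have := v.size_toInt_le
      omega
    exact ⟨by omega, by omega⟩
  | comp f g hf hg =>
    obtain ⟨K1, hK1, h1⟩ := hf
    obtain ⟨K2, hK2, h2⟩ := hg
    refine ⟨K2, hK2, fun v T w r hs => ?_⟩
    obtain ⟨w', T', a, b⟩ := mem_support_andThen hs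
    have c1 := h1 _ _ _ _ a
    have c2 := h2 _ _ _ _ b
    exact ⟨by omega, c2.2.trans (Nat.mul_le_mul_left _ (by omega))⟩
  | pair f g hf hg =>
    obtain ⟨K1, hK1, h1⟩ := hf
    obtain ⟨K2, hK2, h2⟩ := hg
    refine ⟨K1 + K2 + 1, by omega, fun v T w r hs => ?_⟩
    obtain ⟨a, T', ha, hs⟩ := mem_support_andThen hs
    obtain ⟨b, T'', hb, hs⟩ := mem_support_andThen hs
    simp only [PMF.mem_support_pure_iff, Option.some.injEq, Prod.mk.injEq] at hs
    obtain ⟨rfl, rfl⟩ := hs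
    have c1 := h1 _ _ _ _ ha
    have c2 := h2 _ _ _ _ hb
    refine ⟨by omega, ?_⟩
    simp only [Val.size]
    have e1 : K1 * (T - T') ≤ K1 * (T - r) := Nat.mul_le_mul_left _ (by omega)
    have e2 : K2 * (T' - r) ≤ K2 * (T - r) := Nat.mul_le_mul_left _ (by omega)
    have e3 : 1 ≤ T - r := by omega
    rw [add_mul, add_mul]
    omega
  | ite c f g hc hf hg =>
    obtain ⟨K0, hK0, h0⟩ := hc
    obtain ⟨K1, hK1, h1⟩ := hf
    obtain ⟨K2, hK2, h2⟩ := hg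
    refine ⟨K1 + K2, by omega, fun v T w r hs => ?_⟩
    obtain ⟨b, T', hb, hs⟩ := mem_support_andThen hs
    have c0 := h0 _ _ _ _ hb
    split_ifs at hs
    · have c1 := h1 _ _ _ _ hs
      exact ⟨by omega, c1.2.trans (Nat.mul_le_mul (by omega) (by omega))⟩
    · have c1 := h2 _ _ _ _ hs
      exact ⟨by omega, c1.2.trans (Nat.mul_le_mul (by omega) (by omega))⟩
  | loop c f hc hf =>
    obtain ⟨K0, hK0, h0⟩ := hc
    obtain ⟨K1, hK1, h1⟩ := hf
    -- The constant is 1 whatever the body is: the last test reads the final datum and pays for its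
    -- size.
    refine ⟨1, le_rfl, ?_⟩
    have key : ∀ m v T w r, some (w, r) ∈ (rounds (exec c) (exec f) m v T).support →
        r + 1 + v.size ≤ T ∧ w.size ≤ 1 * (T - r) := by
      intro m
      induction m with
      | zero => intro v T w r hs; simp [rounds] at hs
      | succ m ih =>
        intro v T w r hs
        obtain ⟨b, T', hb, hs⟩ := mem_support_andThen hs
        have c0 := h0 _ _ _ _ hb
        split_ifs at hs
        · obtain ⟨v', T'', hv', hs⟩ := mem_support_andThen hs
          have c1 := h1 _ _ _ _ hv'
          have c2 := ih _ _ _ _ hs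
          omega
        · simp only [PMF.mem_support_pure_iff, Option.some.injEq, Prod.mk.injEq] at hs
          obtain ⟨rfl, rfl⟩ := hs
          omega
    intro v T w r hs
    exact key _ _ _ _ _ hs

theorem Prog.exists_size_le (P : Prog) : ∃ K, ∀ v T p, Runs P v T p →
    v.size ≤ T ∧ ∀ w ∈ p.support, w.size ≤ K * T := by
  obtain ⟨K, -, hK⟩ := exec_size P
  refine ⟨K, fun v T p ⟨ν, a1, a2⟩ => ?_⟩
  have key : ∀ x ∈ ν.support, v.size ≤ T ∧ x.1.size ≤ K * T := by
    intro x hx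
    have hs : some x ∈ (exec P v T).support := by
      have := a1 0
      rw [add_zero] at this
      rw [this, PMF.mem_support_map_iff]
      exact ⟨x, hx, rfl⟩
    have := hK v T x.1 x.2 hs
    exact ⟨by omega, this.2.trans (Nat.mul_le_mul_left _ (by omega))⟩
  refine ⟨?_, fun w hw => ?_⟩
  · obtain ⟨x, hx⟩ := ν.support_nonempty
    exact (key x hx).1
  · rw [← a2, PMF.mem_support_map_iff] at hw
    obtain ⟨x, hx, rfl⟩ := hw
    exact (key x hx).2

/-! ## Polynomial time in the size of the input -/

theorem eval_mono_nat (p : ℕ[X]) {a b : ℕ} (h : a ≤ b) : p.eval a ≤ p.eval b := by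
  rw [Polynomial.eval_eq_sum, Polynomial.eval_eq_sum]
  exact Finset.sum_le_sum fun i _ => Nat.mul_le_mul_left _ (Nat.pow_le_pow_left h i)

/-- `F` is computed by a program in time polynomial in the size of the input. -/
def PP (F : Val → PMF Val) : Prop :=
  ∃ (P : Prog) (b : ℕ[X]), ∀ v, Runs P v (b.eval v.size) (F v)

/-- The deterministic functions that are computed in polynomial time. -/
@[fun_prop]
def FP (f : Val → Val) : Prop := PP fun v => PMF.pure (f v)

/-- With notation for the arithmetical operations, programs can be written as terms, and `fun_prop`
proves that they are polynomial. -/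
instance : Add Val := ⟨fun a b => .num (a.toInt + b.toInt)⟩
instance : Sub Val := ⟨fun a b => .num (a.toInt - b.toInt)⟩
instance : Mul Val := ⟨fun a b => .num (a.toInt * b.toInt)⟩
instance : Div Val := ⟨fun a b => .num (a.toInt / b.toInt)⟩

@[simp] theorem Val.toInt_num (z : ℤ) : (Val.num z).toInt = z := rfl
@[simp] theorem Val.fst_pair (a b : Val) : (Val.pair a b).fst = a := rfl
@[simp] theorem Val.snd_pair (a b : Val) : (Val.pair a b).snd = b := rfl
@[simp] theorem Val.toInt_add (a b : Val) : (a + b).toInt = a.toInt + b.toInt := rfl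
@[simp] theorem Val.toInt_sub (a b : Val) : (a - b).toInt = a.toInt - b.toInt := rfl
@[simp] theorem Val.toInt_mul (a b : Val) : (a * b).toInt = a.toInt * b.toInt := rfl
@[simp] theorem Val.toInt_div (a b : Val) : (a / b).toInt = a.toInt / b.toInt := rfl

/-- Comparison of leaves. -/
def Val.le (a b : Val) : Val := .num (if a.toInt ≤ b.toInt then 1 else 0)

/-- Case distinction. -/
def Val.ite (c a b : Val) : Val := if c.truth then a else b

theorem Val.ite_le (a b c d : Val) :
    Val.ite (Val.le a b) c d = if a.toInt ≤ b.toInt then c else d := by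
  unfold Val.ite Val.le
  by_cases h : a.toInt ≤ b.toInt <;> simp [h, Val.truth]

/-- The intermediate datum has polynomial size by `Prog.exists_size_le`, so the second time bound is
evaluated at a polynomial. -/
theorem PP.comp {F G : Val → PMF Val} (hG : PP G) (hF : PP F) : PP fun v => (F v).bind G := by
  obtain ⟨P, b, hP⟩ := hF
  obtain ⟨Q, d, hQ⟩ := hG
  obtain ⟨K, hK⟩ := P.exists_size_le
  refine ⟨.comp P Q, b + d.comp (C K * b), fun v => ?_⟩
  have h2 : ∀ w ∈ (F v).support, Runs Q w (d.eval (K * b.eval v.size)) (G w) := fun w hw =>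
    (hQ w).mono (eval_mono_nat d ((hK v _ _ (hP v)).2 w hw))
  simpa using runs_comp (hP v) h2

theorem FP.comp_PP {G : Val → PMF Val} {f : Val → Val} (hG : PP G) (hf : FP f) :
    PP fun v => G (f v) := by
  simpa [PMF.pure_bind] using PP.comp hG hf

@[fun_prop]
theorem FP.comp {g f : Val → Val} (hg : FP g) (hf : FP f) : FP fun v => g (f v) :=
  FP.comp_PP (G := fun v => PMF.pure (g v)) hg hf

theorem PP.pairing {F G : Val → PMF Val} (hF : PP F) (hG : PP G) :
    PP fun v => (F v).bind fun a => (G v).map fun b => .pair a b := by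
  obtain ⟨P, b, hP⟩ := hF
  obtain ⟨Q, d, hQ⟩ := hG
  exact ⟨.pair P Q, b + d, fun v => by simpa using runs_pair (hP v) (hQ v)⟩

@[fun_prop]
theorem FP.pair {f g : Val → Val} (hf : FP f) (hg : FP g) : FP fun v => .pair (f v) (g v) := by
  simpa [FP, PMF.pure_bind, PMF.pure_map] using PP.pairing hf hg

theorem fp_prim (o : Prim) : FP o.eval :=
  ⟨.prim o, 1 + X, fun v => by simpa using runs_prim o v⟩

@[fun_prop]
theorem FP.id : FP fun v => v := fp_prim .id

@[fun_prop]
theorem FP.fst {f : Val → Val} (hf : FP f) : FP fun v => (f v).fst := FP.comp (fp_prim .fst) hf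

@[fun_prop]
theorem FP.snd {f : Val → Val} (hf : FP f) : FP fun v => (f v).snd := FP.comp (fp_prim .snd) hf

@[fun_prop]
theorem FP.const (c : Val) : FP fun _ => c := by
  induction c with
  | num z => exact fp_prim (.const z)
  | pair a b ha hb => exact ha.pair hb

@[fun_prop]
theorem FP.add {f g : Val → Val} (hf : FP f) (hg : FP g) : FP fun v => f v + g v :=
  FP.comp (fp_prim .add) (hf.pair hg)

@[fun_prop]
theorem FP.sub {f g : Val → Val} (hf : FP f) (hg : FP g) : FP fun v => f v - g v :=
  FP.comp (fp_prim .sub) (hf.pair hg)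

@[fun_prop]
theorem FP.mul {f g : Val → Val} (hf : FP f) (hg : FP g) : FP fun v => f v * g v :=
  FP.comp (fp_prim .mul) (hf.pair hg)

@[fun_prop]
theorem FP.div {f g : Val → Val} (hf : FP f) (hg : FP g) : FP fun v => f v / g v :=
  FP.comp (fp_prim .div) (hf.pair hg)

@[fun_prop]
theorem FP.le {f g : Val → Val} (hf : FP f) (hg : FP g) : FP fun v => Val.le (f v) (g v) :=
  FP.comp (fp_prim .le) (hf.pair hg)

theorem PP.ite {c : Val → Val} {F G : Val → PMF Val} (hc : FP c) (hF : PP F) (hG : PP G) :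
    PP fun v => if (c v).truth then F v else G v := by
  obtain ⟨R, r, hR⟩ := hc
  obtain ⟨P, b, hP⟩ := hF
  obtain ⟨Q, d, hQ⟩ := hG
  refine ⟨.ite R P Q, r + (b + d), fun v => ?_⟩
  have := runs_ite (f := P) (g := Q) (T2 := b.eval v.size + d.eval v.size) (hR v)
    (q := fun w => if w.truth then F v else G v) (fun w _ => by
      split_ifs
      · exact (hP v).mono (Nat.le_add_right _ _)
      · exact (hQ v).mono (Nat.le_add_left _ _))
  simpa [PMF.pure_bind] using this

@[fun_prop]
theorem FP.ite {c f g : Val → Val} (hc : FP c) (hf : FP f) (hg : FP g) :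
    FP fun v => Val.ite (c v) (f v) (g v) := by
  have := PP.ite hc hf hg
  unfold FP Val.ite
  convert this using 2
  exact apply_ite PMF.pure _ _ _

/-- The continuation still sees the original input besides the sample. Repeated use treats a program
with several random variables, each stored in front of the earlier ones. -/
theorem PP.bind {F : Val → PMF Val} {G : Val → Val → PMF Val} (hF : PP F)
    (hG : PP fun p => G p.fst p.snd) : PP fun v => (F v).bind fun w => G w v := by
  have := PP.comp hG (PP.pairing hF FP.id)
  simpa [PMF.pure_map, PMF.bind_bind, PMF.pure_bind] using this

theorem PP.rand {f : Val → Val} (hf : FP f) : PP fun v => randNum (f v).toInt.toNat :=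
  FP.comp_PP (G := fun v => randNum v.toInt.toNat)
    ⟨.rand, 1 + X, fun v => by simpa using runs_rand v⟩ hf

theorem PP.exists_size_le {F : Val → PMF Val} (hF : PP F) :
    ∃ b : ℕ[X], ∀ v, ∀ w ∈ (F v).support, w.size ≤ b.eval v.size := by
  obtain ⟨P, b, hP⟩ := hF
  obtain ⟨K, hK⟩ := P.exists_size_le
  exact ⟨C K * b, fun v w hw => by simpa using (hK v _ _ (hP v)).2 w hw⟩

theorem FP.exists_size_le {f : Val → Val} (hf : FP f) :
    ∃ b : ℕ[X], ∀ v, (f v).size ≤ b.eval v.size := by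
  obtain ⟨b, hb⟩ := PP.exists_size_le hf
  exact ⟨b, fun v => hb v _ (by simp)⟩

/-- A program that is fast on the range of `f`, between two others. -/
theorem PP.sandwich {f : Val → Val} {G H : Val → PMF Val} (hf : FP f)
    (hG : ∃ (Q : Prog) (b : ℕ[X]), ∀ v, Runs Q (f v) (b.eval (f v).size) (G v)) (hH : PP H) :
    PP fun v => (G v).bind H := by
  obtain ⟨Q, d, hQ⟩ := hG
  obtain ⟨P, b, hP⟩ := hf
  obtain ⟨K, hK⟩ := P.exists_size_le
  refine PP.comp hH ⟨.comp P Q, b + d.comp (C K * b), fun v => ?_⟩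
  have hsize := (hK v _ _ (hP v)).2 _ ((PMF.mem_support_pure_iff _ _).2 rfl)
  have := runs_comp (hP v) (g := Q) (T2 := d.eval (K * b.eval v.size)) (κ := fun _ => G v)
    fun w hw => by
      rw [PMF.mem_support_pure_iff] at hw
      subst hw
      exact (hQ v).mono (eval_mono_nat d hsize)
  simpa [PMF.pure_bind] using this

/-! ### Folds over lists -/

/-- A fold of a random step over a list. -/
def foldM (G : Val → Val → Val → PMF Val) (e : Val) : List Val → Val → PMF Val
  | [], s => PMF.pure s
  | x :: l, s => (G x s e).bind (foldM G e l)

theorem Val.length_toList_le (v : Val) : v.toList.length ≤ v.size := by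
  induction v with
  | num z => simp [Val.toList]
  | pair a b _ ih => simp only [Val.toList, List.length_cons, Val.size]; omega

theorem Val.size_pair (a b : Val) : (Val.pair a b).size = 1 + a.size + b.size := rfl

/-- The growth condition for folds: a step adds to the state at most a polynomial in the size of
the list entry and the environment. -/
def Grows (G : Val → Val → Val → PMF Val) : Prop :=
  ∃ b : ℕ[X], ∀ x s e, ∀ w ∈ (G x s e).support, w.size ≤ s.size + b.eval (x.size + e.size)

/-- A polynomial step alone would not suffice, since a state may double in each round. Under `Grows`
each round adds an amount that does not depend on the state, so the state stays polynomial over the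
whole list. The loop works on `((list, state), environment)` and stops when the list is a leaf. -/
theorem PP.foldM {G : Val → Val → Val → PMF Val}
    (hG : PP fun p => G p.fst p.snd.fst p.snd.snd) (hgr : Grows G) {L S E : Val → Val}
    (hL : FP L) (hS : FP S) (hE : FP E) :
    PP fun v => foldM G (E v) (L v).toList (S v) := by
  have hc : FP fun v => Prim.isPair.eval v.fst.fst := FP.comp (fp_prim .isPair) (by fun_prop)
  set stepF : Val → PMF Val := fun v => (G v.fst.fst.fst v.fst.snd v.snd).bind fun w =>
    PMF.pure (.pair (.pair v.fst.fst.snd w) v.snd) with hstep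
  have hf : PP stepF := by
    refine PP.bind (F := fun v => G v.fst.fst.fst v.fst.snd v.snd)
      (G := fun w v => PMF.pure (.pair (.pair v.fst.fst.snd w) v.snd)) ?_ ?_
    · exact FP.comp_PP (f := fun v => .pair v.fst.fst.fst (.pair v.fst.snd v.snd)) hG (by fun_prop)
    · exact (by fun_prop : FP fun p => .pair (.pair p.snd.fst.fst.snd p.fst) p.snd.snd)
  have hpre : FP fun v => Val.pair (.pair (L v) (S v)) (E v) := by fun_prop
  have hpost : FP fun v => v.fst.snd := by fun_prop
  obtain ⟨Pc, bc, hPc⟩ := hc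
  obtain ⟨Pf, bf, hPf⟩ := hf
  obtain ⟨g, hg⟩ := hgr
  let Z : ℕ[X] := 2 + 4 * X + X * g.comp (2 * X)
  let K : ℕ[X] := (bc + bf).comp Z
  have main : ∀ l s e, Runs (.loop Pc Pf) (.pair (.pair l s) e)
      (((2 * K + 1) * (X + 1)).eval (Val.pair (.pair l s) e).size)
      (iter stepF l.toList.length (.pair (.pair l s) e)) := by
    intro l₀ s₀ e
    set N := (Val.pair (.pair l₀ s₀) e).size with hN
    have hN' : N = 1 + (1 + l₀.size + s₀.size) + e.size := rfl
    -- Potential argument: each of the `i` remaining entries may still add `g (2N)`, because an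
    -- entry and the environment together have size at most `2N`.
    let Inv : ℕ → Val → Prop := fun i v => ∃ l s, v = .pair (.pair l s) e ∧ l.toList.length = i ∧
      l.size ≤ N ∧ s.size + i * g.eval (2 * N) ≤ N + N * g.eval (2 * N)
    have hsize : ∀ i v, Inv i v → v.size ≤ Z.eval N := by
      rintro i v ⟨l, s, rfl, -, hl, hs⟩
      have : e.size ≤ N := by omega
      simp only [Val.size, Z, eval_add, eval_mul, eval_X, eval_comp, eval_ofNat]
      have : 1 ≤ N := by omega
      have := Nat.zero_le (i * g.eval (2 * N))
      omega
    have hcK : ∀ i v, Inv i v → bc.eval v.size ≤ K.eval N := fun i v hv => by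
      simp only [K, eval_comp, eval_add]
      exact (eval_mono_nat bc (hsize i v hv)).trans (Nat.le_add_right _ _)
    have hfK : ∀ i v, Inv i v → bf.eval v.size ≤ K.eval N := fun i v hv => by
      simp only [K, eval_comp, eval_add]
      exact (eval_mono_nat bf (hsize i v hv)).trans (Nat.le_add_left _ _)
    have hlen : l₀.toList.length ≤ N := l₀.length_toList_le.trans (by omega)
    refine (runs_loop_of_inv (c := Pc) (f := Pf) (F := stepF) (K := K.eval N) Inv ?_ ?_ ?_ ?_
      l₀.toList.length _ ?_).mono ?_
    · rintro v ⟨l, s, rfl, hl, hl'⟩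
      refine ⟨.num 0, ?_, rfl⟩
      have h := hPc (.pair (.pair l s) e)
      rcases l with z | ⟨a, b⟩
      · exact h.mono (hcK 0 _ ⟨_, s, rfl, hl, hl'⟩)
      · simp [Val.toList] at hl
    · rintro m v ⟨l, s, rfl, hl, hl'⟩
      refine ⟨.num 1, ?_, rfl⟩
      have h := hPc (.pair (.pair l s) e)
      rcases l with z | ⟨a, b⟩
      · simp [Val.toList] at hl
      · exact h.mono (hcK (m + 1) _ ⟨_, s, rfl, hl, hl'⟩)
    · exact fun m v hv => (hPf v).mono (hfK _ v hv)
    · rintro m v ⟨l, s, rfl, hl, hl1, hl2⟩ w hw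
      rcases l with z | ⟨x, l⟩
      · simp [Val.toList] at hl
      simp only [hstep, Val.fst_pair, Val.snd_pair, PMF.mem_support_bind_iff,
        PMF.mem_support_pure_iff] at hw
      obtain ⟨s', hs', rfl⟩ := hw
      simp only [Val.toList, List.length_cons, add_left_inj] at hl
      simp only [Val.size] at hl1
      refine ⟨l, s', rfl, hl, by omega, ?_⟩
      have h1 := hg _ _ _ _ hs'
      have h2 := eval_mono_nat g (show x.size + e.size ≤ 2 * N by omega)
      rw [add_mul, one_mul] at hl2
      omega
    · exact ⟨l₀, s₀, rfl, rfl, by omega, by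
        have := Nat.mul_le_mul_right (g.eval (2 * N)) hlen
        omega⟩
    · simp only [eval_mul, eval_add, eval_one, eval_X, eval_ofNat]
      exact Nat.mul_le_mul_left _ (by omega)
  have hiter : ∀ l s e, (iter stepF l.toList.length (.pair (.pair l s) e)).bind
      (fun v => PMF.pure v.fst.snd) = LatticeID.foldM G e l.toList s := by
    intro l s e
    induction l generalizing s with
    | num z => simp [Val.toList, iter, LatticeID.foldM, PMF.pure_bind]
    | pair x l _ ih =>
      simp only [Val.toList, List.length_cons, iter, LatticeID.foldM]
      rw [hstep]
      simp only [Val.fst_pair, Val.snd_pair, PMF.bind_bind, PMF.pure_bind]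
      refine congrArg _ (funext fun s' => ?_)
      exact ih s'
  have := PP.sandwich hpre ⟨_, _, fun v => main (L v) (S v) (E v)⟩ hpost
  simpa only [hiter] using this

/-- A deterministic fold. -/
def fold (g : Val → Val → Val → Val) (e : Val) (l : List Val) (s : Val) : Val :=
  l.foldl (fun s x => g x s e) s

theorem foldM_pure (g : Val → Val → Val → Val) (e : Val) (l : List Val) (s : Val) :
    foldM (fun x s e => PMF.pure (g x s e)) e l s = PMF.pure (fold g e l s) := by
  induction l generalizing s with
  | nil => rfl
  | cons x l ih => simp [foldM, PMF.pure_bind, ih, fold]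

theorem FP.fold {g : Val → Val → Val → Val} (hg : FP fun p => g p.fst p.snd.fst p.snd.snd)
    (hgr : ∃ b : ℕ[X], ∀ x s e, (g x s e).size ≤ s.size + b.eval (x.size + e.size))
    {L S E : Val → Val} (hL : FP L) (hS : FP S) (hE : FP E) :
    FP fun v => fold g (E v) (L v).toList (S v) := by
  have := PP.foldM (G := fun x s e => PMF.pure (g x s e)) hg (by
    obtain ⟨b, hb⟩ := hgr
    refine ⟨b, fun x s e w hw => ?_⟩
    rw [PMF.mem_support_pure_iff] at hw
    exact hw ▸ hb x s e) hL hS hE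
  simp only [foldM_pure] at this
  exact this

/-! ### Binary digits -/

/-- The list of the binary digits of a leaf, the most significant one first. -/
def bits (v : Val) : Val :=
  .ofList ((Nat.digits 2 v.toInt.toNat).reverse.map fun d : ℕ => .num (d : ℤ))

theorem length_digits_le_size (m : ℕ) : (Nat.digits 2 m).length ≤ m.size := by
  rw [Nat.digits_length_le_iff (by norm_num)]
  exact Nat.lt_size_self m

-- Repeated halving, each remainder being pushed in front of the earlier ones, which puts the most
-- significant digit first. A digit adds at most 3 to the size of the output; the invariant reserves
-- 4. The digits drive square-and-multiply and yield `log n`.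
@[fun_prop]
theorem FP.bits {f : Val → Val} (hf : FP f) : FP fun v => bits (f v) := by
  let c : Val → Val := fun v => Val.le (.num 1) v.fst
  let st : Val → Val := fun v =>
    .pair (v.fst / .num 2) (.pair (v.fst - v.fst / .num 2 * .num 2) v.snd)
  have hc : FP c := by fun_prop
  have hst : FP st := by fun_prop
  have hpre : FP fun v => Val.pair (f v) (.num 0) := by fun_prop
  have hpost : FP fun v => v.snd := by fun_prop
  obtain ⟨Pc, bc, hPc⟩ := hc
  obtain ⟨Pf, bf, hPf⟩ := hst
  let Z : ℕ[X] := 1 + 8 * X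
  let K : ℕ[X] := (bc + bf).comp Z
  have main : ∀ v₀, ∃ w, Runs (.loop Pc Pf) (.pair v₀ (.num 0))
      (((2 * K + 1) * (X + 1)).eval (Val.pair v₀ (.num 0)).size)
      (PMF.pure (.pair w (LatticeID.bits v₀))) := by
    intro v₀
    set N := (Val.pair v₀ (.num 0)).size with hN
    have hN' : N = 1 + v₀.size + 1 := by rw [hN]; simp [Val.size]
    let Inv : ℕ → Val → Prop := fun i v => ∃ a acc, v = .pair a acc ∧
      (Nat.digits 2 a.toInt.toNat).length = i ∧ a.size ≤ N ∧ acc.size + i * 4 ≤ N * 5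
    have hsize : ∀ i v, Inv i v → v.size ≤ Z.eval N := by
      rintro i v ⟨l, s, rfl, -, hl, hs⟩
      simp only [Val.size, Z, eval_add, eval_mul, eval_X, eval_one, eval_ofNat]
      omega
    have hcK : ∀ i v, Inv i v → bc.eval v.size ≤ K.eval N := fun i v hv => by
      simp only [K, eval_comp, eval_add]
      exact (eval_mono_nat bc (hsize i v hv)).trans (Nat.le_add_right _ _)
    have hfK : ∀ i v, Inv i v → bf.eval v.size ≤ K.eval N := fun i v hv => by
      simp only [K, eval_comp, eval_add]
      exact (eval_mono_nat bf (hsize i v hv)).trans (Nat.le_add_left _ _)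
    have hpos : ∀ m (a : Val), (Nat.digits 2 a.toInt.toNat).length = m + 1 → 1 ≤ a.toInt := by
      intro m a h
      by_contra h'
      have : a.toInt.toNat = 0 := by omega
      simp [this] at h
    have hdig : ∀ a : Val, 1 ≤ a.toInt → Nat.digits 2 a.toInt.toNat =
        (a.toInt - a.toInt / 2 * 2).toNat :: Nat.digits 2 (a.toInt / 2).toNat := by
      intro a ha
      obtain ⟨b, hb⟩ : ∃ b : ℕ, a.toInt = b := ⟨a.toInt.toNat, by omega⟩
      rw [hb, Int.toNat_natCast, Nat.digits_of_two_le_of_pos le_rfl (by omega)]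
      congr 2 <;> omega
    have hlen : (Nat.digits 2 v₀.toInt.toNat).length ≤ v₀.size :=
      (length_digits_le_size _).trans
        ((Nat.size_le_size (by omega)).trans v₀.size_toInt_le)
    have hrun := runs_loop_of_inv (c := Pc) (f := Pf) (F := fun v => PMF.pure (st v))
      (K := K.eval N) Inv (by
        rintro v ⟨a, s, rfl, hl, hl'⟩
        refine ⟨c (.pair a s), (hPc _).mono (hcK 0 _ ⟨a, s, rfl, hl, hl'⟩), ?_⟩
        have : a.toInt.toNat = 0 := by
          by_contra h0
          rw [Nat.digits_of_two_le_of_pos le_rfl (by omega)] at hl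
          simp at hl
        have : ¬ 1 ≤ a.toInt := by omega
        simp [c, Val.le, this, Val.truth])
      (by
        rintro m v ⟨a, s, rfl, hl, hl'⟩
        refine ⟨c (.pair a s), (hPc _).mono (hcK (m + 1) _ ⟨a, s, rfl, hl, hl'⟩), ?_⟩
        simp [c, Val.le, hpos _ _ hl, Val.truth])
      (fun m v hv => (hPf v).mono (hfK _ v hv))
      (by
        rintro m v ⟨a, s, rfl, hl, h1, h2⟩ w hw
        rw [PMF.mem_support_pure_iff] at hw
        subst hw
        have ha := hpos _ _ hl
        rw [hdig a ha] at hl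
        refine ⟨_, _, rfl, by simpa using hl, ?_, ?_⟩
        · refine le_trans ?_ h1
          rcases a with z | ⟨a, b⟩
          · exact size_le_of_natAbs_le (a := z / 2) (Int.natAbs_ediv_le_natAbs z 2)
          · simp [Val.toInt] at ha
        · have hd : (a.toInt - a.toInt / 2 * 2).natAbs ≤ 1 := by omega
          have hd' := Nat.size_le_size hd
          rw [Nat.size_one] at hd'
          change (Val.pair (.num (a.toInt - a.toInt / 2 * 2)) s).size + m * 4 ≤ N * 5
          simp only [Val.size]
          omega)
      (Nat.digits 2 v₀.toInt.toNat).length (.pair v₀ (.num 0))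
      ⟨v₀, .num 0, rfl, rfl, by omega, by simp [Val.size]; omega⟩
    have hiter : ∀ m (a : Val) l, (Nat.digits 2 a.toInt.toNat).length = m → ∃ w,
        iter (fun v => PMF.pure (st v)) m (.pair a (.ofList l)) = PMF.pure (.pair w (.ofList
          ((Nat.digits 2 a.toInt.toNat).reverse.map (fun d : ℕ => .num (d : ℤ)) ++ l))) := by
      intro m
      induction m with
      | zero =>
        intro a l h
        rw [List.length_eq_zero_iff] at h
        exact ⟨a, by simp [h, iter]⟩
      | succ m ih =>
        intro a l h
        have ha := hpos _ _ h
        rw [hdig a ha] at h ⊢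
        obtain ⟨w, hw⟩ := ih (a / .num 2) (.num (a.toInt - a.toInt / 2 * 2) :: l) (by simpa using h)
        refine ⟨w, ?_⟩
        simp only [iter, PMF.pure_bind]
        have h0 : 0 ≤ a.toInt - a.toInt / 2 * 2 := by omega
        rw [show st (.pair a (.ofList l)) =
          .pair (a / .num 2) (.ofList (.num (a.toInt - a.toInt / 2 * 2) :: l)) from rfl, hw]
        rw [List.reverse_cons, List.map_append, List.append_assoc]
        simp only [List.map_cons, List.map_nil, List.singleton_append, Int.toNat_of_nonneg h0]
        rfl
    obtain ⟨w, hw⟩ := hiter _ v₀ [] rfl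
    refine ⟨w, ?_⟩
    simp only [List.append_nil, Val.ofList] at hw
    rw [hw] at hrun
    unfold LatticeID.bits
    refine hrun.mono ?_
    simp only [eval_mul, eval_add, eval_one, eval_X, eval_ofNat]
    exact Nat.mul_le_mul_left _ (by omega)
  choose w hw using main
  have := PP.sandwich hpre ⟨_, _, fun v => hw (f v)⟩ hpost
  simp only [PMF.pure_bind] at this
  exact this

/-! ## Algorithms from polynomial-time functions and conversely -/

theorem Val.size_add_le (a b : Val) : (a + b).size ≤ a.size + b.size + 2 := by
  have := int_size_add_le a.toInt b.toInt
  have := a.size_toInt_le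
  have := b.size_toInt_le
  change 1 + (a.toInt + b.toInt).natAbs.size ≤ _
  omega

theorem Val.size_sub_le (a b : Val) : (a - b).size ≤ a.size + b.size + 2 := by
  have := int_size_sub_le a.toInt b.toInt
  have := a.size_toInt_le
  have := b.size_toInt_le
  change 1 + (a.toInt - b.toInt).natAbs.size ≤ _
  omega

theorem Val.size_mul_le (a b : Val) : (a * b).size ≤ a.size + b.size + 1 := by
  have := int_size_mul_le a.toInt b.toInt
  have := a.size_toInt_le
  have := b.size_toInt_le
  change 1 + (a.toInt * b.toInt).natAbs.size ≤ _
  omega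

theorem Val.size_div_le (a b : Val) : (a / b).size ≤ a.size + 1 := by
  have := int_size_div_le a.toInt b.toInt
  have := a.size_toInt_le
  change 1 + (a.toInt / b.toInt).natAbs.size ≤ _
  omega

/-- The length of a list, as a leaf. -/
def lenV (v : Val) : Val := fold (fun _ s _ => s + .num 1) (.num 0) v.toList (.num 0)

theorem lenV_eq (v : Val) : lenV v = .num v.toList.length := by
  have : ∀ (l : List Val) (z : ℤ),
      fold (fun _ s _ => s + .num 1) (.num 0) l (.num z) = .num (z + l.length) := by
    intro l
    induction l with
    | nil => intro z; simp [fold]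
    | cons x l ih =>
      intro z
      have := ih (z + 1)
      simp only [fold, List.foldl_cons, List.length_cons] at this ⊢
      change List.foldl _ (Val.num (z + 1)) l = _
      rw [this]; push_cast; ring_nf
  unfold lenV
  simpa using this v.toList 0

@[fun_prop]
theorem FP.lenV {f : Val → Val} (hf : FP f) : FP fun v => lenV (f v) := by
  refine FP.fold (g := fun _ s _ => s + .num 1) (E := fun _ => .num 0) (S := fun _ => .num 0)
    (by fun_prop) ⟨C 4, fun x s e => ?_⟩ hf (by fun_prop) (by fun_prop)
  have := s.size_add_le (Val.num 1)
  simp only [Val.size, Int.natAbs_one, Nat.size_one, eval_C] at this ⊢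
  omega

/-- The integer `m` in unary. -/
def unary (m : ℕ) : Val := .ofList (List.replicate m (.num 0))

@[simp] theorem Val.toList_ofList (l : List Val) : (Val.ofList l).toList = l := by
  induction l with
  | nil => rfl
  | cons a l ih => simp [Val.ofList, Val.toList, ih]

@[simp] theorem toList_unary (m : ℕ) : (unary m).toList = List.replicate m (.num 0) :=
  Val.toList_ofList _

theorem size_ofList (l : List Val) :
    (Val.ofList l).size = 1 + (l.map fun v => v.size + 1).sum := by
  induction l with
  | nil => simp [Val.ofList, Val.size]
  | cons a l ih => simp [Val.ofList, Val.size, ih]; omega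

theorem size_unary (m : ℕ) : (unary m).size = 1 + 2 * m := by
  simp [unary, size_ofList, Val.size, mul_comm]

/-- The time of `A` is polynomial in `n` itself and not in its bit-size. It is therefore polynomial
in the size of the data when `n` is given as the length of a list. -/
theorem PPT.pp_run (A : PPT) {L Y : Val → Val} (hL : FP L) (hY : FP Y) :
    PP fun v => A.run (L v).toList.length (Y v) := by
  have hpre : FP fun v => Val.pair (L v) (Y v) := by fun_prop
  have hconv : FP fun v => Val.pair (lenV v.fst) v.snd := by fun_prop
  obtain ⟨P, b, hP⟩ := hconv
  have key : PP fun v => A.run v.fst.toList.length v.snd := by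
    refine ⟨.comp P A.prog, b + A.bound.comp (2 * X), fun v => ?_⟩
    have := runs_comp (hP v) (g := A.prog) (T2 := A.bound.eval (2 * v.size))
      (κ := fun _ => A.run v.fst.toList.length v.snd) fun w hw => by
        rw [PMF.mem_support_pure_iff] at hw
        subst hw
        beta_reduce
        rw [lenV_eq]
        refine (A.runs _ _).mono (eval_mono_nat _ ?_)
        have h1 := v.fst.length_toList_le
        have h2 := v.size_fst_le
        have h3 := v.size_snd_le
        omega
    simpa [PMF.pure_bind] using this
  exact FP.comp_PP key hpre

/-- The algorithm first expands the leaf `n` to a list of length `n`. This is exponential in the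
size of the leaf, but allowed, because the time of a `PPT` is measured in `n` plus the size of the
input. -/
theorem PPT.exists_of_pp {F : Val → PMF Val} (hF : PP F) :
    ∃ D : PPT, ∀ n x, D.run n x = F (.pair (unary n) x) := by
  let c : Val → Val := fun v => Val.le (.num 1) v.fst.fst
  let st : Val → Val := fun v =>
    .pair (.pair (v.fst.fst - .num 1) v.fst.snd) (.pair (.num 0) v.snd)
  have hc : FP c := by fun_prop
  have hst : FP st := by fun_prop
  have hpre : FP fun v => Val.pair v (.num 0) := by fun_prop
  have hpost : FP fun v => Val.pair v.snd v.fst.snd := by fun_prop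
  obtain ⟨Pc, bc, hPc⟩ := hc
  obtain ⟨Pf, bf, hPf⟩ := hst
  obtain ⟨Pp, bp, hPp⟩ := hpre
  obtain ⟨Pq, bq, hPq⟩ := hpost
  obtain ⟨PF, bF, hPF⟩ := hF
  let Z : ℕ[X] := 10 + 10 * X
  let K : ℕ[X] := (bc + bf).comp Z
  let B : ℕ[X] := (2 * K + 1) * (X + 1)
  have hloop : ∀ (n : ℕ) (x : Val), Runs (.loop Pc Pf) (.pair (.pair (.num n) x) (.num 0))
      (B.eval (n + x.size)) (PMF.pure (.pair (.pair (.num 0) x) (unary n))) := by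
    intro n x
    set N := n + x.size with hN
    let Inv : ℕ → Val → Prop := fun i v => i ≤ n ∧ v = .pair (.pair (.num i) x) (unary (n - i))
    have hsize : ∀ i v, Inv i v → v.size ≤ Z.eval N := by
      rintro i v ⟨hi, rfl⟩
      have : (i : ℕ).size ≤ i := Nat.size_le.2 Nat.lt_two_pow_self
      simp only [Val.size, size_unary, Int.natAbs_natCast, Z, eval_add, eval_mul, eval_X,
        eval_ofNat]
      omega
    have hcK : ∀ i v, Inv i v → bc.eval v.size ≤ K.eval N := fun i v hv => by
      simp only [K, eval_comp, eval_add]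
      exact (eval_mono_nat bc (hsize i v hv)).trans (Nat.le_add_right _ _)
    have hfK : ∀ i v, Inv i v → bf.eval v.size ≤ K.eval N := fun i v hv => by
      simp only [K, eval_comp, eval_add]
      exact (eval_mono_nat bf (hsize i v hv)).trans (Nat.le_add_left _ _)
    have hstep : ∀ m v, Inv (m + 1) v → Inv m (st v) := by
      rintro m v ⟨hi, rfl⟩
      refine ⟨by omega, ?_⟩
      have h1 : (Val.num ((m + 1 : ℕ) : ℤ) - Val.num 1) = Val.num m := by
        change Val.num (((m + 1 : ℕ) : ℤ) - 1) = _
        congr 1; push_cast; ring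
      have h2 : n - m = (n - (m + 1)) + 1 := by omega
      simp only [st, Val.fst_pair, Val.snd_pair, h1, h2, unary, List.replicate_succ, Val.ofList]
    have hrun := runs_loop_of_inv (c := Pc) (f := Pf) (F := fun v => PMF.pure (st v))
      (K := K.eval N) Inv (by
        rintro v hv
        refine ⟨c v, (hPc _).mono (hcK 0 _ hv), ?_⟩
        obtain ⟨hi, rfl⟩ := hv
        simp [c, Val.le, Val.truth])
      (by
        rintro m v hv
        refine ⟨c v, (hPc _).mono (hcK _ _ hv), ?_⟩
        obtain ⟨hi, rfl⟩ := hv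
        have : (1 : ℤ) ≤ (m : ℤ) + 1 := by omega
        simp [c, Val.le, Val.truth, this])
      (fun m v hv => (hPf v).mono (hfK _ v hv))
      (by
        intro m v hv w hw
        rw [PMF.mem_support_pure_iff] at hw
        exact hw ▸ hstep m v hv)
      n (.pair (.pair (.num n) x) (.num 0)) ⟨le_rfl, by simp [unary, Val.ofList]⟩
    have hiter : ∀ m v, Inv m v → iter (fun v => PMF.pure (st v)) m v =
        PMF.pure (.pair (.pair (.num 0) x) (unary n)) := by
      intro m
      induction m with
      | zero => rintro v ⟨-, rfl⟩; simp [iter]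
      | succ m ih =>
        intro v hv
        simp only [iter, PMF.pure_bind]
        exact ih _ (hstep m v hv)
    rw [hiter n _ ⟨le_rfl, by simp [unary, Val.ofList]⟩] at hrun
    refine hrun.mono ?_
    simp only [B, eval_mul, eval_add, eval_one, eval_X, eval_ofNat]
    exact Nat.mul_le_mul_left _ (by omega)
  have hall : ∀ (n : ℕ) (x : Val), Runs (.comp (.comp (.comp Pp (.loop Pc Pf)) Pq) PF)
      (.pair (.num (n : ℕ)) x)
      ((bp.comp (2 + X) + B + bq.comp (10 + 10 * X) + bF.comp (2 + 2 * X)).eval (n + x.size))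
      (F (.pair (unary n) x)) := by
    intro n x
    have hn : (n : ℕ).size ≤ n := Nat.size_le.2 Nat.lt_two_pow_self
    have r1 := (hPp (.pair (.num n) x)).mono (T' := (bp.comp (2 + X)).eval (n + x.size)) (by
      rw [eval_comp]
      refine eval_mono_nat _ ?_
      simp only [Val.size, Int.natAbs_natCast, eval_add, eval_X, eval_ofNat]
      omega)
    have r2 := runs_comp r1 (g := .loop Pc Pf) (T2 := B.eval (n + x.size))
      (κ := fun _ => PMF.pure (.pair (.pair (.num 0) x) (unary n))) fun w hw => by
        rw [PMF.mem_support_pure_iff] at hw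
        exact hw ▸ hloop n x
    rw [PMF.pure_bind] at r2
    have r3 := runs_comp r2 (g := Pq) (T2 := (bq.comp (10 + 10 * X)).eval (n + x.size))
      (κ := fun _ => PMF.pure (.pair (unary n) x)) fun w hw => by
        rw [PMF.mem_support_pure_iff] at hw
        subst hw
        refine (hPq _).mono ?_
        rw [eval_comp]
        refine eval_mono_nat _ ?_
        simp only [Val.size, size_unary, Int.natAbs_zero, Nat.size_zero, eval_add, eval_mul,
          eval_X, eval_ofNat]
        omega
    rw [PMF.pure_bind] at r3
    have r4 := runs_comp r3 (g := PF) (T2 := (bF.comp (2 + 2 * X)).eval (n + x.size))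
      (κ := fun _ => F (.pair (unary n) x)) fun w hw => by
        rw [PMF.mem_support_pure_iff] at hw
        subst hw
        refine (hPF _).mono ?_
        rw [eval_comp]
        refine eval_mono_nat _ ?_
        simp only [Val.size, size_unary, eval_add, eval_mul, eval_X, eval_ofNat]
        omega
    rw [PMF.pure_bind] at r4
    simpa only [eval_add] using r4
  exact ⟨PPT.ofRuns _ _ _ hall, PPT.ofRuns_run _ _ _ hall⟩

/-! ## Coefficients -/

section Coeffs

variable {A : Type} [CommRing A] {n : ℕ} [NeZero n]

theorem monic_cyc (A : Type) [CommRing A] (n : ℕ) [NeZero n] : (X ^ n + 1 : A[X]).Monic := by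
  simpa using monic_X_pow_add_C (1 : A) (NeZero.ne n)

/-- The class of a polynomial. -/
def Cyc.mk (A : Type) [CommRing A] (n : ℕ) : A[X] →+* Cyc A n := AdjoinRoot.mk (X ^ n + 1 : A[X])

/-- The remainder modulo `X ^ n + 1`, as a linear map. -/
def Cyc.rep (u : Cyc A n) : A[X] := AdjoinRoot.modByMonicHom (monic_cyc A n) u

theorem Cyc.rep_mk (p : A[X]) : (Cyc.mk A n p).rep = p %ₘ (X ^ n + 1) :=
  AdjoinRoot.modByMonicHom_mk _ _

theorem Cyc.mk_rep (u : Cyc A n) : Cyc.mk A n u.rep = u :=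
  AdjoinRoot.mk_leftInverse (monic_cyc A n) u

theorem coeffs_eq (u : Cyc A n) (i : Fin n) : coeffs u i = u.rep.coeff i := rfl

omit [NeZero n] in
theorem ofCoeffs_eq (v : Fin n → A) : ofCoeffs v = Cyc.mk A n (∑ i, C (v i) * X ^ (i : ℕ)) := rfl

omit [NeZero n] in
theorem degree_sum_lt (v : Fin n → A) : (∑ i, C (v i) * X ^ (i : ℕ) : A[X]).degree < n :=
  (degree_sum_fin_lt v)

theorem degree_cyc [Nontrivial A] : (X ^ n + 1 : A[X]).degree = n := by
  simpa using degree_X_pow_add_C (NeZero.pos n) (1 : A)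

theorem Cyc.degree_rep_lt [Nontrivial A] (u : Cyc A n) : u.rep.degree < n := by
  conv_lhs => rw [← u.mk_rep, Cyc.rep_mk]
  have := degree_modByMonic_lt u.rep (monic_cyc A n)
  rwa [degree_cyc] at this

@[simp] theorem coeffs_ofCoeffs (v : Fin n → A) : coeffs (ofCoeffs v : Cyc A n) = v := by
  nontriviality A
  funext i
  rw [coeffs_eq, ofCoeffs_eq, Cyc.rep_mk, (modByMonic_eq_self_iff (monic_cyc A n)).2]
  · simp only [finsetSum_coeff, coeff_C_mul, coeff_X_pow]
    simp [Fin.val_inj]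
  · rw [degree_cyc]; exact degree_sum_lt v

@[simp] theorem ofCoeffs_coeffs (u : Cyc A n) : ofCoeffs (coeffs u) = u := by
  rcases subsingleton_or_nontrivial A with hA | hA
  · rw [← u.mk_rep, ofCoeffs_eq]
    congr 1
    exact Subsingleton.elim _ _
  rw [ofCoeffs_eq]
  conv_rhs => rw [← u.mk_rep]
  congr 1
  have h : u.rep.degree < n := u.degree_rep_lt
  conv_rhs => rw [u.rep.as_sum_range' n (by
    by_cases h0 : u.rep = 0
    · rw [h0]; simpa using NeZero.pos n
    · exact (natDegree_lt_iff_degree_lt h0).2 h)]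
  simp only [← C_mul_X_pow_eq_monomial]
  exact (Finset.sum_range fun i => C (u.rep.coeff i) * X ^ i).symm

omit [NeZero n] in
theorem Cyc.mk_self : Cyc.mk A n (X ^ n + 1) = 0 := AdjoinRoot.mk_self

/-- The substitution of `B` for `X`. -/
def kronHom (n : ℕ) (B : ℕ) : Rz n →+* ZMod (B ^ n + 1) :=
  AdjoinRoot.lift (Int.castRingHom _) (B : ZMod (B ^ n + 1)) (by
    have : ((B ^ n + 1 : ℕ) : ZMod (B ^ n + 1)) = 0 := ZMod.natCast_self _
    push_cast at this
    simpa using this)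

theorem kronHom_mk (n B : ℕ) (p : ℤ[X]) : kronHom n B (Cyc.mk ℤ n p) =
    p.eval₂ (Int.castRingHom _) (B : ZMod (B ^ n + 1)) :=
  AdjoinRoot.lift_mk (f := X ^ n + 1) _ _

theorem Cyc.mk_map (q n : ℕ) (p : ℤ[X]) :
    red q (Cyc.mk ℤ n p) = Cyc.mk (ZMod q) n (p.map (Int.castRingHom (ZMod q))) := by
  have : (red q).comp (Cyc.mk ℤ n) =
      (Cyc.mk (ZMod q) n).comp (mapRingHom (Int.castRingHom (ZMod q))) := by
    apply Polynomial.ringHom_ext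
    · intro a
      exact (AdjoinRoot.map_of (Int.castRingHom (ZMod q)) (X ^ n + 1) (X ^ n + 1) (by simp) a).trans
        (by simp only [RingHom.comp_apply, coe_mapRingHom, map_C]; rfl)
    · exact (AdjoinRoot.map_root (Int.castRingHom (ZMod q)) (X ^ n + 1) (X ^ n + 1) (by simp)).trans
        (by simp only [RingHom.comp_apply, coe_mapRingHom, map_X]; rfl)
  exact congrArg (fun f => f p) this

theorem rep_add (u v : Cyc A n) : (u + v).rep = u.rep + v.rep :=
  map_add (AdjoinRoot.modByMonicHom (monic_cyc A n)) u v

theorem rep_sub (u v : Cyc A n) : (u - v).rep = u.rep - v.rep :=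
  map_sub (AdjoinRoot.modByMonicHom (monic_cyc A n)) u v

theorem rep_zero : (0 : Cyc A n).rep = 0 :=
  map_zero (AdjoinRoot.modByMonicHom (monic_cyc A n))

attribute [local irreducible] Cyc

/-- Elements correspond to their coefficient vectors. -/
def coeffEquiv (A : Type) [CommRing A] (n : ℕ) [NeZero n] : Cyc A n ≃ (Fin n → A) where
  toFun := coeffs
  invFun := ofCoeffs
  left_inv := ofCoeffs_coeffs
  right_inv := coeffs_ofCoeffs

theorem coeffs_injective : Function.Injective (coeffs : Cyc A n → Fin n → A) :=
  (coeffEquiv A n).injective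

@[simp] theorem coeffs_add (u v : Cyc A n) (i : Fin n) :
    coeffs (u + v) i = coeffs u i + coeffs v i := by
  simp [coeffs_eq, rep_add]

@[simp] theorem coeffs_sub (u v : Cyc A n) (i : Fin n) :
    coeffs (u - v) i = coeffs u i - coeffs v i := by
  simp [coeffs_eq, rep_sub]

@[simp] theorem coeffs_zero (i : Fin n) : coeffs (0 : Cyc A n) i = 0 := by
  simp [coeffs_eq, rep_zero]

@[simp] theorem coeffs_neg (u : Cyc A n) (i : Fin n) : coeffs (-u) i = -coeffs u i := by
  rw [← zero_sub, coeffs_sub, coeffs_zero, zero_sub]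

theorem coeffs_sum {ι : Type*} (s : Finset ι) (f : ι → Cyc A n) (i : Fin n) :
    coeffs (∑ j ∈ s, f j) i = ∑ j ∈ s, coeffs (f j) i := by
  classical
  induction s using Finset.induction with
  | empty => simp
  | insert a s ha ih => rw [Finset.sum_insert ha, Finset.sum_insert ha, coeffs_add, ih]

/-- The class of `X`. -/
def Cyc.x (A : Type) [CommRing A] (n : ℕ) : Cyc A n := Cyc.mk A n X

/-- The constants. -/
def Cyc.c (A : Type) [CommRing A] (n : ℕ) : A →+* Cyc A n := (Cyc.mk A n).comp C

omit [NeZero n] in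
theorem Cyc.x_pow : Cyc.x A n ^ n = -1 := by
  have h := Cyc.mk_self (A := A) (n := n)
  rw [map_add, map_one, map_pow] at h
  exact eq_neg_of_add_eq_zero_left h

omit [NeZero n] in
theorem ofCoeffs_eq_sum (v : Fin n → A) :
    (ofCoeffs v : Cyc A n) = ∑ i, Cyc.c A n (v i) * Cyc.x A n ^ (i : ℕ) := by
  rw [ofCoeffs_eq, map_sum]
  simp [Cyc.c, Cyc.x]

theorem eq_sum_coeffs (u : Cyc A n) : u = ∑ i, Cyc.c A n (coeffs u i) * Cyc.x A n ^ (i : ℕ) := by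
  rw [← ofCoeffs_eq_sum, ofCoeffs_coeffs]

@[simp] theorem coeffs_c_mul (a : A) (u : Cyc A n) (i : Fin n) :
    coeffs (Cyc.c A n a * u) i = a * coeffs u i := by
  have : Cyc.c A n a * u = ofCoeffs fun i => a * coeffs u i := by
    conv_lhs => rw [eq_sum_coeffs u]
    rw [ofCoeffs_eq_sum, Finset.mul_sum]
    refine Finset.sum_congr rfl fun i _ => ?_
    rw [map_mul, mul_assoc]
  rw [this, coeffs_ofCoeffs]

/-- Since `x^n = -1`, multiplication by `x` is a cyclic shift with one change of sign. In particular
it preserves the norm. -/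
theorem coeffs_x_mul {m : ℕ} (u : Cyc A (m + 1)) :
    coeffs (Cyc.x A (m + 1) * u) = Fin.cons (-coeffs u (Fin.last m)) (fun i => coeffs u i.castSucc) := by
  have : Cyc.x A (m + 1) * u =
      ofCoeffs (Fin.cons (-coeffs u (Fin.last m)) (fun i => coeffs u i.castSucc)) := by
    conv_lhs => rw [eq_sum_coeffs u]
    rw [ofCoeffs_eq_sum, Finset.mul_sum, Fin.sum_univ_castSucc, Fin.sum_univ_succ]
    refine (add_comm _ _).trans ?_
    congr 1
    · have := Cyc.x_pow (A := A) (n := m + 1)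
      simp only [Fin.val_last, Fin.cons_zero, Fin.val_zero, pow_zero, mul_one, map_neg]
      rw [mul_left_comm, ← pow_succ', this, mul_neg, mul_one]
    · refine Finset.sum_congr rfl fun i _ => ?_
      simp only [Fin.val_castSucc, Fin.cons_succ, Fin.val_succ]
      rw [pow_succ']; ring
  rw [this, coeffs_ofCoeffs]

/-- For fixed `g`, each coefficient of `g * d` is a linear form in the coefficients of `d` whose
weights are, up to sign, coefficients of `g`. The tail bounds for products with random `d` rest on
this. -/
theorem coeffs_mul (g d : Cyc A n) (j : Fin n) :
    coeffs (g * d) j = ∑ i, coeffs d i * coeffs (Cyc.x A n ^ (i : ℕ) * g) j := by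
  conv_lhs => rw [eq_sum_coeffs d, Finset.mul_sum]
  rw [coeffs_sum]
  refine Finset.sum_congr rfl fun i _ => ?_
  rw [← coeffs_c_mul]; congr 1; ring

end Coeffs

attribute [local irreducible] Cyc

/-! ### Sup norms, and representatives of elements of `R_q` in `R` -/

section Norm

variable {n : ℕ} [NeZero n]

theorem NormLe.mono {u : Rz n} {B B' : ℝ} (h : NormLe u B) (hB : B ≤ B') : NormLe u B' :=
  fun i => (h i).trans hB

theorem NormLe.add {u v : Rz n} {B B' : ℝ} (h : NormLe u B) (h' : NormLe v B') :
    NormLe (u + v) (B + B') := fun i => by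
  rw [coeffs_add]; push_cast
  exact (abs_add_le _ _).trans (add_le_add (h i) (h' i))

theorem NormLe.neg {u : Rz n} {B : ℝ} (h : NormLe u B) : NormLe (-u) B := fun i => by
  rw [coeffs_neg]; push_cast; rw [abs_neg]; exact h i

theorem NormLe.sub {u v : Rz n} {B B' : ℝ} (h : NormLe u B) (h' : NormLe v B') :
    NormLe (u - v) (B + B') := by
  rw [sub_eq_add_neg]; exact h.add h'.neg

theorem NormLe.nonneg {u : Rz n} {B : ℝ} (h : NormLe u B) : 0 ≤ B :=
  (abs_nonneg _).trans (h ⟨0, NeZero.pos n⟩)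

theorem NormLe.x_mul {u : Rz n} {B : ℝ} (h : NormLe u B) : NormLe (Cyc.x ℤ n * u) B := by
  obtain ⟨m, rfl⟩ : ∃ m, n = m + 1 := ⟨n - 1, (Nat.succ_pred (NeZero.ne n)).symm⟩
  intro i
  rw [coeffs_x_mul]
  refine Fin.cases ?_ (fun i => ?_) i
  · simpa using h (Fin.last m)
  · simpa using h i.castSucc

theorem NormLe.x_pow_mul {u : Rz n} {B : ℝ} (h : NormLe u B) (i : ℕ) :
    NormLe (Cyc.x ℤ n ^ i * u) B := by
  induction i with
  | zero => simpa using h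
  | succ i ih => rw [pow_succ', mul_assoc]; exact ih.x_mul

/-- The worst-case bound with its factor `n`. It is used where that factor is affordable: for the
third component of the extracted vector and for intermediate results of programs. -/
theorem NormLe.mul {u v : Rz n} {B B' : ℝ} (h : NormLe u B) (h' : NormLe v B') :
    NormLe (u * v) (n * (B * B')) := fun j => by
  rw [coeffs_mul]; push_cast
  refine (Finset.abs_sum_le_sum_abs _ _).trans ?_
  calc ∑ i : Fin n, |((coeffs v i : ℤ) : ℝ) * ((coeffs (Cyc.x ℤ n ^ (i : ℕ) * u) j : ℤ) : ℝ)|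
      ≤ ∑ _i : Fin n, B * B' := Finset.sum_le_sum fun i _ => by
        rw [abs_mul, mul_comm]
        exact mul_le_mul (h.x_pow_mul i j) (h' i) (abs_nonneg _) h.nonneg
    _ = n * (B * B') := by simp

variable {q : ℕ}

omit [NeZero n] in
theorem red_ofCoeffs (v : Fin n → ℤ) :
    red q (ofCoeffs v : Rz n) = ofCoeffs fun i => (v i : ZMod q) := by
  rw [ofCoeffs_eq, Cyc.mk_map, ofCoeffs_eq]
  simp [Polynomial.map_sum]

@[simp] theorem coeffs_red (u : Rz n) (i : Fin n) :
    coeffs (red q u) i = ((coeffs u i : ℤ) : ZMod q) := by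
  conv_lhs => rw [← ofCoeffs_coeffs u, red_ofCoeffs, coeffs_ofCoeffs]

/-- The representative with coefficients in `[-(q-1)/2, (q-1)/2]`. -/
def liftQ (r : Rq q n) : Rz n := ofCoeffs fun i => (coeffs r i).valMinAbs

theorem coeffs_liftQ (r : Rq q n) (i : Fin n) : coeffs (liftQ r) i = (coeffs r i).valMinAbs := by
  rw [liftQ, coeffs_ofCoeffs]

@[simp] theorem red_liftQ (r : Rq q n) : red q (liftQ r) = r := by
  apply coeffs_injective
  funext i
  rw [coeffs_red, coeffs_liftQ, ZMod.coe_valMinAbs]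

theorem normLe_liftQ {r : Rq q n} {B : ℝ} : NormLe (liftQ r) B ↔ NormLeQ r B := by
  simp [NormLe, NormLeQ, coeffs_liftQ]

theorem abs_valMinAbs_le [NeZero q] (r : ZMod q) : |(r.valMinAbs : ℝ)| ≤ q / 2 := by
  have h := ZMod.natAbs_valMinAbs_le r
  have h2 : (r.valMinAbs.natAbs : ℝ) ≤ (q : ℝ) / 2 :=
    le_trans (Nat.cast_le.2 h) (by simpa using Nat.cast_div_le (α := ℝ) (m := q) (n := 2))
  rwa [Nat.cast_natAbs, Int.cast_abs] at h2

theorem normLe_liftQ_half [NeZero q] (r : Rq q n) : NormLe (liftQ r) (q / 2) :=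
  normLe_liftQ.2 fun _ => abs_valMinAbs_le _

/-- Either `z` is its own balanced residue, or `|z| ≥ q/2` anyway. So reduction never increases a
norm, and correctness needs no comparison of `η_t` with `q`. -/
theorem abs_valMinAbs_intCast_le [NeZero q] (z : ℤ) : |((z : ZMod q).valMinAbs : ℝ)| ≤ |(z : ℝ)| := by
  by_cases h : 2 * z.natAbs < q
  · have : (z : ZMod q).valMinAbs = z := by
      rw [ZMod.valMinAbs_spec]
      exact ⟨rfl, by constructor <;> omega⟩
    rw [this]
  · refine (abs_valMinAbs_le _).trans ?_
    rw [← Int.cast_abs, ← Nat.cast_natAbs]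
    rw [div_le_iff₀ (by norm_num)]
    have : q ≤ z.natAbs * 2 := by omega
    exact_mod_cast this

theorem NormLe.red [NeZero q] {u : Rz n} {B : ℝ} (h : NormLe u B) : NormLeQ (LatticeID.red q u) B :=
  fun i => by
    rw [coeffs_red]
    exact (abs_valMinAbs_intCast_le _).trans (h i)

theorem liftQ_red [NeZero q] {u : Rz n} {B : ℝ} (h : NormLe u B) (hB : 2 * B < q) :
    liftQ (LatticeID.red q u) = u := by
  apply coeffs_injective
  funext i
  rw [coeffs_liftQ, coeffs_red, ZMod.valMinAbs_spec]
  refine ⟨rfl, ?_⟩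
  have h1 := abs_le.1 (h i)
  have h2 : ((coeffs u i * 2 : ℤ) : ℝ) ≤ ((q : ℤ) : ℝ) := by push_cast; linarith
  have h3 : ((-(q : ℤ) : ℤ) : ℝ) < ((coeffs u i * 2 : ℤ) : ℝ) := by push_cast; linarith
  exact ⟨by exact_mod_cast h3, by exact_mod_cast h2⟩

end Norm

/-! ## Kronecker substitution -/

/-- The residue of `z` modulo `m` that is smallest in absolute value. -/
def cmod (m z : ℤ) : ℤ := if 1 ≤ m then (z + m / 2) - m * ((z + m / 2) / m) - m / 2 else 0

theorem cmod_eq {m z c : ℤ} (hc : 2 * |c| < m) (hd : m ∣ z - c) : cmod m z = c := by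
  have h0 := abs_nonneg c
  have hm : 1 ≤ m := by omega
  obtain ⟨d, hd⟩ := hd
  obtain rfl : z = c + m * d := by linarith
  have h1 : (c + m * d + m / 2) / m = d := by
    rw [show c + m * d + m / 2 = (c + m / 2) + m * d by ring, Int.add_mul_ediv_left _ _ (by omega)]
    rw [Int.ediv_eq_zero_of_lt, zero_add] <;> rcases abs_cases c with h | h <;> omega
  simp only [cmod, hm, if_true, h1]
  ring

theorem natAbs_cmod_le (m z : ℤ) : (cmod m z).natAbs ≤ m.natAbs := by
  unfold cmod
  split_ifs with h
  · have h1 := Int.emod_nonneg (z + m / 2) (show m ≠ 0 by omega)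
    have h2 := Int.emod_lt_of_pos (z + m / 2) (show 0 < m by omega)
    rw [Int.emod_def] at h1 h2
    omega
  · simp

theorem cmod_eq_valMinAbs {q : ℕ} (hq : q % 2 = 1) (z : ℤ) :
    cmod q z = (z : ZMod q).valMinAbs := by
  have : NeZero q := ⟨by omega⟩
  refine cmod_eq ?_ ?_
  · have := ZMod.natAbs_valMinAbs_le (z : ZMod q)
    rw [← Int.natCast_natAbs]; omega
  · rw [← ZMod.intCast_zmod_eq_zero_iff_dvd]
    simp

/-- The value at `B` of a polynomial with coefficients `v`. -/
def kron (B : ℤ) {n : ℕ} (v : Fin n → ℤ) : ℤ := ∑ i, v i * B ^ (i : ℕ)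

theorem kron_succ (B : ℤ) {n : ℕ} (v : Fin (n + 1) → ℤ) :
    kron B v = v 0 + B * kron B (fun i => v i.succ) := by
  simp only [kron, Fin.sum_univ_succ, Fin.val_zero, pow_zero, mul_one, Fin.val_succ, Finset.mul_sum]
  congr 1
  exact Finset.sum_congr rfl fun i _ => by ring

/-- Balanced digits smaller than `h` in base `2h` give a number below half of `(2h)^n`. It is
therefore the balanced residue of its class modulo `(2h)^n + 1`, and nothing is lost in that ring.
-/
theorem abs_kron_lt {h : ℤ} {n : ℕ} (hh : 1 ≤ h) (v : Fin n → ℤ) (hv : ∀ i, |v i| < h) :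
    2 * |kron (2 * h) v| < (2 * h) ^ n := by
  induction n with
  | zero => simp [kron]
  | succ n ih =>
    rw [kron_succ, pow_succ]
    have h1 := ih (fun i => v i.succ) fun i => hv _
    have h2 := hv 0
    have h3 := abs_add_le (v 0) (2 * h * kron (2 * h) fun i => v i.succ)
    rw [abs_mul, abs_of_pos (show (0 : ℤ) < 2 * h by omega)] at h3
    nlinarith

variable {n : ℕ} [NeZero n]

theorem kronHom_eq (B : ℕ) (u : Rz n) : kronHom n B u = (kron B (coeffs u) : ZMod (B ^ n + 1)) := by
  conv_lhs => rw [← ofCoeffs_coeffs u]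
  rw [ofCoeffs_eq, kronHom_mk]
  simp [eval₂_finsetSum, kron]

/-- An integer that represents a ring element determines it. -/
theorem cmod_kron {h : ℕ} {u : Rz n} (hu : NormLe u (h - 1)) {z : ℤ}
    (hz : (z : ZMod ((2 * h) ^ n + 1)) = kronHom n (2 * h) u) :
    cmod ((2 * h) ^ n + 1) z = kron (2 * h) (coeffs u) := by
  have hlt : ∀ i, |coeffs u i| < (h : ℤ) := fun i => by
    have := hu i
    rw [← Int.cast_abs] at this
    have h2 : ((|coeffs u i| : ℤ) : ℝ) < ((h : ℤ) : ℝ) := by push_cast at this ⊢; linarith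
    exact_mod_cast h2
  have h1 : (1 : ℤ) ≤ h := by
    have := hlt ⟨0, NeZero.pos n⟩
    have := abs_nonneg (coeffs u ⟨0, NeZero.pos n⟩)
    omega
  refine cmod_eq ?_ ?_
  · have := abs_kron_lt h1 (coeffs u) hlt
    omega
  · rw [kronHom_eq] at hz
    have := (ZMod.intCast_eq_intCast_iff_dvd_sub _ _ _).1 hz.symm
    push_cast at this
    exact_mod_cast this

/-! ## Programs for the arithmetic of `R_q` -/

/-- `cmod` on data. -/
def cmodV (m z : Val) : Val :=
  Val.ite (Val.le (.num 1) m) ((z + m / .num 2) - m * ((z + m / .num 2) / m) - m / .num 2) (.num 0)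

theorem cmodV_eq (m z : Val) : cmodV m z = .num (cmod m.toInt z.toInt) := by
  unfold cmodV cmod
  rw [Val.ite_le]
  by_cases h : 1 ≤ m.toInt
  · simp only [Val.toInt_num, h, if_true]; rfl
  · simp only [Val.toInt_num, h, if_false]

@[fun_prop]
theorem FP.cmodV {f g : Val → Val} (hf : FP f) (hg : FP g) : FP fun v => cmodV (f v) (g v) := by
  unfold LatticeID.cmodV; fun_prop

theorem size_cmodV_le (m z : Val) : (cmodV m z).size ≤ 1 + m.size := by
  rw [cmodV_eq]
  simp only [Val.size]
  have h1 := Nat.size_le_size (natAbs_cmod_le m.toInt z.toInt)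
  have h2 := m.size_toInt_le
  omega

/-- One entry of a list is reduced and moved to the output. -/
def normStep (_x s e : Val) : Val := .pair s.fst.snd (.pair (cmodV e s.fst.fst) s.snd)

/-- The first entries of a list, modulo `q`, in reversed order. -/
def normR (un q w : Val) : Val := (fold normStep q un.toList (.pair w (.num 0))).snd

theorem size_normStep_le (x s e : Val) : (normStep x s e).size ≤ s.size + (e.size + 5) := by
  have h1 := s.fst.size_snd_le
  have h2 := s.size_fst_add_size_snd_le
  have h3 := size_cmodV_le e s.fst.fst
  simp only [normStep, Val.size] at *
  omega

@[fun_prop]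
theorem FP.normR {un q w : Val → Val} (hun : FP un) (hq : FP q) (hw : FP w) :
    FP fun v => normR (un v) (q v) (w v) := by
  unfold LatticeID.normR
  refine FP.snd (FP.fold (g := normStep) ?_ ⟨X + 5, fun x s e => ?_⟩ hun
    (S := fun v => Val.pair (w v) (Val.num 0)) (by fun_prop) hq)
  · unfold normStep; fun_prop
  · have := size_normStep_le x s e
    simp only [eval_add, eval_X, eval_ofNat]; omega

/-- Evaluation of a list of coefficients. -/
def horner (B l : Val) : Val := fold (fun x s e => s * e + x) B l.toList (.num 0)

@[fun_prop]
theorem FP.horner {B l : Val → Val} (hB : FP B) (hl : FP l) : FP fun v => horner (B v) (l v) := by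
  unfold LatticeID.horner
  refine FP.fold (g := fun x s e => s * e + x) (S := fun _ => .num 0) (by fun_prop)
    ⟨X + 5, fun x s e => ?_⟩ hl (by fun_prop) hB
  have h1 := (s * e).size_add_le x
  have h2 := s.size_mul_le e
  simp only [eval_add, eval_X, eval_ofNat]
  omega

/-- One digit is split off, reduced and moved to the output. -/
def digStep (_x s e : Val) : Val :=
  .pair ((s.fst - cmodV e.snd s.fst) / e.snd) (.pair (cmodV e.fst (cmodV e.snd s.fst)) s.snd)

/-- The balanced digits of an integer, modulo `m`, in reversed order. -/
def digitsR (m B un N : Val) : Val := (fold digStep (.pair m B) un.toList (.pair N (.num 0))).snd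

@[fun_prop]
theorem FP.digitsR {m B un N : Val → Val} (hm : FP m) (hB : FP B) (hun : FP un) (hN : FP N) :
    FP fun v => digitsR (m v) (B v) (un v) (N v) := by
  unfold LatticeID.digitsR
  refine FP.snd (FP.fold (g := digStep) ?_ ⟨2 * X + 20, fun x s e => ?_⟩ hun
    (S := fun v => Val.pair (N v) (Val.num 0)) (by fun_prop)
    (E := fun v => Val.pair (m v) (B v)) (by fun_prop))
  · unfold digStep; fun_prop
  · have h1 := (s.fst - LatticeID.cmodV e.snd s.fst).size_div_le e.snd
    have h2 := s.fst.size_sub_le (LatticeID.cmodV e.snd s.fst)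
    have h3 := size_cmodV_le e.snd s.fst
    have h4 := size_cmodV_le e.fst (LatticeID.cmodV e.snd s.fst)
    have h5 := s.size_fst_add_size_snd_le
    have h6 := e.size_fst_le
    have h7 := e.size_snd_le
    simp only [digStep, Val.size, eval_add, eval_X, eval_mul, eval_ofNat]
    omega

/-- The bound does not involve `N`: the number of digits is prescribed by `un`, and each digit is
reduced modulo `m`. -/
theorem size_digitsR_le (m B un N : Val) :
    (digitsR m B un N).size ≤ un.size * (m.size + 2) + 1 := by
  have key : ∀ (l : List Val) (s : Val), (fold digStep (.pair m B) l s).snd.size ≤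
      s.snd.size + l.length * (m.size + 2) := by
    intro l
    induction l with
    | nil => intro s; simp [fold]
    | cons x l ih =>
      intro s
      have h1 := ih (digStep x s (.pair m B))
      have h2 : (digStep x s (.pair m B)).snd.size ≤ s.snd.size + (m.size + 2) := by
        have := size_cmodV_le m (cmodV B s.fst)
        simp only [digStep, Val.snd_pair, Val.fst_pair, Val.size]
        omega
      simp only [fold, List.foldl_cons, List.length_cons] at h1 ⊢
      rw [add_mul]
      omega
  have h1 := key un.toList (.pair N (.num 0))
  have h2 := Nat.mul_le_mul_right (m.size + 2) un.length_toList_le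
  simp only [digitsR]
  simp only [Val.snd_pair, Val.size, Int.natAbs_zero, Nat.size_zero] at h1
  omega

/-- Reversal of a list. -/
def rev (l : Val) : Val := fold (fun x s _ => .pair x s) (.num 0) l.toList (.num 0)

@[fun_prop]
theorem FP.rev {l : Val → Val} (hl : FP l) : FP fun v => rev (l v) := by
  unfold LatticeID.rev
  refine FP.fold (g := fun x s _ => .pair x s) (S := fun _ => .num 0) (E := fun _ => .num 0)
    (by fun_prop) ⟨X + 1, fun x s e => ?_⟩ hl (by fun_prop) (by fun_prop)
  simp only [Val.size, eval_add, eval_X, eval_one]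
  omega

/-- A power with exponent in unary. -/
def powV (b un : Val) : Val := fold (fun _ s e => s * e) b un.toList (.num 1)

@[fun_prop]
theorem FP.powV {b un : Val → Val} (hb : FP b) (hun : FP un) : FP fun v => powV (b v) (un v) := by
  unfold LatticeID.powV
  refine FP.fold (g := fun _ s e => s * e) (S := fun _ => .num 1)
    (by fun_prop) ⟨X + 1, fun x s e => ?_⟩ hun (by fun_prop) hb
  have := s.size_mul_le e
  simp only [eval_add, eval_X, eval_one]
  omega

/-- The context of computations in `R_q`: `n` in unary, `q`, the base, and the modulus. -/
def mkCtx (un q : Val) : Val :=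
  .pair un (.pair q (.pair (.num 8 * (lenV un * lenV un) * (q * q * q))
    (powV (.num 8 * (lenV un * lenV un) * (q * q * q)) un + .num 1)))

@[fun_prop]
theorem FP.mkCtx {un q : Val → Val} (hun : FP un) (hq : FP q) : FP fun v => mkCtx (un v) (q v) := by
  unfold LatticeID.mkCtx; fun_prop

/-- `a b + c` in `R_q`. -/
def fma (K a b c : Val) : Val :=
  horner K.snd.snd.fst (digitsR K.snd.fst K.snd.snd.fst K.fst (cmodV K.snd.snd.snd (a * b + c)))

@[fun_prop]
theorem FP.fma {K a b c : Val → Val} (hK : FP K) (ha : FP a) (hb : FP b) (hc : FP c) :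
    FP fun v => fma (K v) (a v) (b v) (c v) := by
  unfold LatticeID.fma; fun_prop

/-- The result is reduced, so its size is bounded by the context alone, however large the operands
are. This is why folds that multiply their state repeatedly satisfy the growth condition. -/
theorem exists_size_fma_le : ∃ b : ℕ[X], ∀ K a c d, (fma K a c d).size ≤ b.eval K.size := by
  obtain ⟨b, hb⟩ := (FP.horner (B := fun v => v.fst) (l := fun v => v.snd)
    (by fun_prop) (by fun_prop)).exists_size_le
  refine ⟨b.comp (1 + X + (X * (X + 2) + 1)), fun K a c d => ?_⟩
  refine (hb (.pair K.snd.snd.fst (digitsR K.snd.fst K.snd.snd.fst K.fst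
    (cmodV K.snd.snd.snd (a * c + d))))).trans ?_
  rw [eval_comp]
  refine eval_mono_nat _ ?_
  have h1 := size_digitsR_le K.snd.fst K.snd.snd.fst K.fst (cmodV K.snd.snd.snd (a * c + d))
  have h2 := K.size_fst_le
  have h3 := (K.snd.size_fst_le).trans K.size_snd_le
  have h4 := (K.snd.snd.size_fst_le).trans ((K.snd.size_snd_le).trans K.size_snd_le)
  have h5 := Nat.mul_le_mul h2 (Nat.add_le_add_right h3 2)
  simp only [Val.size, eval_add, eval_X, eval_mul, eval_one, eval_ofNat]
  omega

/-- Reading an element of `R_q`. -/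
def load (K w : Val) : Val := horner K.snd.snd.fst (normR K.fst K.snd.fst w)

@[fun_prop]
theorem FP.load {K w : Val → Val} (hK : FP K) (hw : FP w) : FP fun v => load (K v) (w v) := by
  unfold LatticeID.load; fun_prop

/-- Writing an element of `R`. -/
def outZ (K N : Val) : Val :=
  rev (digitsR K.snd.snd.fst K.snd.snd.fst K.fst (cmodV K.snd.snd.snd N))

@[fun_prop]
theorem FP.outZ {K N : Val → Val} (hK : FP K) (hN : FP N) : FP fun v => outZ (K v) (N v) := by
  unfold LatticeID.outZ; fun_prop

/-- A step of square-and-multiply. -/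
def sqmStep (x s e : Val) : Val :=
  Val.ite x (fma e.fst (fma e.fst s s (.num 0)) e.snd (.num 0)) (fma e.fst s s (.num 0))

/-- The inverse of a unit of `R_q`. -/
def invV (K r : Val) : Val :=
  fold sqmStep (.pair K r) (bits (powV K.snd.fst K.fst - .num 2)).toList (.num 1)

@[fun_prop]
theorem FP.invV {K r : Val → Val} (hK : FP K) (hr : FP r) : FP fun v => invV (K v) (r v) := by
  unfold LatticeID.invV
  obtain ⟨b, hb⟩ := exists_size_fma_le
  refine FP.fold (g := sqmStep) ?_ ⟨b, fun x s e => ?_⟩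
    (L := fun v => LatticeID.bits (LatticeID.powV (K v).snd.fst (K v).fst - Val.num 2))
    (S := fun _ => Val.num 1) (E := fun v => Val.pair (K v) (r v))
    (by fun_prop) (by fun_prop) (by fun_prop)
  · unfold sqmStep; fun_prop
  · have h1 := eval_mono_nat b (e.size_fst_le.trans (Nat.le_add_left e.size x.size))
    unfold sqmStep Val.ite
    split_ifs
    · exact (hb _ _ _ _).trans (h1.trans (Nat.le_add_left _ _))
    · exact (hb _ _ _ _).trans (h1.trans (Nat.le_add_left _ _))

/-- A step of a sum of products. -/
def dotStep (x s e : Val) : Val := .pair s.fst.snd (fma e (load e s.fst.fst) (load e x) s.snd)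

/-- The sum of the products of the entries of two lists. -/
def dotV (K us ls : Val) : Val := (fold dotStep K us.toList (.pair ls (.num 0))).snd

@[fun_prop]
theorem FP.dotV {K us ls : Val → Val} (hK : FP K) (hus : FP us) (hls : FP ls) :
    FP fun v => dotV (K v) (us v) (ls v) := by
  unfold LatticeID.dotV
  obtain ⟨b, hb⟩ := exists_size_fma_le
  refine FP.snd (FP.fold (g := dotStep) ?_ ⟨b + 1, fun x s e => ?_⟩ hus
    (S := fun v => Val.pair (ls v) (Val.num 0)) (by fun_prop) hK)
  · unfold dotStep; fun_prop
  · have h1 := eval_mono_nat b (Nat.le_add_left e.size x.size)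
    have h2 := hb e (LatticeID.load e s.fst.fst) (LatticeID.load e x) s.snd
    have h3 := s.fst.size_snd_le
    have h4 := s.size_fst_le
    simp only [dotStep, Val.size, eval_add, eval_one]
    omega

/-- A step of a truncated sum. -/
def sumStep (x s e : Val) : Val :=
  Val.ite (Val.le (s.fst + .num 1) e.snd)
    (.pair (s.fst + .num 1) (fma e.fst (load e.fst x) (.num 1) s.snd)) s

/-- The sum of the first `m` entries of a list. -/
def sumV (K m l : Val) : Val := (fold sumStep (.pair K m) l.toList (.pair (.num 0) (.num 0))).snd

@[fun_prop]
theorem FP.sumV {K m l : Val → Val} (hK : FP K) (hm : FP m) (hl : FP l) :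
    FP fun v => sumV (K v) (m v) (l v) := by
  unfold LatticeID.sumV
  obtain ⟨b, hb⟩ := exists_size_fma_le
  refine FP.snd (FP.fold (g := sumStep) ?_ ⟨b + 5, fun x s e => ?_⟩ hl
    (S := fun v => Val.pair (Val.num 0) (Val.num 0)) (by fun_prop)
    (E := fun v => Val.pair (K v) (m v)) (by fun_prop))
  · unfold sumStep; fun_prop
  · have h1 := eval_mono_nat b (e.size_fst_le.trans (Nat.le_add_left e.size x.size))
    have h2 := hb e.fst (LatticeID.load e.fst x) (.num 1) s.snd
    have h3 := s.fst.size_add_le (.num 1)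
    have h4 := s.size_fst_le
    unfold sumStep Val.ite
    split_ifs
    · simp only [Val.size, Int.natAbs_one, Nat.size_one, eval_add, eval_ofNat] at h3 ⊢
      omega
    · omega

/-- A step of the comparison of the norm with a bound. -/
def chkStep (x s e : Val) : Val :=
  Val.ite (Val.le x e) (Val.ite (Val.le (.num 0 - x) e) s (.num 0)) (.num 0)

/-- Comparison of the norm with a bound. -/
def chkV (K eta w : Val) : Val := fold chkStep eta (normR K.fst K.snd.fst w).toList (.num 1)

@[fun_prop]
theorem FP.chkV {K eta w : Val → Val} (hK : FP K) (he : FP eta) (hw : FP w) :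
    FP fun v => chkV (K v) (eta v) (w v) := by
  unfold LatticeID.chkV
  refine FP.fold (g := chkStep) ?_ ⟨1, fun x s e => ?_⟩
    (L := fun v => LatticeID.normR (K v).fst (K v).snd.fst (w v))
    (S := fun v => Val.num 1) (by fun_prop) (by fun_prop) he
  · unfold chkStep; fun_prop
  · have := s.one_le_size
    unfold chkStep Val.ite
    split_ifs <;> simp [Val.size]

/-- Equality of integers. -/
def eqV (a b : Val) : Val := Val.ite (Val.le a b) (Val.le b a) (.num 0)

@[fun_prop]
theorem FP.eqV {a b : Val → Val} (ha : FP a) (hb : FP b) : FP fun v => eqV (a v) (b v) := by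
  unfold LatticeID.eqV; fun_prop

/-- The verification algorithm. -/
def verV (K mu eta a us ls v c z₁ z₂ : Val) : Val :=
  Val.ite (eqV (fma K a (load K z₁) (load K z₂)) (fma K (dotV K us ls) (load K c) (sumV K mu v)))
    (Val.ite (chkV K eta z₁) (chkV K eta z₂) (.num 0)) (.num 0)

@[fun_prop]
theorem FP.verV {K mu eta a us ls w c z₁ z₂ : Val → Val} (hK : FP K) (h1 : FP mu) (h2 : FP eta)
    (h3 : FP a) (h4 : FP us) (h5 : FP ls) (h6 : FP w) (h7 : FP c) (h8 : FP z₁) (h9 : FP z₂) :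
    FP fun v => verV (K v) (mu v) (eta v) (a v) (us v) (ls v) (w v) (c v) (z₁ v) (z₂ v) := by
  unfold LatticeID.verV; fun_prop

/-! ### Sampling -/

/-- One coefficient of a challenge is sampled. -/
def sampStep (_x s e : Val) : PMF Val :=
  (randNum (Val.ite (Val.le (.num 2 * s.fst + .num 1) e.fst) (.num 2 * e.snd + .num 1)
    (.num 1)).toInt.toNat).bind fun w => PMF.pure (.pair (s.fst - .num 1)
      (.pair (w - Val.ite (Val.le (.num 2 * s.fst + .num 1) e.fst) e.snd (.num 0)) s.snd))

/-- The logarithm of the length of a list. -/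
def logV (un : Val) : Val := lenV (bits (lenV un)) - .num 1

@[fun_prop]
theorem FP.logV {un : Val → Val} (hun : FP un) : FP fun v => logV (un v) := by
  unfold LatticeID.logV; fun_prop

/-- A challenge is sampled. -/
def sampleC (un : Val) : PMF Val :=
  (foldM sampStep (.pair (lenV un) (logV un)) un.toList (.pair (lenV un - .num 1) (.num 0))).bind
    fun s => PMF.pure s.snd

theorem PP.sampleC {un : Val → Val} (hun : FP un) : PP fun v => sampleC (un v) := by
  unfold LatticeID.sampleC
  refine PP.bind (G := fun w _ => PMF.pure w.snd) (PP.foldM (G := sampStep) ?_ ?_ hun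
    (E := fun v => .pair (LatticeID.lenV (un v)) (LatticeID.logV (un v)))
    (S := fun v => Val.pair (LatticeID.lenV (un v) - .num 1) (Val.num 0)) (by fun_prop)
    (by fun_prop)) (show FP fun p => p.fst.snd by fun_prop)
  · unfold sampStep
    refine PP.bind (F := fun p => _) (G := fun w p => PMF.pure (.pair (p.snd.fst.fst - .num 1)
      (.pair (w - Val.ite (Val.le (.num 2 * p.snd.fst.fst + .num 1) p.snd.snd.fst) p.snd.snd.snd
        (.num 0)) p.snd.fst.snd))) (PP.rand (f := fun p => Val.ite
        (Val.le (.num 2 * p.snd.fst.fst + .num 1) p.snd.snd.fst)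
        (.num 2 * p.snd.snd.snd + .num 1) (.num 1)) (by fun_prop)) ?_
    exact show FP fun p => _ by fun_prop
  · refine ⟨30 + 5 * X, fun x s e w hw => ?_⟩
    simp only [sampStep, PMF.mem_support_bind_iff, PMF.mem_support_pure_iff] at hw
    obtain ⟨r, hr, rfl⟩ := hw
    have h1 := e.size_snd_le
    have hr' : r.size ≤ e.size + 10 := by
      obtain ⟨i, hi, rfl⟩ := randNum_support hr
      have h3 := (Val.num 2 * e.snd).size_add_le (.num 1)
      have h4 := (Val.num 2).size_mul_le e.snd
      have h5 : (Val.num 2).size = 3 := rfl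
      have h6 : (Val.num 1).size = 2 := rfl
      unfold Val.ite at hi
      split_ifs at hi
      · have h2 := size_le_of_natAbs_le (a := (i : ℤ)) (b := (Val.num 2 * e.snd + .num 1).toInt)
          (by omega)
        have : (Val.num 2 * e.snd + .num 1) = Val.num (Val.num 2 * e.snd + .num 1).toInt := rfl
        rw [← this] at h2
        omega
      · have h2 := size_le_of_natAbs_le (a := (i : ℤ)) (b := 1) (by
          have : (Val.num 1).toInt = 1 := rfl
          omega)
        omega
    have h7 := s.fst.size_sub_le (.num 1)
    have h8 := s.size_fst_add_size_snd_le
    have h9 := r.size_sub_le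
      (Val.ite (Val.le (.num 2 * s.fst + .num 1) e.fst) e.snd (.num 0))
    have h10 : (Val.ite (Val.le (.num 2 * s.fst + .num 1) e.fst) e.snd (.num 0)).size ≤
        e.size + 1 := by
      unfold Val.ite
      split_ifs
      · omega
      · simp [Val.size]
    have h11 : (Val.num 1).size = 2 := rfl
    simp only [Val.size_pair, eval_add, eval_mul, eval_X, eval_ofNat]
    omega

/-- A list of challenges is sampled. -/
def sampleL (un l : Val) : PMF Val :=
  foldM (fun _ s e => (sampleC e).bind fun c => PMF.pure (.pair c s)) un l.toList (.num 0)

theorem PP.sampleL {un l : Val → Val} (hun : FP un) (hl : FP l) :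
    PP fun v => sampleL (un v) (l v) := by
  obtain ⟨b, hb⟩ := (PP.sampleC FP.id).exists_size_le
  refine PP.foldM (G := fun _ s e => (LatticeID.sampleC e).bind fun c => PMF.pure (.pair c s)) ?_
    ⟨b + 1, fun x s e w hw => ?_⟩ hl (S := fun _ => .num 0) (by fun_prop) hun
  · refine PP.bind (F := fun p => LatticeID.sampleC p.snd.snd)
      (G := fun c p => PMF.pure (.pair c p.snd.fst)) (PP.sampleC (by fun_prop)) ?_
    exact show FP fun p => _ by fun_prop
  · simp only [PMF.mem_support_bind_iff, PMF.mem_support_pure_iff] at hw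
    obtain ⟨c, hc, rfl⟩ := hw
    have h1 := hb e c hc
    have h2 := eval_mono_nat b (Nat.le_add_left e.size x.size)
    simp only [Val.size, eval_add, eval_one]
    omega

/-! ## Correctness of the programs for the arithmetic of `R_q` -/

/-- The bound on the coefficients in computations in `R`. -/
def coeffBound (n q : ℕ) : ℕ := 4 * n ^ 2 * q ^ 3

/-- The context of computations in `R_q`. -/
def ctx (n q : ℕ) : Val :=
  .pair (unary n) (.pair (.num q) (.pair (.num (2 * coeffBound n q : ℕ))
    (.num ((2 * coeffBound n q) ^ n + 1 : ℕ))))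

theorem lenV_unary (n : ℕ) : lenV (unary n) = .num n := by simp [lenV_eq]

theorem fold_cons (g : Val → Val → Val → Val) (e x : Val) (l : List Val) (s : Val) :
    fold g e (x :: l) s = fold g e l (g x s e) := rfl

theorem fold_append (g : Val → Val → Val → Val) (e : Val) (l l' : List Val) (s : Val) :
    fold g e (l ++ l') s = fold g e l' (fold g e l s) := List.foldl_append

theorem powV_unary (b : ℤ) (n : ℕ) : powV (.num b) (unary n) = .num (b ^ n) := by
  unfold powV
  rw [toList_unary]
  induction n with
  | zero => simp [fold]
  | succ n ih =>
    rw [List.replicate_succ', fold_append, ih, fold_cons, pow_succ]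
    rfl

theorem mkCtx_eq (n q : ℕ) : mkCtx (unary n) (.num q) = ctx n q := by
  have h : Val.num 8 * (lenV (unary n) * lenV (unary n)) * (.num q * .num q * .num q) =
      .num (2 * coeffBound n q : ℕ) := by
    rw [lenV_unary]
    change Val.num (8 * ((n : ℤ) * n) * ((q : ℤ) * q * q)) = _
    congr 1
    unfold coeffBound
    push_cast; ring
  unfold mkCtx ctx
  rw [h, powV_unary]
  congr 3

/-- The list of the entries of a vector, in reversed order. -/
def revList {n : ℕ} (v : Fin n → ℤ) : Val := .ofList (List.ofFn fun i => Val.num (v i)).reverse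

theorem Val.fst_eq_getD (w : Val) : w.fst = w.toList.getD 0 (.num 0) := by
  cases w <;> simp [Val.fst, Val.toList]

theorem Val.toList_snd (w : Val) : w.snd.toList = w.toList.tail := by
  cases w <;> simp [Val.snd, Val.toList]

theorem normR_eq (n : ℕ) (q w : Val) :
    normR (unary n) q w = revList fun i : Fin n => cmod q.toInt (w.toList.getD i (.num 0)).toInt := by
  have key : ∀ (n : ℕ) (w : Val) (out : List Val),
      (fold normStep q (List.replicate n (.num 0)) (.pair w (.ofList out))).snd =
      .ofList ((List.ofFn fun i : Fin n =>
        Val.num (cmod q.toInt (w.toList.getD i (.num 0)).toInt)).reverse ++ out) := by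
    intro n
    induction n with
    | zero => intro w out; simp [fold]
    | succ n ih =>
      intro w out
      rw [List.replicate_succ, fold_cons]
      have : normStep (.num 0) (.pair w (.ofList out)) q = .pair w.snd (.ofList
          (Val.num (cmod q.toInt (w.toList.getD 0 (.num 0)).toInt) :: out)) := by
        rw [← Val.fst_eq_getD, ← cmodV_eq]; rfl
      rw [this, ih, List.ofFn_succ, List.reverse_cons, List.append_assoc, Val.toList_snd]
      simp
  unfold normR revList
  rw [toList_unary]
  simpa using! key n w []

/-- Programs build their output by pushing to the front, hence in reversed order. That is the order
in which Horner's rule consumes coefficients. -/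
theorem horner_revList {n : ℕ} (B : ℤ) (v : Fin n → ℤ) :
    horner (.num B) (revList v) = .num (kron B v) := by
  unfold horner revList
  rw [Val.toList_ofList]
  induction n with
  | zero => simp [fold, kron]
  | succ n ih =>
    rw [List.ofFn_succ, List.reverse_cons, fold_append, ih, kron_succ]
    change Val.num (kron B (fun i => v i.succ) * B + v 0) = _
    congr 1; ring

theorem digitsR_eq {n : ℕ} (m : Val) {h : ℤ} (v : Fin n → ℤ) (hv : ∀ i, |v i| < h) :
    digitsR m (.num (2 * h)) (unary n) (.num (kron (2 * h) v)) =
      revList fun i => cmod m.toInt (v i) := by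
  have key : ∀ (n : ℕ) (v : Fin n → ℤ) (_ : ∀ i, |v i| < h) (out : List Val),
      (fold digStep (.pair m (.num (2 * h))) (List.replicate n (.num 0))
        (.pair (.num (kron (2 * h) v)) (.ofList out))).snd =
      .ofList ((List.ofFn fun i : Fin n => Val.num (cmod m.toInt (v i))).reverse ++ out) := by
    intro n
    induction n with
    | zero => intro v hv out; simp [fold]
    | succ n ih =>
      intro v hv out
      rw [List.replicate_succ, fold_cons]
      have h0 := hv 0
      have h1 : (0 : ℤ) < h := (abs_nonneg _).trans_lt h0
      have hc : cmod (2 * h) (kron (2 * h) v) = v 0 := by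
        refine cmod_eq (by omega) ?_
        rw [kron_succ]
        exact ⟨_, add_sub_cancel_left _ _⟩
      have hstep : digStep (.num 0) (.pair (.num (kron (2 * h) v)) (.ofList out))
          (.pair m (.num (2 * h))) = .pair (.num (kron (2 * h) fun i => v i.succ))
            (.ofList (Val.num (cmod m.toInt (v 0)) :: out)) := by
        simp only [digStep, Val.fst_pair, Val.snd_pair, cmodV_eq, Val.toInt_num, hc, Val.ofList]
        congr 1
        change Val.num ((kron (2 * h) v - v 0) / (2 * h)) = _
        rw [kron_succ, add_sub_cancel_left, Int.mul_ediv_cancel_left _ (by omega)]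
      rw [hstep, ih _ fun i => hv i.succ, List.ofFn_succ, List.reverse_cons, List.append_assoc]
      simp
  unfold digitsR revList
  rw [toList_unary]
  simpa using! key n v hv []

theorem rev_eq (l : Val) : rev l = .ofList l.toList.reverse := by
  have key : ∀ (l out : List Val), fold (fun x s _ => Val.pair x s) (.num 0) l (.ofList out) =
      .ofList (l.reverse ++ out) := by
    intro l
    induction l with
    | nil => intro out; rfl
    | cons a l ih =>
      intro out
      rw [fold_cons]
      simpa [Val.ofList] using ih (a :: out)
  unfold rev
  simpa [Val.ofList] using key l.toList []

section Spec

variable {n q : ℕ} [NeZero n]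

/-- The integer that represents an element of `R_q` in computations. -/
def repQ (r : Rq q n) : Val := .num (kron (2 * coeffBound n q : ℕ) (coeffs (liftQ r)))

theorem load_eq (hq : q % 2 = 1) (w : Val) : load (ctx n q) w = repQ (decQ q n w) := by
  unfold load ctx
  simp only [Val.fst_pair, Val.snd_pair]
  rw [normR_eq, horner_revList, repQ]
  congr 2
  funext i
  simp only [Val.toInt_num]
  rw [cmod_eq_valMinAbs hq, coeffs_liftQ, decQ, coeffs_ofCoeffs]

theorem lt_of_normLe {u : Rz n} {h : ℕ} (hu : NormLe u (h - 1)) (i : Fin n) :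
    |coeffs u i| < (h : ℤ) := by
  have := hu i
  rw [← Int.cast_abs] at this
  have h2 : ((|coeffs u i| : ℤ) : ℝ) < ((h : ℤ) : ℝ) := by push_cast at this ⊢; linarith
  exact_mod_cast h2

theorem outZ_eq {u : Rz n} (hu : NormLe u (coeffBound n q - 1)) {z : ℤ}
    (hz : (z : ZMod ((2 * coeffBound n q) ^ n + 1)) = kronHom n (2 * coeffBound n q) u) :
    outZ (ctx n q) (.num z) = encZ u := by
  unfold outZ ctx
  simp only [Val.fst_pair, Val.snd_pair]
  have h1 := cmod_kron hu hz
  rw [cmodV_eq]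
  have hlt := lt_of_normLe hu
  push_cast
  simp only [Val.toInt_num]
  rw [h1, digitsR_eq _ _ hlt, rev_eq, revList, Val.toList_ofList, List.reverse_reverse, encZ]
  congr 3
  funext i
  congr 1
  simp only [Val.toInt_num]
  refine cmod_eq ?_ (by simp)
  have := hlt i
  omega

theorem sub_red_eq (hq : q % 2 = 1) {u : Rz n} {r : Rq q n} (h : red q u = r) (i : Fin n) :
    cmod q (coeffs u i) = coeffs (liftQ r) i := by
  rw [cmod_eq_valMinAbs hq, coeffs_liftQ, ← h, coeffs_red]

/-- Any integer congruent to the Kronecker image of a small `u` will do. Its balanced residue is the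
packed form of `u`, the digits are the coefficients of `u`, and these are reduced modulo `q` one by
one and packed again. So sums and products may be computed in `ℤ` and normalized once at the end. -/
theorem reduce_eq (hq : q % 2 = 1) {u : Rz n} (hu : NormLe u (coeffBound n q - 1)) {z : ℤ}
    (hz : (z : ZMod ((2 * coeffBound n q) ^ n + 1)) = kronHom n (2 * coeffBound n q) u) :
    horner (.num (2 * coeffBound n q : ℕ)) (digitsR (.num q) (.num (2 * coeffBound n q : ℕ))
      (unary n) (cmodV (.num ((2 * coeffBound n q) ^ n + 1 : ℕ)) (.num z))) =
      repQ (red q u) := by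
  have h1 := cmod_kron hu hz
  rw [cmodV_eq]
  have hlt := lt_of_normLe hu
  push_cast
  simp only [Val.toInt_num]
  rw [h1, digitsR_eq _ _ hlt, horner_revList, repQ]
  push_cast
  congr 2
  funext i
  exact sub_red_eq hq rfl i

theorem cast_repQ (r : Rq q n) : (((repQ r).toInt : ℤ) : ZMod ((2 * coeffBound n q) ^ n + 1)) =
    kronHom n (2 * coeffBound n q) (liftQ r) := by
  rw [kronHom_eq]; rfl

theorem one_le_nq (n q : ℕ) [NeZero n] (hq : q % 2 = 1) : (1 : ℝ) ≤ n ∧ (1 : ℝ) ≤ q := by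
  have h1 : 1 ≤ n := NeZero.pos n
  have h2 : 1 ≤ q := by omega
  exact ⟨by exact_mod_cast h1, by exact_mod_cast h2⟩

theorem fma_eq (hq : q % 2 = 1) (a b c : Rq q n) :
    fma (ctx n q) (repQ a) (repQ b) (repQ c) = repQ (a * b + c) := by
  have : NeZero q := ⟨by omega⟩
  have hu : NormLe (liftQ a * liftQ b + liftQ c) (coeffBound n q - 1) := by
    refine (((normLe_liftQ_half a).mul (normLe_liftQ_half b)).add (normLe_liftQ_half c)).mono ?_
    obtain ⟨h1, h2⟩ := one_le_nq n q hq
    have h3 : (n : ℝ) ≤ n ^ 2 := by nlinarith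
    have h4 : (q : ℝ) ≤ q ^ 2 := by nlinarith
    have h5 : (q : ℝ) ^ 2 ≤ q ^ 3 := by nlinarith [sq_nonneg (q : ℝ)]
    have h6 : (n : ℝ) * q ^ 2 ≤ n ^ 2 * q ^ 3 := mul_le_mul h3 h5 (by positivity) (by positivity)
    have h7 : 1 * (q : ℝ) ^ 3 ≤ n ^ 2 * q ^ 3 :=
      mul_le_mul_of_nonneg_right (by linarith) (by positivity)
    unfold coeffBound
    push_cast
    nlinarith
  have := reduce_eq hq hu (z := (repQ a).toInt * (repQ b).toInt + (repQ c).toInt) (by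
    push_cast
    rw [cast_repQ, cast_repQ, cast_repQ, map_add, map_mul])
  rw [map_add, map_mul, red_liftQ, red_liftQ, red_liftQ] at this
  exact this

theorem repQ_zero : repQ (0 : Rq q n) = .num 0 := by
  unfold repQ kron
  simp [coeffs_liftQ]

theorem kron_one (B : ℤ) : kron B (coeffs (1 : Rz n)) = 1 := by
  obtain ⟨m, rfl⟩ : ∃ m, n = m + 1 := ⟨n - 1, (Nat.succ_pred (NeZero.ne n)).symm⟩
  have h : (1 : Rz (m + 1)) = ofCoeffs (Fin.cons 1 fun _ => 0) := by
    rw [ofCoeffs_eq_sum, Fin.sum_univ_succ]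
    simp
  rw [h, coeffs_ofCoeffs, kron_succ]
  simp [kron]

theorem normLe_one : NormLe (1 : Rz n) 1 := by
  obtain ⟨m, rfl⟩ : ∃ m, n = m + 1 := ⟨n - 1, (Nat.succ_pred (NeZero.ne n)).symm⟩
  have h : (1 : Rz (m + 1)) = ofCoeffs (Fin.cons 1 fun _ => 0) := by
    rw [ofCoeffs_eq_sum, Fin.sum_univ_succ]
    simp
  intro i
  rw [h, coeffs_ofCoeffs]
  refine Fin.cases ?_ (fun i => ?_) i <;> simp

theorem repQ_one (hq : 3 ≤ q) : repQ (1 : Rq q n) = .num 1 := by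
  have : NeZero q := ⟨by omega⟩
  have h : liftQ (1 : Rq q n) = 1 := by
    rw [← map_one (red q), liftQ_red normLe_one]
    have : (3 : ℝ) ≤ q := by exact_mod_cast hq
    linarith
  rw [repQ, h, kron_one]

/-- The coefficients can be read back from the integer by `outZ_eq`. Equality in `R_q` may thus be
tested by one comparison of integers. -/
theorem repQ_injective (hq : q % 2 = 1) : Function.Injective (fun r : Rq q n => (repQ r).toInt) := by
  intro r s h
  have : NeZero q := ⟨by omega⟩
  have hle : ((q : ℝ) / 2) ≤ coeffBound n q - 1 := by
    obtain ⟨h1, h2⟩ := one_le_nq n q hq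
    have h3 : (1 : ℝ) ≤ n ^ 2 := by nlinarith
    have h4 : (q : ℝ) ≤ q ^ 2 := by nlinarith
    have h5 : (q : ℝ) ^ 2 ≤ q ^ 3 := by nlinarith [sq_nonneg (q : ℝ)]
    have h7 : 1 * (q : ℝ) ^ 3 ≤ n ^ 2 * q ^ 3 :=
      mul_le_mul_of_nonneg_right (by linarith) (by positivity)
    unfold coeffBound
    push_cast
    nlinarith
  have h1 := reduce_eq hq ((normLe_liftQ_half r).mono hle) (cast_repQ r)
  have h2 := reduce_eq hq ((normLe_liftQ_half s).mono hle) (cast_repQ s)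
  have h3 := outZ_eq ((normLe_liftQ_half r).mono hle) (cast_repQ r)
  have h4 := outZ_eq ((normLe_liftQ_half s).mono hle) (cast_repQ s)
  beta_reduce at h
  rw [h, h4] at h3
  have h5 : coeffs (liftQ s) = coeffs (liftQ r) := by
    have := congrArg Val.toList h3
    simp only [encZ, Val.toList_ofList] at this
    have := List.ofFn_injective this
    funext i
    simpa using congrFun this i
  have h6 := coeffs_injective h5
  rw [← red_liftQ r, ← red_liftQ s, h6]

theorem eqV_eq (a b : Val) : eqV a b = .num (if a.toInt = b.toInt then 1 else 0) := by
  unfold eqV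
  rw [Val.ite_le, Val.le]
  by_cases h : a.toInt ≤ b.toInt
  · simp only [h, if_true]
    congr 1
    by_cases h' : b.toInt ≤ a.toInt
    · rw [if_pos h', if_pos (le_antisymm h h')]
    · rw [if_neg h', if_neg fun e => h' e.ge]
  · rw [if_neg h, if_neg fun e => h e.le]

theorem Val.ite_num_one_zero (p : Prop) [Decidable p] (a b : Val) :
    Val.ite (.num (if p then 1 else 0)) a b = if p then a else b := by
  unfold Val.ite
  by_cases h : p <;> simp [h, Val.truth]

/-- Square-and-multiply from the most significant bit on: appending a bit `d` replaces the exponent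
`e` by `2e + d`, which matches `Nat.ofDigits` on the list read from its other end. -/
theorem invV_eq (hq : q % 2 = 1) (hq3 : 3 ≤ q) (r : Rq q n) :
    invV (ctx n q) (repQ r) = repQ (r ^ (q ^ n - 2)) := by
  have hsq : ∀ s : Rq q n, fma (ctx n q) (repQ s) (repQ s) (.num 0) = repQ (s * s) := fun s => by
    rw [← repQ_zero (n := n) (q := q), fma_eq hq, add_zero]
  have hmul : ∀ s : Rq q n, fma (ctx n q) (repQ s) (repQ r) (.num 0) = repQ (s * r) := fun s => by
    rw [← repQ_zero (n := n) (q := q), fma_eq hq, add_zero]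
  have key : ∀ l : List ℕ, (∀ d ∈ l, d < 2) →
      fold sqmStep (.pair (ctx n q) (repQ r)) (l.reverse.map fun d : ℕ => Val.num (d : ℤ))
        (.num 1) = repQ (r ^ Nat.ofDigits 2 l) := by
    intro l
    induction l with
    | nil => intro _; simp [fold, repQ_one hq3]
    | cons d l ih =>
      intro hd
      rw [List.reverse_cons, List.map_append, fold_append,
        ih fun d hd' => hd d (List.mem_cons_of_mem _ hd'), Nat.ofDigits_cons]
      simp only [List.map_cons, List.map_nil, fold_cons]
      have h2 := hd d (by simp)
      have e : r ^ (d + 2 * Nat.ofDigits 2 l) =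
          r ^ Nat.ofDigits 2 l * r ^ Nat.ofDigits 2 l * r ^ d := by ring
      rw [show r ^ (((d : ℕ) : ℕ) + 2 * Nat.ofDigits 2 l) = _ from e]
      unfold sqmStep
      simp only [Val.fst_pair, Val.snd_pair, fold, List.foldl_nil, hsq, hmul]
      interval_cases d
      · simp [Val.ite, Val.truth]
      · simp [Val.ite, Val.truth]
  unfold invV ctx
  simp only [Val.fst_pair, Val.snd_pair]
  have h2 : 2 ≤ q ^ n := (show 2 ≤ q by omega).trans (Nat.le_self_pow (NeZero.ne n) q)
  have he : (powV (.num q) (unary n) - .num 2).toInt.toNat = q ^ n - 2 := by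
    rw [powV_unary, Val.toInt_sub, Val.toInt_num, Val.toInt_num]
    have : ((q : ℤ) ^ n) = ((q ^ n : ℕ) : ℤ) := by push_cast; rfl
    omega
  rw [bits, he, Val.toList_ofList]
  have := key (Nat.digits 2 (q ^ n - 2)) fun d hd => Nat.digits_lt_base (by norm_num) hd
  rw [Nat.ofDigits_digits] at this
  exact this

theorem dotV_eq (hq : q % 2 = 1) (us ls : Val) : dotV (ctx n q) us ls =
    repQ (∑ i : Fin us.toList.length,
      decQ q n (ls.toList.getD i (.num 0)) * decQ q n (us.toList.get i)) := by
  have key : ∀ (us : List Val) (ls : Val) (acc : Rq q n),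
      (fold dotStep (ctx n q) us (.pair ls (repQ acc))).snd = repQ (acc +
        ∑ i : Fin us.length, decQ q n (ls.toList.getD i (.num 0)) * decQ q n (us.get i)) := by
    intro us
    induction us with
    | nil => intro ls acc; simp [fold]
    | cons u us ih =>
      intro ls acc
      rw [fold_cons]
      have : dotStep u (.pair ls (repQ acc)) (ctx n q) = .pair ls.snd
          (repQ (decQ q n (ls.toList.getD 0 (.num 0)) * decQ q n u + acc)) := by
        unfold dotStep
        simp only [Val.fst_pair, Val.snd_pair]
        rw [load_eq hq, load_eq hq, fma_eq hq, Val.fst_eq_getD]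
      rw [this, ih]
      congr 1
      simp only [List.length_cons]
      rw [Fin.sum_univ_succ, Val.toList_snd]
      simp only [List.get_eq_getElem, Fin.val_zero, Fin.val_succ, List.getElem_cons_zero,
        List.getElem_cons_succ, List.getD_eq_getElem?_getD, List.getElem?_tail]
      ring
  have := key us.toList ls 0
  rw [repQ_zero, zero_add] at this
  exact this

theorem decQ_zero : decQ q n (.num 0) = 0 := by
  apply coeffs_injective
  funext i
  rw [decQ, coeffs_ofCoeffs, coeffs_zero]
  simp [Val.toList]

theorem sumV_eq (hq : q % 2 = 1) (hq3 : 3 ≤ q) (m : ℕ) (l : Val) : sumV (ctx n q) (.num m) l =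
    repQ (∑ j : Fin m, decQ q n (l.toList.getD j (.num 0))) := by
  -- Here `i` entries have been summed and `m` are to come. If the list ends early, the missing
  -- entries count as `0`, in accordance with `getD`.
  have key : ∀ (l : List Val) (m i : ℕ) (acc : Rq q n),
      (fold sumStep (.pair (ctx n q) (.num (i + m : ℕ))) l (.pair (.num i) (repQ acc))).snd =
      repQ (acc + ∑ j ∈ Finset.range m, decQ q n (l.getD j (.num 0))) := by
    intro l
    induction l with
    | nil => intro m i acc; simp [fold, decQ_zero]
    | cons x l ih =>
      intro m i acc
      rw [fold_cons]
      rcases m with _ | m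
      · have : sumStep x (.pair (.num i) (repQ acc)) (.pair (ctx n q) (.num (i + 0 : ℕ))) =
            .pair (.num i) (repQ acc) := by
          unfold sumStep
          rw [Val.ite_le, if_neg]
          simp
        rw [this, ih 0]
        simp
      · have : sumStep x (.pair (.num i) (repQ acc)) (.pair (ctx n q) (.num (i + (m + 1) : ℕ))) =
            .pair (.num (i + 1 : ℕ)) (repQ (decQ q n x + acc)) := by
          unfold sumStep
          rw [Val.ite_le, if_pos (by simp)]
          simp only [Val.fst_pair, Val.snd_pair]
          have h1 := fma_eq hq (decQ q n x) 1 acc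
          rw [repQ_one hq3, mul_one] at h1
          rw [load_eq hq, h1]
          rfl
        rw [this, show i + (m + 1) = (i + 1) + m by ring, ih m (i + 1), Finset.sum_range_succ']
        congr 1
        simp only [List.getD_cons_succ, List.getD_cons_zero]
        ring
  have := key l.toList m 0 0
  rw [repQ_zero, zero_add, zero_add, Finset.sum_range] at this
  exact this

open Classical in
theorem chkV_eq (hq : q % 2 = 1) (η : ℝ) (w : Val) : chkV (ctx n q) (.num ⌊η⌋) w =
    .num (if NormLeQ (decQ q n w) η then 1 else 0) := by
  have key : ∀ (e : ℤ) (l : List ℤ) (s : ℤ), fold chkStep (.num e) (l.map Val.num) (.num s) =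
      if ∀ x ∈ l, |x| ≤ e then .num s else .num 0 := by
    intro e l
    induction l with
    | nil => intro s; simp [fold]
    | cons x l ih =>
      intro s
      have h : chkStep (.num x) (.num s) (.num e) = .num (if |x| ≤ e then s else 0) := by
        unfold chkStep
        rw [Val.ite_le, Val.ite_le]
        have h0 : |x| ≤ e ↔ x ≤ e ∧ 0 - x ≤ e := by
          rw [abs_le]; constructor <;> (intro h; omega)
        by_cases h1 : x ≤ e <;> by_cases h2 : 0 - x ≤ e <;>
          simp only [Val.toInt_num, Val.toInt_sub, h0, h1, h2, if_true, if_false, and_self,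
            and_true, and_false]
      rw [List.map_cons, fold_cons, h, ih]
      simp only [List.mem_cons, forall_eq_or_imp]
      by_cases h1 : |x| ≤ e <;> by_cases h2 : ∀ x ∈ l, |x| ≤ e <;> simp [h1, h2]
  unfold chkV ctx
  simp only [Val.fst_pair, Val.snd_pair]
  rw [normR_eq, revList, Val.toList_ofList]
  have hl : ∀ v : Fin n → ℤ, (List.ofFn fun i => Val.num (v i)).reverse =
      (List.ofFn v).reverse.map Val.num := fun v => by
    rw [List.map_reverse, List.map_ofFn]; rfl
  rw [hl, key]
  have hiff : (∀ x ∈ (List.ofFn fun i : Fin n => cmod (Val.num (q : ℤ)).toInt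
      (w.toList.getD i (.num 0)).toInt).reverse, |x| ≤ ⌊η⌋) ↔ NormLeQ (decQ q n w) η := by
    simp only [List.mem_reverse, List.mem_ofFn, forall_exists_index, forall_apply_eq_imp_iff,
      Val.toInt_num, Int.le_floor, NormLeQ]
    refine forall_congr' fun i => ?_
    rw [cmod_eq_valMinAbs hq, decQ, coeffs_ofCoeffs, Int.cast_abs]
  simp only [hiff]
  exact (apply_ite Val.num _ _ _).symm

open Classical in
theorem verV_eq (hq : q % 2 = 1) (hq3 : 3 ≤ q) (m : ℕ) (η : ℝ) (a : Rq q n)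
    (us ls v c z₁ z₂ : Val) :
    verV (ctx n q) (.num m) (.num ⌊η⌋) (repQ a) us ls v c z₁ z₂ =
    .num (if ∑ j : Fin m, decQ q n (v.toList.getD j (.num 0)) =
        a * decQ q n z₁ + decQ q n z₂ - (∑ i : Fin us.toList.length,
          decQ q n (ls.toList.getD i (.num 0)) * decQ q n (us.toList.get i)) * decQ q n c ∧
        NormLeQ (decQ q n z₁) η ∧ NormLeQ (decQ q n z₂) η then 1 else 0) := by
  unfold verV
  rw [load_eq hq, load_eq hq, load_eq hq, fma_eq hq, dotV_eq hq, sumV_eq hq hq3, fma_eq hq, eqV_eq,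
    chkV_eq hq, chkV_eq hq, Val.ite_num_one_zero, Val.ite_num_one_zero]
  -- The program has moved the term with the key to the other side, so that both sides are values of
  -- `fma`.
  have hiff : ∀ s t u w : Rq q n, (repQ (a * s + t)).toInt = (repQ (u * w + (∑ j : Fin m,
      decQ q n (v.toList.getD j (.num 0))))).toInt ↔
      ∑ j : Fin m, decQ q n (v.toList.getD j (.num 0)) = a * s + t - u * w := by
    intro s t u w
    constructor
    · intro h
      rw [repQ_injective hq h]; ring
    · intro h
      rw [h]; congr 2; ring
  simp only [hiff]
  split_ifs <;> first | rfl | (exfalso; tauto)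

theorem decQ_encQ (a : Rq q n) : decQ q n (encQ a) = a := by
  apply coeffs_injective
  funext i
  rw [decQ, coeffs_ofCoeffs, encQ, Val.toList_ofList]
  simp

theorem decQ_encZ (c : Rz n) : decQ q n (encZ c) = red q c := by
  apply coeffs_injective
  funext i
  rw [decQ, coeffs_ofCoeffs, encZ, Val.toList_ofList, coeffs_red]
  simp

theorem decZ_encZ (c : Rz n) : decZ n (encZ c) = c := by
  apply coeffs_injective
  funext i
  rw [decZ, coeffs_ofCoeffs, encZ, Val.toList_ofList]
  simp

theorem encZ_liftQ (a : Rq q n) : encZ (liftQ a) = encQ a := by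
  unfold encZ encQ
  simp only [coeffs_liftQ]

theorem outZ_repQ (hq : q % 2 = 1) (a : Rq q n) : outZ (ctx n q) (repQ a) = encQ a := by
  have : NeZero q := ⟨by omega⟩
  rw [← encZ_liftQ]
  refine outZ_eq ((normLe_liftQ_half a).mono ?_) (cast_repQ a)
  obtain ⟨h1, h2⟩ := one_le_nq n q hq
  have h3 : (1 : ℝ) ≤ n ^ 2 := by nlinarith
  have h4 : (q : ℝ) ≤ q ^ 2 := by nlinarith
  have h5 : (q : ℝ) ^ 2 ≤ q ^ 3 := by nlinarith [sq_nonneg (q : ℝ)]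
  have h7 : 1 * (q : ℝ) ^ 3 ≤ n ^ 2 * q ^ 3 :=
    mul_le_mul_of_nonneg_right (by linarith) (by positivity)
  unfold coeffBound
  push_cast
  nlinarith

end Spec

/-! ## Expectations -/

open scoped ENNReal

/-- The expectation of a nonnegative function. -/
def expect {α : Type*} (p : PMF α) (f : α → ℝ≥0∞) : ℝ≥0∞ := ∑' a, p a * f a

open Classical in
/-- The indicator of a proposition. -/
def ind (P : Prop) : ℝ≥0∞ := if P then 1 else 0

theorem ind_le_one (P : Prop) : ind P ≤ 1 := by unfold ind; split_ifs <;> simp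

theorem ind_of {P : Prop} (h : P) : ind P = 1 := if_pos h

theorem ind_of_not {P : Prop} (h : ¬P) : ind P = 0 := if_neg h

theorem ind_mono {P Q : Prop} (h : P → Q) : ind P ≤ ind Q := by
  by_cases hP : P
  · rw [ind_of hP, ind_of (h hP)]
  · rw [ind_of_not hP]; exact zero_le

theorem ind_or_le (P Q : Prop) : ind (P ∨ Q) ≤ ind P + ind Q := by
  by_cases hP : P
  · rw [ind_of hP]; exact (ind_le_one _).trans le_self_add
  · by_cases hQ : Q
    · rw [ind_of hQ]; exact (ind_le_one _).trans le_add_self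
    · rw [ind_of_not (by tauto)]; exact zero_le

theorem ind_exists_le {ι : Type*} [Fintype ι] (P : ι → Prop) : ind (∃ i, P i) ≤ ∑ i, ind (P i) := by
  by_cases h : ∃ i, P i
  · obtain ⟨i, hi⟩ := h
    refine (ind_le_one _).trans ?_
    rw [← ind_of hi]
    exact Finset.single_le_sum (f := fun i => ind (P i)) (fun _ _ => zero_le) (Finset.mem_univ i)
  · rw [ind_of_not h]; exact zero_le

section Expect

variable {α β : Type*}

theorem expect_pure (a : α) (f : α → ℝ≥0∞) : expect (PMF.pure a) f = f a := by
  unfold expect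
  rw [tsum_eq_single a fun b hb => by simp [PMF.pure_apply, hb]]
  simp

theorem expect_bind (p : PMF α) (g : α → PMF β) (f : β → ℝ≥0∞) :
    expect (p.bind g) f = expect p fun a => expect (g a) f := by
  unfold expect
  simp only [PMF.bind_apply, ← ENNReal.tsum_mul_right, ← ENNReal.tsum_mul_left]
  rw [ENNReal.tsum_comm]
  simp only [mul_assoc]

theorem expect_map (p : PMF α) (g : α → β) (f : β → ℝ≥0∞) :
    expect (p.map g) f = expect p fun a => f (g a) := by
  rw [← PMF.bind_pure_comp, expect_bind]
  simp only [Function.comp, expect_pure]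

theorem expect_mono_support {p : PMF α} {f g : α → ℝ≥0∞} (h : ∀ a ∈ p.support, f a ≤ g a) :
    expect p f ≤ expect p g := by
  refine ENNReal.tsum_le_tsum fun a => ?_
  by_cases ha : a ∈ p.support
  · exact mul_le_mul_right (h a ha) _
  · rw [PMF.mem_support_iff, not_not] at ha; simp [ha]

theorem expect_mono {p : PMF α} {f g : α → ℝ≥0∞} (h : ∀ a, f a ≤ g a) :
    expect p f ≤ expect p g := expect_mono_support fun a _ => h a

theorem expect_const (p : PMF α) (c : ℝ≥0∞) : expect p (fun _ => c) = c := by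
  unfold expect
  rw [ENNReal.tsum_mul_right, p.tsum_coe, one_mul]

theorem expect_le {p : PMF α} {f : α → ℝ≥0∞} {c : ℝ≥0∞} (h : ∀ a, f a ≤ c) : expect p f ≤ c :=
  (expect_mono h).trans_eq (expect_const p c)

theorem expect_add (p : PMF α) (f g : α → ℝ≥0∞) :
    expect p (fun a => f a + g a) = expect p f + expect p g := by
  unfold expect
  simp only [mul_add]
  exact ENNReal.tsum_add

theorem expect_sum {ι : Type*} (s : Finset ι) (p : PMF α) (f : ι → α → ℝ≥0∞) :
    expect p (fun a => ∑ i ∈ s, f i a) = ∑ i ∈ s, expect p (f i) := by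
  classical
  induction s using Finset.induction with
  | empty => simp [expect]
  | insert i s hi ih => simp only [Finset.sum_insert hi, expect_add, ih]

theorem expect_mul_const (p : PMF α) (f : α → ℝ≥0∞) (c : ℝ≥0∞) :
    expect p (fun a => f a * c) = expect p f * c := by
  unfold expect
  rw [← ENNReal.tsum_mul_right]
  simp only [mul_assoc]

theorem expect_const_mul (p : PMF α) (f : α → ℝ≥0∞) (c : ℝ≥0∞) :
    expect p (fun a => c * f a) = c * expect p f := by
  simp only [mul_comm c]
  exact expect_mul_const p f c

theorem expect_comm (p : PMF α) (q : PMF β) (f : α → β → ℝ≥0∞) :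
    expect p (fun a => expect q (f a)) = expect q fun b => expect p fun a => f a b := by
  unfold expect
  simp only [← ENNReal.tsum_mul_left]
  rw [ENNReal.tsum_comm]
  refine tsum_congr fun b => tsum_congr fun a => ?_
  ring

theorem expect_ind_not (p : PMF α) (P : α → Prop) :
    expect p (fun a => ind (¬P a)) = 1 - expect p fun a => ind (P a) := by
  have h : expect p (fun a => ind (¬P a)) + expect p (fun a => ind (P a)) = 1 := by
    rw [← expect_add, ← expect_const p 1]
    congr 1; funext a
    by_cases h : P a
    · rw [ind_of h, ind_of_not (by simpa), zero_add]
    · rw [ind_of_not h, ind_of h, add_zero]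
  rw [← h, ENNReal.add_sub_cancel_right]
  exact ne_top_of_le_ne_top ENNReal.one_ne_top (expect_le fun a => ind_le_one _)

/-- Jensen's inequality for the square. -/
theorem sq_expect_le (p : PMF α) (f : α → ℝ≥0∞) (hf : ∀ a, f a ≤ 1) :
    expect p f ^ 2 ≤ expect p fun a => f a ^ 2 := by
  set c := expect p f with hc
  have hc1 : c ≤ 1 := expect_le hf
  have hct : c ≠ ⊤ := ne_top_of_le_ne_top ENNReal.one_ne_top hc1
  have h : 2 * c * c ≤ (expect p fun a => f a ^ 2) + c ^ 2 := by
    rw [← expect_const p (c ^ 2), ← expect_add]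
    nth_rewrite 2 [hc]
    rw [← expect_const_mul]
    refine expect_mono fun a => ?_
    have ha : f a ≠ ⊤ := ne_top_of_le_ne_top ENNReal.one_ne_top (hf a)
    lift f a to NNReal using ha with x
    obtain ⟨d, hd⟩ : ∃ d : NNReal, (d : ℝ≥0∞) = c := ⟨c.toNNReal, ENNReal.coe_toNNReal hct⟩
    rw [← hd]
    norm_cast
    exact NNReal.coe_le_coe.1 (by push_cast; nlinarith [sq_nonneg ((x : ℝ) - d)])
  have h2 : c ^ 2 + c ^ 2 ≤ (expect p fun a => f a ^ 2) + c ^ 2 := by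
    refine le_trans (le_of_eq ?_) h; ring
  exact (ENNReal.add_le_add_iff_right (ENNReal.pow_ne_top hct)).1 h2

theorem apply_true_eq_expect (p : PMF Bool) : p true = expect p fun b => ind (b = true) := by
  unfold expect
  rw [tsum_bool]
  simp [ind]

theorem prob_eq_expect (p : PMF Bool) : prob p = (expect p fun b => ind (b = true)).toReal := by
  rw [prob, apply_true_eq_expect]

end Expect

/-! ## Independent samples -/

section Indep

variable {α : Type*}

/-- Independent samples of distributions. -/
def indep : {m : ℕ} → (Fin m → PMF α) → PMF (Fin m → α)
  | 0, _ => PMF.pure Fin.elim0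
  | _ + 1, p => (p 0).bind fun a => (indep fun i => p i.succ).map fun f => Fin.cons a f

theorem iid_eq_indep (p : PMF α) (m : ℕ) : iid p m = indep fun _ : Fin m => p := by
  induction m with
  | zero => rfl
  | succ m ih => simp only [iid, indep, ih]

/-- Independence in the form in which it is used: expectations of products over the coordinates
factor. -/
theorem expect_indep_prod {m : ℕ} (p : Fin m → PMF α) (f : Fin m → α → ℝ≥0∞) :
    expect (indep p) (fun x => ∏ i, f i (x i)) = ∏ i, expect (p i) (f i) := by
  induction m with
  | zero => simp [expect_const]
  | succ m ih =>
    simp only [indep, expect_bind, expect_map, Fin.prod_univ_succ, Fin.cons_zero, Fin.cons_succ,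
      expect_const_mul]
    rw [← ih, expect_mul_const]

theorem expect_indep_apply {m : ℕ} (p : Fin m → PMF α) (i : Fin m) (f : α → ℝ≥0∞) :
    expect (indep p) (fun x => f (x i)) = expect (p i) f := by
  have h := expect_indep_prod p fun j => if j = i then f else fun _ => 1
  have h1 : ∀ x : Fin m → α, (∏ j, (if j = i then f else fun _ => 1) (x j)) = f (x i) := fun x => by
    rw [Finset.prod_eq_single i (fun j _ hj => by simp [hj]) (by simp)]
    simp
  simp only [h1] at h
  rw [h, Finset.prod_eq_single i (fun j _ hj => by simp [hj, expect_const]) (by simp)]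
  simp

theorem indep_apply {m : ℕ} (p : Fin m → PMF α) (x : Fin m → α) : indep p x = ∏ i, p i (x i) := by
  have h0 : ∀ {β : Type _} (q : PMF β) (b : β), q b = expect q fun a => ind (a = b) := by
    intro β q b
    unfold expect
    rw [tsum_eq_single b fun a ha => by simp [ind_of_not ha]]
    simp [ind_of]
  have h1 : ∀ y : Fin m → α, ind (y = x) = ∏ i, ind (y i = x i) := by
    intro y
    by_cases h : y = x
    · subst h
      rw [ind_of rfl, Finset.prod_eq_one fun i _ => ind_of rfl]
    · rw [ind_of_not h]
      obtain ⟨i, hi⟩ := Function.ne_iff.1 h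
      rw [Finset.prod_eq_zero (Finset.mem_univ i) (ind_of_not hi)]
  rw [h0]
  simp only [h1]
  rw [expect_indep_prod p fun i a => ind (a = x i)]
  simp only [← h0]

/-- The sampling programs push samples to the front of a list, so they draw the last coordinate
first; `indep` is defined with the first coordinate first. -/
theorem indep_snoc {m : ℕ} (p : Fin (m + 1) → PMF α) :
    indep p = (p (Fin.last m)).bind fun b => (indep fun i : Fin m => p i.castSucc).map fun f =>
      (Fin.snoc f b : Fin (m + 1) → α) := by
  induction m with
  | zero =>
    simp only [indep, PMF.pure_map]
    refine congrArg _ (funext fun a => congrArg _ (funext fun i => ?_))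
    rw [Subsingleton.elim (α := Fin 1) i 0]
    rfl
  | succ m ih =>
    rw [indep, ih fun i => p i.succ]
    simp only [PMF.map_bind, PMF.map_comp]
    rw [PMF.bind_comm]
    refine congrArg _ (funext fun b => ?_)
    conv_rhs => rw [indep]
    simp only [PMF.map_bind, PMF.map_comp]
    refine congrArg _ (funext fun a => ?_)
    congr 1
    funext f
    simp only [Function.comp]
    exact Fin.cons_snoc_eq_snoc_cons a f b

/-- A tail bound for sums of independent variables with subgaussian moments. -/
theorem expect_indep_tail {m : ℕ} (p : Fin m → PMF α) (Y : Fin m → α → ℝ) (v : Fin m → ℝ)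
    (hv : ∀ i s, expect (p i) (fun a => ENNReal.ofReal (Real.exp (s * Y i a))) ≤
      ENNReal.ofReal (Real.exp (s ^ 2 * v i / 2)))
    {V T : ℝ} (hV : 0 < V) (hvV : ∑ i, v i ≤ V) (hT : 0 ≤ T) :
    expect (indep p) (fun x => ind (¬ |∑ i, Y i (x i)| ≤ T)) ≤
      ENNReal.ofReal (2 * Real.exp (-T ^ 2 / (2 * V))) := by
  have key : ∀ s : ℝ, expect (indep p) (fun x => ENNReal.ofReal (Real.exp (s * ∑ i, Y i (x i)))) ≤
      ENNReal.ofReal (Real.exp (s ^ 2 * V / 2)) := by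
    intro s
    have h1 : ∀ x : Fin m → α, ENNReal.ofReal (Real.exp (s * ∑ i, Y i (x i))) =
        ∏ i, ENNReal.ofReal (Real.exp (s * Y i (x i))) := fun x => by
      rw [Finset.mul_sum, Real.exp_sum, ENNReal.ofReal_prod_of_nonneg fun i _ => (Real.exp_pos _).le]
    simp only [h1]
    rw [expect_indep_prod p fun i a => ENNReal.ofReal (Real.exp (s * Y i a))]
    refine (Finset.prod_le_prod' fun i _ => hv i s).trans ?_
    rw [← ENNReal.ofReal_prod_of_nonneg fun i _ => (Real.exp_pos _).le, ← Real.exp_sum]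
    refine ENNReal.ofReal_le_ofReal (Real.exp_le_exp.2 ?_)
    rw [← Finset.sum_div, ← Finset.mul_sum]
    have := mul_le_mul_of_nonneg_left hvV (sq_nonneg s)
    linarith
  -- This value minimizes the exponent `-sT + s²V/2` of the Chernoff bound.
  set s := T / V with hs
  have hs0 : 0 ≤ s := div_nonneg hT hV.le
  -- Markov's inequality for the exponential moments, one summand for each sign of the sum.
  have hpt : ∀ x : Fin m → α, ind (¬ |∑ i, Y i (x i)| ≤ T) ≤
      ENNReal.ofReal (Real.exp (-(s * T))) * ENNReal.ofReal (Real.exp (s * ∑ i, Y i (x i))) +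
      ENNReal.ofReal (Real.exp (-(s * T))) * ENNReal.ofReal (Real.exp (-s * ∑ i, Y i (x i))) := by
    intro x
    by_cases h : |∑ i, Y i (x i)| ≤ T
    · rw [ind_of_not (by simpa)]; exact zero_le
    · refine (ind_le_one _).trans ?_
      rw [← ENNReal.ofReal_mul (Real.exp_pos _).le, ← ENNReal.ofReal_mul (Real.exp_pos _).le,
        ← Real.exp_add, ← Real.exp_add]
      rcases lt_abs.1 (not_le.1 h) with h | h
      · refine le_trans ?_ le_self_add
        rw [ENNReal.one_le_ofReal, Real.one_le_exp_iff]
        nlinarith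
      · refine le_trans ?_ le_add_self
        rw [ENNReal.one_le_ofReal, Real.one_le_exp_iff]
        nlinarith
  refine (expect_mono hpt).trans ?_
  rw [expect_add, expect_const_mul, expect_const_mul]
  have e : ENNReal.ofReal (2 * Real.exp (-T ^ 2 / (2 * V))) =
      ENNReal.ofReal (Real.exp (-(s * T))) * ENNReal.ofReal (Real.exp (s ^ 2 * V / 2)) +
      ENNReal.ofReal (Real.exp (-(s * T))) * ENNReal.ofReal (Real.exp ((-s) ^ 2 * V / 2)) := by
    have e1 : -(s * T) + s ^ 2 * V / 2 = -T ^ 2 / (2 * V) := by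
      rw [hs]; field_simp; ring
    rw [neg_sq, ← ENNReal.ofReal_mul (Real.exp_pos _).le, ← Real.exp_add, e1,
      ← ENNReal.ofReal_add (Real.exp_pos _).le (Real.exp_pos _).le, two_mul]
  rw [e]
  gcongr
  · exact key s
  · exact key (-s)

end Indep

/-! ## Uniform distributions -/

section Uniform

variable {α β : Type*} [Inhabited α] [Inhabited β]

theorem uniformOn_eq {S : Set α} (hS : S.Finite) (hne : hS.toFinset.Nonempty) :
    uniformOn S = PMF.uniformOfFinset hS.toFinset hne := by
  have h : ∃ hS : S.Finite, hS.toFinset.Nonempty := ⟨hS, hne⟩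
  unfold uniformOn
  rw [dif_pos h]

theorem uniformOn_apply {S : Set α} (hS : S.Finite) (hne : S.Nonempty) (a : α) :
    uniformOn S a = ind (a ∈ S) * (S.ncard : ℝ≥0∞)⁻¹ := by
  rw [uniformOn_eq hS (by simpa using hne), PMF.uniformOfFinset_apply, Set.ncard_eq_toFinset_card S hS]
  by_cases h : a ∈ S
  · rw [ind_of h, if_pos (by simpa using h), one_mul]
  · rw [ind_of_not h, if_neg (by simpa using h), zero_mul]

theorem mem_of_mem_support_uniformOn {S : Set α} (hS : S.Finite) (hne : S.Nonempty) {a : α}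
    (ha : a ∈ (uniformOn S).support) : a ∈ S := by
  by_contra h
  rw [PMF.mem_support_iff, uniformOn_apply hS hne, ind_of_not h, zero_mul] at ha
  exact ha rfl

/-- The constant `c` need not be known: total mass 1 determines it. -/
theorem eq_uniformOn {p : PMF α} {S : Set α} {c : ℝ≥0∞} (hS : S.Finite)
    (h : ∀ a, p a = ind (a ∈ S) * c) : p = uniformOn S := by
  have hsum : ∑' a, p a = S.ncard * c := by
    rw [tsum_congr h, ENNReal.tsum_mul_right]
    congr 1
    rw [tsum_eq_sum (s := hS.toFinset) fun a ha => ind_of_not (by simpa using ha),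
      Finset.sum_congr rfl fun a ha => ind_of (by simpa using ha)]
    simp [Set.ncard_eq_toFinset_card S hS]
  rw [p.tsum_coe] at hsum
  have hne : S.Nonempty := by
    rw [Set.nonempty_iff_ne_empty]
    rintro rfl
    simp at hsum
  ext a
  rw [h, uniformOn_apply hS hne]
  congr 1
  exact ENNReal.eq_inv_of_mul_eq_one_left (by rw [mul_comm]; exact hsum.symm)

theorem uniformOn_map {S : Set α} (hS : S.Finite) (hne : S.Nonempty) {f : α → β}
    (hf : Set.InjOn f S) : (uniformOn S).map f = uniformOn (f '' S) := by
  classical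
  refine eq_uniformOn (c := (S.ncard : ℝ≥0∞)⁻¹) (hS.image f) fun b => ?_
  rw [PMF.map_apply]
  by_cases hb : b ∈ f '' S
  · obtain ⟨a, ha, rfl⟩ := hb
    rw [tsum_eq_single a, if_pos rfl, uniformOn_apply hS hne, ind_of ha,
      ind_of (Set.mem_image_of_mem f ha)]
    intro a' ha'
    split_ifs with h
    · rw [uniformOn_apply hS hne, ind_of_not, zero_mul]
      exact fun h' => ha' (hf h' ha h.symm)
    · rfl
  · rw [ind_of_not hb, zero_mul, ENNReal.tsum_eq_zero]
    intro a
    split_ifs with h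
    · rw [uniformOn_apply hS hne, ind_of_not, zero_mul]
      exact fun h' => hb ⟨a, h', h.symm⟩
    · rfl

theorem uniformOfFintype_eq [Fintype α] [Nonempty α] :
    PMF.uniformOfFintype α = uniformOn Set.univ := by
  ext a
  rw [uniformOn_apply Set.finite_univ Set.univ_nonempty, PMF.uniformOfFintype_apply,
    ind_of (Set.mem_univ a), one_mul, Set.ncard_univ, Nat.card_eq_fintype_card]

theorem indep_uniformOn {m : ℕ} {S : Fin m → Set α} (hS : ∀ i, (S i).Finite)
    (hne : ∀ i, (S i).Nonempty) :
    indep (fun i => uniformOn (S i)) = uniformOn (Set.univ.pi S) := by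
  refine eq_uniformOn (c := ∏ i, ((S i).ncard : ℝ≥0∞)⁻¹) (Set.Finite.pi hS)
    fun x => ?_
  rw [indep_apply]
  simp only [uniformOn_apply (hS _) (hne _)]
  rw [Finset.prod_mul_distrib]
  congr 1
  by_cases h : x ∈ Set.univ.pi S
  · rw [ind_of h, Finset.prod_eq_one fun i _ => ind_of (h i (Set.mem_univ i))]
  · rw [ind_of_not h]
    simp only [Set.mem_pi, Set.mem_univ, true_implies, not_forall] at h
    obtain ⟨i, hi⟩ := h
    exact Finset.prod_eq_zero (Finset.mem_univ i) (ind_of_not hi)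

end Uniform

/-! ## Boxes -/

/-- The uniform distribution on an interval that is symmetric about the origin. -/
def unifI (b : ℕ) : PMF ℤ := uniformOn (Set.Icc (-(b : ℤ)) b)

theorem finite_Icc_symm (b : ℕ) : (Set.Icc (-(b : ℤ)) b).Finite := Set.finite_Icc _ _

theorem nonempty_Icc_symm (b : ℕ) : (Set.Icc (-(b : ℤ)) b).Nonempty := ⟨0, by simp⟩

theorem ncard_Icc_symm (b : ℕ) : (Set.Icc (-(b : ℤ)) b).ncard = 2 * b + 1 := by
  rw [Set.ncard_eq_toFinset_card']
  simp; omega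

theorem unifI_apply (b : ℕ) (z : ℤ) :
    unifI b z = ind (z ∈ Set.Icc (-(b : ℤ)) b) * ((2 * b + 1 : ℕ) : ℝ≥0∞)⁻¹ := by
  rw [unifI, uniformOn_apply (finite_Icc_symm b) (nonempty_Icc_symm b), ncard_Icc_symm]

theorem unifI_neg (b : ℕ) : (unifI b).map (fun z => -z) = unifI b := by
  unfold unifI
  rw [uniformOn_map (finite_Icc_symm b) (nonempty_Icc_symm b) neg_injective.injOn]
  congr 1
  ext z
  simp only [Set.mem_image, Set.mem_Icc]
  constructor
  · rintro ⟨y, hy, rfl⟩; omega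
  · intro h; exact ⟨-z, by omega, neg_neg z⟩

theorem mem_support_unifI {b : ℕ} {z : ℤ} (h : z ∈ (unifI b).support) : |z| ≤ b := by
  have := mem_of_mem_support_uniformOn (finite_Icc_symm b) (nonempty_Icc_symm b) h
  exact abs_le.2 this

/-- By symmetry the exponential moment is the mean of `cosh (s w z)`, and `cosh x ≤ exp (x²/2)` with
`|z| ≤ b`. So `w z` is subgaussian with variance proxy `(w b)²`. -/
theorem expect_unifI_exp (b : ℕ) (w s : ℝ) :
    expect (unifI b) (fun z => ENNReal.ofReal (Real.exp (s * (w * z)))) ≤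
      ENNReal.ofReal (Real.exp (s ^ 2 * (w * b) ^ 2 / 2)) := by
  set L := expect (unifI b) (fun z => ENNReal.ofReal (Real.exp (s * (w * z)))) with hL
  have h1 : L = expect (unifI b) (fun z => ENNReal.ofReal (Real.exp (-(s * (w * z))))) := by
    rw [hL]
    nth_rewrite 1 [← unifI_neg]
    rw [expect_map]
    congr 1; funext z; push_cast; ring_nf
  -- One copy of the moment is taken at `z` and the other at `-z`, which produces `2 cosh`.
  have h2 : L + L ≤ ENNReal.ofReal (Real.exp (s ^ 2 * (w * b) ^ 2 / 2)) +
      ENNReal.ofReal (Real.exp (s ^ 2 * (w * b) ^ 2 / 2)) := by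
    nth_rewrite 2 [h1]
    rw [hL, ← expect_add, ← ENNReal.ofReal_add (Real.exp_pos _).le (Real.exp_pos _).le,
      ← expect_const (unifI b) (ENNReal.ofReal _)]
    refine expect_mono_support fun z hz => ?_
    rw [← ENNReal.ofReal_add (Real.exp_pos _).le (Real.exp_pos _).le]
    refine ENNReal.ofReal_le_ofReal ?_
    have h3 := Real.cosh_le_exp_half_sq (s * (w * z))
    rw [Real.cosh_eq] at h3
    have h4 : Real.exp ((s * (w * z)) ^ 2 / 2) ≤ Real.exp (s ^ 2 * (w * b) ^ 2 / 2) := by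
      refine Real.exp_le_exp.2 ?_
      have h5 : |(z : ℝ)| ≤ b := by
        have := mem_support_unifI hz
        rw [← Int.cast_abs]
        exact_mod_cast this
      have h6 : (z : ℝ) ^ 2 ≤ (b : ℝ) ^ 2 := sq_le_sq' (by linarith [abs_le.1 h5]) (abs_le.1 h5).2
      have h7 := mul_le_mul_of_nonneg_left h6 (sq_nonneg (s * w))
      nlinarith
    linarith
  by_contra h
  exact absurd h2 (not_le.2 (ENNReal.add_lt_add (not_le.1 h) (not_le.1 h)))

/-! ### Random ring elements with bounded coefficients -/

section Box

variable {n : ℕ} [NeZero n]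

/-- Bounds on the absolute values of the coefficients. -/
def symBox (b : Fin n → ℕ) : Set (Rz n) := {u | ∀ i, |coeffs u i| ≤ b i}

theorem ofCoeffs_injective {A : Type} [CommRing A] :
    Function.Injective (ofCoeffs : (Fin n → A) → Cyc A n) := (coeffEquiv A n).symm.injective

theorem symBox_eq (b : Fin n → ℕ) :
    symBox b = ofCoeffs '' (Set.univ.pi fun i => Set.Icc (-(b i : ℤ)) (b i)) := by
  ext u
  simp only [symBox, Set.mem_ofPred_eq, Set.mem_image, Set.mem_pi, Set.mem_univ, true_implies,
    abs_le, Set.mem_Icc]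
  constructor
  · intro h; exact ⟨coeffs u, h, ofCoeffs_coeffs u⟩
  · rintro ⟨v, hv, rfl⟩; rwa [coeffs_ofCoeffs]

theorem finite_symBox (b : Fin n → ℕ) : (symBox b).Finite := by
  rw [symBox_eq]
  exact (Set.Finite.pi fun i => finite_Icc_symm (b i)).image _

theorem nonempty_symBox (b : Fin n → ℕ) : (symBox b).Nonempty := ⟨0, fun i => by simp⟩

theorem uniformOn_symBox (b : Fin n → ℕ) :
    uniformOn (symBox b) = (indep fun i => unifI (b i)).map ofCoeffs := by
  unfold unifI
  rw [indep_uniformOn (fun i => finite_Icc_symm _) (fun i => nonempty_Icc_symm _),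
    uniformOn_map (Set.Finite.pi fun i => finite_Icc_symm (b i))
      (Set.univ_pi_nonempty_iff.2 fun i => nonempty_Icc_symm _) ofCoeffs_injective.injOn,
    ← symBox_eq]

theorem expect_symBox (b : Fin n → ℕ) (f : Rz n → ℝ≥0∞) :
    expect (uniformOn (symBox b)) f = expect (indep fun i => unifI (b i)) fun x => f (ofCoeffs x) := by
  rw [uniformOn_symBox, expect_map]

/-- The product with a random element of a box is short. -/
theorem expect_mul_tail (b : Fin n → ℕ) {K G T : ℝ} (hb : ∀ i, (b i : ℝ) ≤ K) (hK : 0 < K)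
    (hG : 0 < G) (hT : 0 ≤ T) {g : Rz n} (hg : NormLe g G) :
    expect (uniformOn (symBox b)) (fun d => ind (¬NormLe (g * d) T)) ≤
      n * ENNReal.ofReal (2 * Real.exp (-T ^ 2 / (2 * (n * (G * K) ^ 2)))) := by
  have hn : (0 : ℝ) < n := by exact_mod_cast NeZero.pos n
  have h1 : ∀ d : Rz n, ind (¬NormLe (g * d) T) ≤
      ∑ j, ind (¬ |((coeffs (g * d) j : ℤ) : ℝ)| ≤ T) := fun d => by
    refine le_trans (ind_mono fun h => ?_) (ind_exists_le _)
    simpa [NormLe] using h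
  refine (expect_mono h1).trans ?_
  rw [expect_sum]
  refine (Finset.sum_le_sum fun j _ => ?_).trans_eq (b := ∑ _j : Fin n, ENNReal.ofReal
    (2 * Real.exp (-T ^ 2 / (2 * (n * (G * K) ^ 2))))) (by simp)
  rw [expect_symBox]
  have h2 := expect_indep_tail (fun i => unifI (b i))
    (fun i z => ((coeffs (Cyc.x ℤ n ^ (i : ℕ) * g) j : ℤ) : ℝ) * z)
    (fun i => (((coeffs (Cyc.x ℤ n ^ (i : ℕ) * g) j : ℤ) : ℝ) * b i) ^ 2)
    (fun i s => expect_unifI_exp _ _ _) (V := n * (G * K) ^ 2) (T := T) (by positivity) ?_ hT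
  · refine le_trans (le_of_eq ?_) h2
    congr 1; funext x
    congr 3
    rw [coeffs_mul, coeffs_ofCoeffs]
    push_cast
    refine congrArg _ (Finset.sum_congr rfl fun i _ => ?_)
    ring
  · calc ∑ i : Fin n, (((coeffs (Cyc.x ℤ n ^ (i : ℕ) * g) j : ℤ) : ℝ) * b i) ^ 2
        ≤ ∑ _i : Fin n, (G * K) ^ 2 := Finset.sum_le_sum fun i _ => by
          rw [← sq_abs, abs_mul]
          have h3 := hg.x_pow_mul i j
          rw [Nat.abs_cast]
          exact pow_le_pow_left₀ (by positivity)
            (mul_le_mul h3 (hb i) (Nat.cast_nonneg _) hG.le) 2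
      _ = n * (G * K) ^ 2 := by simp

/-- The sum of independent random elements of a box is short. -/
theorem expect_sum_tail (b : ℕ) (m : ℕ) {T B V : ℝ} (hT : 0 ≤ T) (hbB : (b : ℝ) ≤ B)
    (hV : 0 < V) (hVB : m * B ^ 2 ≤ V) :
    expect (iid (uniformOn (symBox fun _ : Fin n => b)) m) (fun y => ind (¬NormLe (∑ j, y j) T)) ≤
      n * ENNReal.ofReal (2 * Real.exp (-T ^ 2 / (2 * V))) := by
  have h1 : ∀ y : Fin m → Rz n, ind (¬NormLe (∑ j, y j) T) ≤
      ∑ i, ind (¬ |((coeffs (∑ j, y j) i : ℤ) : ℝ)| ≤ T) := fun d => by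
    refine le_trans (ind_mono fun h => ?_) (ind_exists_le _)
    simpa [NormLe] using h
  refine (expect_mono h1).trans ?_
  rw [expect_sum]
  refine (Finset.sum_le_sum fun i _ => ?_).trans_eq (b := ∑ _i : Fin n, ENNReal.ofReal
    (2 * Real.exp (-T ^ 2 / (2 * V)))) (by simp)
  rw [iid_eq_indep]
  have h2 := expect_indep_tail (fun _ : Fin m => uniformOn (symBox fun _ : Fin n => b))
    (fun _ y => ((coeffs y i : ℤ) : ℝ)) (fun _ => (b : ℝ) ^ 2) (fun j s => ?_) hV ?_ hT
  · refine le_trans (le_of_eq ?_) h2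
    congr 1; funext x
    rw [coeffs_sum]
    push_cast
    rfl
  · rw [expect_symBox]
    simp only [coeffs_ofCoeffs]
    rw [expect_indep_apply (fun i => unifI b) i fun z : ℤ => ENNReal.ofReal (Real.exp (s * z))]
    simpa using expect_unifI_exp b 1 s
  · simp only [Finset.sum_const, Finset.card_univ, Fintype.card_fin, nsmul_eq_mul]
    refine le_trans ?_ hVB
    gcongr

/-- The favourable values of `y` form the interval from `-b' - δ` to `b' - δ`. By hypothesis it lies
inside `[-b, b]`, so all its `2b' + 1` points count. -/
theorem expect_unifI_shift (b b' : ℕ) (δ : ℤ) (h : b' + δ.natAbs ≤ b) :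
    ((2 * b' + 1 : ℕ) : ℝ≥0∞) * ((2 * b + 1 : ℕ) : ℝ≥0∞)⁻¹ ≤
      expect (unifI b) (fun y => ind (|δ + y| ≤ b')) := by
  unfold expect
  have h1 : ∀ y ∈ Finset.Icc (-(b' : ℤ) - δ) (b' - δ),
      unifI b y * ind (|δ + y| ≤ b') = ((2 * b + 1 : ℕ) : ℝ≥0∞)⁻¹ := by
    intro y hy
    rw [Finset.mem_Icc] at hy
    rw [unifI_apply, ind_of (by rw [Set.mem_Icc]; omega),
      ind_of (by rw [abs_le]; omega), one_mul, mul_one]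
  refine le_trans (le_of_eq ?_) (ENNReal.sum_le_tsum (Finset.Icc (-(b' : ℤ) - δ) (b' - δ)))
  rw [Finset.sum_congr rfl h1, Finset.sum_const, nsmul_eq_mul, Int.card_Icc]
  congr 2
  omega

end Box

/-! ### The sets of the scheme -/

theorem lg_two_pow (k : ℕ) : lg (2 ^ k) = k := by
  unfold lg
  push_cast
  rw [Real.logb_pow, Real.logb_self_eq_one (by norm_num), mul_one]

/-- The bounds for challenges. -/
def chalBound (k : ℕ) (i : ℕ) : ℕ := if 2 * i + 1 ≤ 2 ^ k then k else 0

theorem chalSet_eq (k : ℕ) : chalSet (2 ^ k) = symBox fun i : Fin (2 ^ k) => chalBound k i := by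
  ext c
  simp only [chalSet, symBox, NormLe, lg_two_pow, Set.mem_ofPred_eq, chalBound]
  constructor
  · rintro ⟨h1, h2⟩ i
    split_ifs with h
    · have := h1 i
      rw [← Int.cast_abs] at this
      exact_mod_cast this
    · simp [h2 i (by omega)]
  · intro h
    refine ⟨fun i => ?_, fun i hi => ?_⟩
    · have := h i
      have h2 : |coeffs c i| ≤ (k : ℤ) := by
        split_ifs at this
        · exact this
        · exact this.trans (by simp)
      rw [← Int.cast_abs]
      exact_mod_cast h2
    · have := h i
      rw [if_neg (by omega)] at this
      simpa using this

theorem finite_chalSet (k : ℕ) : (chalSet (2 ^ k)).Finite := by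
  rw [chalSet_eq]; exact finite_symBox _

theorem nonempty_chalSet (k : ℕ) : (chalSet (2 ^ k)).Nonempty := by
  rw [chalSet_eq]; exact nonempty_symBox _

theorem chalBound_le (k i : ℕ) : chalBound k i ≤ k := by
  unfold chalBound; split_ifs <;> simp

/-- Collisions of challenges are unlikely. -/
theorem expect_chal_eq_le {k : ℕ} (hk : 1 ≤ k) (c₀ : Rz (2 ^ k)) :
    expect (uniformOn (chalSet (2 ^ k))) (fun c => ind (c₀ = c)) ≤ (1 / 2) ^ 2 ^ (k - 1) := by
  have h0 : expect (uniformOn (chalSet (2 ^ k))) (fun c => ind (c₀ = c)) ≤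
      expect (indep fun i : Fin (2 ^ k) => unifI (chalBound k i))
        fun x => ∏ i, ind (coeffs c₀ i = x i) := by
    rw [chalSet_eq, expect_symBox]
    refine expect_mono fun x => ?_
    by_cases h : c₀ = ofCoeffs x
    · rw [Finset.prod_eq_one fun i _ => ind_of (by rw [h, coeffs_ofCoeffs])]
      exact ind_le_one _
    · rw [ind_of_not h]; exact zero_le
  refine h0.trans ?_
  rw [expect_indep_prod _ fun i a => ind (coeffs c₀ i = a)]
  -- Each of the `n/2` free coefficients takes a given value with probability `1/(2k + 1)` at most,
  -- hence at most `1/2` as `k ≥ 1`; the other coefficients contribute the factor 1.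
  have h1 : ∀ i : Fin (2 ^ k), expect (unifI (chalBound k i)) (fun a => ind (coeffs c₀ i = a)) ≤
      if 2 * (i : ℕ) + 1 ≤ 2 ^ k then 1 / 2 else 1 := by
    intro i
    split_ifs with h
    · unfold expect
      rw [tsum_eq_single (coeffs c₀ i) fun a ha => by simp [ind_of_not ha.symm]]
      beta_reduce
      rw [ind_of rfl, mul_one, unifI_apply, chalBound, if_pos h, one_div]
      refine (mul_le_of_le_one_left zero_le (ind_le_one _)).trans ?_
      rw [ENNReal.inv_le_inv]
      exact_mod_cast (by omega : 2 ≤ 2 * k + 1)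
    · exact expect_le fun a => ind_le_one _
  refine (Finset.prod_le_prod' fun i _ => h1 i).trans ?_
  rw [Finset.prod_ite, Finset.prod_const, Finset.prod_const_one, mul_one]
  refine pow_le_pow_right_of_le_one' (by simp) ?_
  have h2 : 2 ^ k = 2 * 2 ^ (k - 1) := by
    rw [← pow_succ']; congr 1; omega
  have : (Finset.univ : Finset (Fin (2 ^ (k - 1)))).card ≤
      (Finset.univ.filter fun i : Fin (2 ^ k) => 2 * (i : ℕ) + 1 ≤ 2 ^ k).card := by
    refine Finset.card_le_card_of_injOn (Fin.castLE (by omega)) (fun i _ => ?_)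
      ((Fin.castLE_injective _).injOn)
    have := i.2
    simp only [Finset.coe_filter, Finset.mem_univ, true_and, Set.mem_ofPred_eq, Fin.val_castLE]
    omega
  simpa using this

/-! ### The sampling programs -/

instance : Inhabited Val := ⟨.num 0⟩

theorem num_injective : Function.Injective Val.num := fun _ _ h => Val.num.inj h

theorem randNum_sub (b : ℕ) : (randNum (2 * b + 1)).map (fun w => w - .num b) =
    (unifI b).map Val.num := by
  rw [randNum_succ, PMF.map_comp, uniformOfFintype_eq, unifI,
    uniformOn_map (finite_Icc_symm b) (nonempty_Icc_symm b) num_injective.injOn,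
    uniformOn_map Set.finite_univ Set.univ_nonempty]
  · congr 1
    ext w
    simp only [Set.mem_image, Set.mem_univ, true_and, Set.mem_Icc, Function.comp]
    constructor
    · rintro ⟨i, rfl⟩
      have := i.2
      exact ⟨(i : ℤ) - b, by omega, rfl⟩
    · rintro ⟨z, hz, rfl⟩
      refine ⟨⟨(z + b).toNat, by omega⟩, ?_⟩
      change Val.num ((((z + b).toNat : ℕ) : ℤ) - b) = _
      congr 1; omega
  · intro i _ j _ h
    have h' : Val.num (((i : ℕ) : ℤ) - b) = Val.num (((j : ℕ) : ℤ) - b) := h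
    have := num_injective h'
    exact Fin.ext (by omega)

theorem logV_unary (k : ℕ) : logV (unary (2 ^ k)) = .num k := by
  unfold logV bits
  rw [lenV_unary, lenV_eq, Val.toList_ofList]
  simp only [List.length_map, List.length_reverse, Val.toInt_num, Int.toNat_natCast]
  rw [Nat.length_digits 2 (2 ^ k) (by norm_num) (by positivity), Nat.log_pow (by norm_num)]
  change Val.num (((k + 1 : ℕ) : ℤ) - 1) = _
  congr 1; push_cast; ring

theorem sampStep_eq (k i : ℕ) (x out : Val) :
    sampStep x (.pair (.num i) out) (.pair (.num (2 ^ k : ℕ)) (.num k)) =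
      (unifI (chalBound k i)).map fun z => .pair (.num ((i : ℤ) - 1)) (.pair (.num z) out) := by
  unfold sampStep
  simp only [Val.fst_pair, Val.snd_pair]
  have h1 : Val.ite (Val.le (.num 2 * .num i + .num 1) (.num (2 ^ k : ℕ))) (.num k) (.num 0) =
      .num (chalBound k i) := by
    rw [Val.ite_le]
    unfold chalBound
    have : (Val.num 2 * .num i + .num 1).toInt = ((2 * i + 1 : ℕ) : ℤ) := by
      push_cast; rfl
    rw [this, Val.toInt_num]
    by_cases h : 2 * i + 1 ≤ 2 ^ k
    · rw [if_pos (by exact_mod_cast h), if_pos h]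
    · rw [if_neg (by exact_mod_cast h), if_neg h]; rfl
  have h2 : (Val.ite (Val.le (.num 2 * .num i + .num 1) (.num (2 ^ k : ℕ)))
      (.num 2 * .num k + .num 1) (.num 1)).toInt.toNat = 2 * chalBound k i + 1 := by
    rw [Val.ite_le]
    unfold chalBound
    have : (Val.num 2 * .num i + .num 1).toInt = ((2 * i + 1 : ℕ) : ℤ) := by
      push_cast; rfl
    rw [this, Val.toInt_num]
    by_cases h : 2 * i + 1 ≤ 2 ^ k
    · rw [if_pos (by exact_mod_cast h), if_pos h]
      change (2 * (k : ℤ) + 1).toNat = _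
      omega
    · rw [if_neg (by exact_mod_cast h), if_neg h]; rfl
  rw [h1, h2]
  have h3 := congrArg (fun p => p.map fun w => Val.pair (.num ((i : ℤ) - 1)) (.pair w out))
    (randNum_sub (chalBound k i))
  simp only [PMF.map_comp] at h3
  exact h3

/-- The counter in the state is the index of the coefficient being drawn. It runs from `n - 1` down
and ends at `-1`, so the finished list starts with the constant coefficient. -/
theorem sampleC_eq (k : ℕ) :
    sampleC (unary (2 ^ k)) = (uniformOn (chalSet (2 ^ k))).map encZ := by
  have key : ∀ (m : ℕ) (out : List Val),
      foldM sampStep (.pair (.num (2 ^ k : ℕ)) (.num k)) (List.replicate m (.num 0))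
        (.pair (.num ((m : ℤ) - 1)) (.ofList out)) =
      (indep fun i : Fin m => unifI (chalBound k i)).map fun f =>
        .pair (.num (-1)) (.ofList ((List.ofFn fun i => Val.num (f i)) ++ out)) := by
    intro m
    induction m with
    | zero => intro out; simp [foldM, indep, PMF.pure_map]
    | succ m ih =>
      intro out
      rw [List.replicate_succ, foldM, indep_snoc]
      have e : ((m + 1 : ℕ) : ℤ) - 1 = m := by push_cast; ring
      rw [e, sampStep_eq, PMF.bind_map, PMF.map_bind]
      simp only [Fin.val_last]
      refine congrArg _ (funext fun z => ?_)
      simp only [Function.comp]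
      refine (ih (Val.num z :: out)).trans ?_
      rw [PMF.map_comp]
      congr 1
      funext f
      simp only [Function.comp]
      rw [List.ofFn_succ']
      simp
  unfold sampleC
  rw [logV_unary, lenV_unary, toList_unary]
  have h := key (2 ^ k) []
  have e : Val.num ((2 ^ k : ℕ) : ℤ) - Val.num 1 = Val.num (((2 ^ k : ℕ) : ℤ) - 1) := rfl
  rw [e]
  refine (congrArg (fun p => p.bind fun s => PMF.pure s.snd) h).trans ?_
  rw [PMF.bind_map, chalSet_eq, uniformOn_symBox, PMF.map_comp, ← PMF.bind_pure_comp]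
  refine congrArg _ (funext fun f => ?_)
  simp only [Function.comp, List.append_nil, Val.snd_pair, encZ, coeffs_ofCoeffs]

theorem sampleL_eq (k : ℕ) (l : Val) : sampleL (unary (2 ^ k)) l =
    (iid (uniformOn (chalSet (2 ^ k))) l.toList.length).map fun f =>
      .ofList (List.ofFn fun i => encZ (f i)) := by
  have key : ∀ (l out : List Val),
      foldM (fun _ s e => (sampleC e).bind fun c => PMF.pure (.pair c s)) (unary (2 ^ k)) l
        (.ofList out) =
      (iid (uniformOn (chalSet (2 ^ k))) l.length).map fun f =>
        .ofList ((List.ofFn fun i => encZ (f i)) ++ out) := by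
    intro l
    induction l with
    | nil => intro out; simp [foldM, iid, PMF.pure_map]
    | cons x l ih =>
      intro out
      rw [foldM, List.length_cons, iid_eq_indep, indep_snoc, sampleC_eq, PMF.bind_map, PMF.map_bind,
        PMF.bind_bind]
      refine congrArg _ (funext fun c => ?_)
      simp only [Function.comp, PMF.pure_bind]
      refine (ih (encZ c :: out)).trans ?_
      rw [PMF.map_comp, iid_eq_indep]
      congr 1
      funext f
      simp only [Function.comp]
      rw [List.ofFn_succ']
      simp
  simpa [Val.ofList] using! key l.toList []

/-! ## The units of `R_q` -/

section Units

/-- For `q = 8t + 3` one has `q² = 1 + 8 (8t² + 6t + 1)` with odd cofactor, and each further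
squaring adds exactly one factor 2. -/
theorem exists_pow_two_pow {q : ℕ} (hq : q % 8 = 3) (j : ℕ) :
    ∃ m, m % 2 = 1 ∧ q ^ 2 ^ (j + 1) = 1 + 2 ^ (j + 3) * m := by
  induction j with
  | zero =>
    refine ⟨8 * (q / 8) ^ 2 + 6 * (q / 8) + 1, by omega, ?_⟩
    have : q = 8 * (q / 8) + 3 := by omega
    generalize q / 8 = t at this ⊢
    subst this
    ring
  | succ j ih =>
    obtain ⟨m, hm, h⟩ := ih
    refine ⟨m + 2 * (2 ^ (j + 1) * m ^ 2), by omega, ?_⟩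
    rw [pow_succ 2 (j + 1), pow_mul, h]
    ring

variable {q : ℕ} [Fact q.Prime]

omit [Fact q.Prime] in
theorem coprime_two_pow (hq : q % 8 = 3) (m : ℕ) : q.Coprime (2 ^ m) := by
  refine Nat.Coprime.pow_right _ ?_
  rw [Nat.coprime_two_right]
  exact Nat.odd_iff.2 (by omega)

omit [Fact q.Prime] in
-- By `exists_pow_two_pow`, `q^(2^(j+1))` is 1 modulo `2^(j+3)`, while `q^(2^j)` is not; for `j = 0`
-- the latter says `3 ≠ 1` modulo 8. With `n = 2^(j+2)` the order of `q` modulo `2n` is thus `n/2`,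
-- the common degree of the irreducible factors of `X^n + 1`. The unit is written with `q ^ 1`, the
-- form in which the results on cyclotomic factors refer to the size of the field.
theorem orderOf_unitOfCoprime_two_pow (hq : q % 8 = 3) (j : ℕ) :
    orderOf (ZMod.unitOfCoprime (q ^ 1) ((coprime_two_pow hq (j + 3)).pow_left 1)) =
      2 ^ (j + 1) := by
  have key : ∀ e : ℕ, ZMod.unitOfCoprime (q ^ 1) ((coprime_two_pow hq (j + 3)).pow_left 1) ^ e = 1 ↔
      q ^ e ≡ 1 [MOD 2 ^ (j + 3)] := by
    intro e
    rw [← ZMod.natCast_eq_natCast_iff, Units.ext_iff]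
    simp
  refine orderOf_eq_prime_pow ?_ ?_
  · rw [key]
    intro h
    have h' : q ^ 2 ^ j % 2 ^ (j + 3) = 1 := by
      rw [h, Nat.mod_eq_of_lt (Nat.one_lt_two_pow (by omega))]
    cases j with
    | zero => simp [hq] at h'
    | succ j =>
      obtain ⟨m, hm, h2⟩ := exists_pow_two_pow hq j
      have h3 : q ^ 2 ^ (j + 1) = 2 ^ (j + 4) * (m / 2) + (1 + 2 ^ (j + 3)) := by
        rw [h2]
        conv_lhs => rw [← Nat.div_add_mod m 2, hm]
        ring
      have h4 : 1 + 2 ^ (j + 3) < 2 ^ (j + 4) := by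
        have : 1 < 2 ^ (j + 3) := Nat.one_lt_two_pow (by omega)
        rw [pow_succ 2 (j + 3)]; omega
      rw [h3, Nat.mul_add_mod, Nat.mod_eq_of_lt h4] at h'
      have : 0 < 2 ^ (j + 3) := by positivity
      omega
  · rw [key]
    obtain ⟨m, -, h2⟩ := exists_pow_two_pow hq j
    rw [h2]
    exact (Nat.modEq_iff_dvd' (by omega)).2 (by simp) |>.symm

theorem cyclotomic_two_pow (A : Type) [CommRing A] (k : ℕ) :
    cyclotomic (2 ^ (k + 1)) A = X ^ 2 ^ k + 1 := by
  rw [cyclotomic_prime_pow_eq_geom_sum Nat.prime_two]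
  simp [Finset.sum_range_succ, add_comm]

theorem natDegree_of_irreducible_dvd (hq : q % 8 = 3) (j : ℕ) {g : (ZMod q)[X]}
    (hg : Irreducible g) (h : g ∣ X ^ 2 ^ (j + 2) + 1) : g.natDegree = 2 ^ (j + 1) := by
  rw [← cyclotomic_two_pow] at h
  rw [natDegree_of_dvd_cyclotomic_of_irreducible (p := q) (f := 1) (by simp [ZMod.card])
    (coprime_two_pow hq _) h hg]
  exact orderOf_unitOfCoprime_two_pow hq j

theorem Cyc.isUnit_of_isCoprime {A : Type} [CommRing A] {n : ℕ} [NeZero n] {u : Cyc A n}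
    (h : IsCoprime u.rep (X ^ n + 1)) : IsUnit u := by
  obtain ⟨a, b, hab⟩ := h
  have := congrArg (Cyc.mk A n) hab
  rw [map_add, map_mul, map_mul, Cyc.mk_rep, Cyc.mk_self, mul_zero, add_zero, map_one] at this
  exact IsUnit.of_mul_eq_one_right _ this

theorem degree_rep_lt_of_coeffs {A : Type} [CommRing A] [Nontrivial A] {n m : ℕ} [NeZero n]
    {u : Cyc A n} (h : ∀ i : Fin n, m ≤ i → coeffs u i = 0) : u.rep.degree < m := by
  rw [degree_lt_iff_coeff_zero]
  intro i hi
  by_cases hin : i < n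
  · exact h ⟨i, hin⟩ hi
  · exact (degree_lt_iff_coeff_zero _ _).1 u.degree_rep_lt i (by omega)

theorem rep_ne_zero {A : Type} [CommRing A] {n : ℕ} [NeZero n] {u : Cyc A n} (h : u ≠ 0) :
    u.rep ≠ 0 := fun h0 => h (by rw [← u.mk_rep, h0, map_zero])

/-- A polynomial of degree less than `n / 2` is not divisible by a factor of `X ^ n + 1`. -/
theorem eq_zero_of_dvd_rep (hq : q % 8 = 3) (j : ℕ) {u : Rq q (2 ^ (j + 2))}
    (h : ∀ i : Fin (2 ^ (j + 2)), 2 ^ (j + 1) ≤ (i : ℕ) → coeffs u i = 0) {g : (ZMod q)[X]}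
    (hg : Irreducible g) (hd : g ∣ X ^ 2 ^ (j + 2) + 1) (hgu : g ∣ u.rep) : u = 0 := by
  by_contra hu
  have h1 := natDegree_le_of_dvd hgu (rep_ne_zero hu)
  have h2 := (natDegree_lt_iff_degree_lt (rep_ne_zero hu)).2 (degree_rep_lt_of_coeffs h)
  rw [natDegree_of_irreducible_dvd hq j hg hd] at h1
  omega

theorem exists_irreducible_dvd_rep {n : ℕ} [NeZero n] {u : Rq q n} (hu : ¬IsUnit u) :
    ∃ g : (ZMod q)[X], Irreducible g ∧ g ∣ X ^ n + 1 ∧ g ∣ u.rep := by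
  by_contra! h
  refine hu (Cyc.isUnit_of_isCoprime (isCoprime_of_irreducible_dvd
    (fun h0 => (monic_cyc (ZMod q) n).ne_zero h0.2) fun g hg h1 h2 => h g hg h2 h1))

/-- A non-unit shares an irreducible factor with `X^n + 1`, and such a factor has degree `n/2`, too
large to divide a nonzero polynomial of degree less than `n/2`. -/
theorem isUnit_of_coeffs (hq : q % 8 = 3) (j : ℕ) {u : Rq q (2 ^ (j + 2))} (hu : u ≠ 0)
    (h : ∀ i : Fin (2 ^ (j + 2)), 2 ^ (j + 1) ≤ (i : ℕ) → coeffs u i = 0) : IsUnit u := by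
  by_contra h'
  obtain ⟨g, hg, h1, h2⟩ := exists_irreducible_dvd_rep h'
  exact hu (eq_zero_of_dvd_rep hq j h hg h1 h2)

instance finite_Rq {n : ℕ} [NeZero n] : Finite (Rq q n) := Finite.of_equiv _ (coeffEquiv _ n).symm

theorem card_Rq (q n : ℕ) [NeZero n] : Nat.card (Rq q n) = q ^ n := by
  rw [Nat.card_congr (coeffEquiv (ZMod q) n), Nat.card_fun, Nat.card_zmod, Nat.card_fin]

/-- There are two irreducible factors `g`, and each non-unit is a multiple of one of them. -/
theorem ncard_not_isUnit_le (hq : q % 8 = 3) (j : ℕ) :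
    {u : Rq q (2 ^ (j + 2)) | ¬IsUnit u}.ncard ≤ 2 * q ^ 2 ^ (j + 1) := by
  classical
  set F := (UniqueFactorizationMonoid.normalizedFactors
    (cyclotomic (2 ^ (j + 3)) (ZMod q))).toFinset with hF
  have hFc : F.card = 2 := by
    rw [hF, normalizedFactors_cyclotomic_card (p := q) (f := 1) (by simp [ZMod.card])
      (coprime_two_pow hq _), orderOf_unitOfCoprime_two_pow hq j,
      Nat.totient_prime_pow Nat.prime_two (by omega)]
    rw [show j + 3 - 1 = j + 1 + 1 by omega, pow_succ 2 (j + 1)]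
    simp
  have hsub : {u : Rq q (2 ^ (j + 2)) | ¬IsUnit u} ⊆
      ⋃ g ∈ F, {u : Rq q (2 ^ (j + 2)) | g ∣ u.rep} := by
    intro u hu
    obtain ⟨g, hg, h1, h2⟩ := exists_irreducible_dvd_rep hu
    rw [← cyclotomic_two_pow] at h1
    obtain ⟨g', hg', ha⟩ := UniqueFactorizationMonoid.exists_mem_normalizedFactors_of_dvd
      (cyclotomic_ne_zero _ _) hg h1
    exact Set.mem_biUnion (Multiset.mem_toFinset.2 hg') (ha.symm.dvd.trans h2)
  have hg : ∀ g ∈ F, {u : Rq q (2 ^ (j + 2)) | g ∣ u.rep}.ncard ≤ q ^ 2 ^ (j + 1) := by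
    intro g hgF
    have hgF := Multiset.mem_toFinset.1 hgF
    have hirr := UniqueFactorizationMonoid.irreducible_of_normalized_factor _ hgF
    have hdvd := UniqueFactorizationMonoid.dvd_of_mem_normalizedFactors hgF
    rw [cyclotomic_two_pow] at hdvd
    have h2 : 2 ^ (j + 2) = 2 ^ (j + 1) + 2 ^ (j + 1) := by ring
    have : (Set.univ : Set (Fin (2 ^ (j + 1)) → ZMod q)).ncard = q ^ 2 ^ (j + 1) := by
      rw [Set.ncard_univ, Nat.card_fun, Nat.card_zmod, Nat.card_fin]
    rw [← this]
    -- A multiple of `g` is determined by the upper half of its coefficients: two multiples that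
    -- agree there differ by a multiple of `g` of degree less than `n/2`, hence by zero.
    refine Set.ncard_le_ncard_of_injOn
      (fun u i => coeffs u (Fin.cast h2.symm (Fin.natAdd _ i))) (fun _ _ => Set.mem_univ _) ?_
      Set.finite_univ
    intro u hu v hv huv
    rw [← sub_eq_zero]
    refine eq_zero_of_dvd_rep hq j (fun i hi => ?_) hirr hdvd ?_
    · have := congrFun huv ⟨i - 2 ^ (j + 1), by omega⟩
      have hi' : Fin.cast h2.symm (Fin.natAdd (2 ^ (j + 1)) ⟨i - 2 ^ (j + 1), by omega⟩) = i := by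
        ext; simp; omega
      simp only [hi'] at this
      rw [coeffs_sub, this, sub_self]
    · rw [rep_sub]; exact dvd_sub hu hv
  calc _ ≤ (⋃ g ∈ F, {u : Rq q (2 ^ (j + 2)) | g ∣ u.rep}).ncard :=
        Set.ncard_le_ncard hsub (Set.toFinite _)
    _ ≤ ∑ g ∈ F, {u : Rq q (2 ^ (j + 2)) | g ∣ u.rep}.ncard := Finset.set_ncard_biUnion_le _ _
    _ ≤ ∑ g ∈ F, q ^ 2 ^ (j + 1) := Finset.sum_le_sum hg
    _ = _ := by rw [Finset.sum_const, hFc, smul_eq_mul]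

theorem expect_uniformOn_ind {α : Type*} [Inhabited α] {S : Set α} (hS : S.Finite)
    (hne : S.Nonempty) (Q : α → Prop) :
    expect (uniformOn S) (fun a => ind (Q a)) = ({a ∈ S | Q a}.ncard : ℝ≥0∞) * (S.ncard : ℝ≥0∞)⁻¹ := by
  classical
  unfold expect
  have h : ∀ a, uniformOn S a * ind (Q a) = if a ∈ (hS.toFinset.filter Q) then (S.ncard : ℝ≥0∞)⁻¹ else 0 := by
    intro a
    rw [uniformOn_apply hS hne]
    by_cases h1 : a ∈ S <;> by_cases h2 : Q a <;> simp [h1, h2, ind]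
  simp_rw [h]
  rw [tsum_eq_sum (s := hS.toFinset.filter Q) fun a ha => if_neg ha,
    Finset.sum_congr rfl fun a ha => if_pos ha, Finset.sum_const, nsmul_eq_mul]
  congr 2
  rw [← Set.ncard_coe_finset]
  congr 1
  ext a; simp

/-- Almost all elements of `R_q` are units. -/
theorem expect_not_isUnit_le (hq : q % 8 = 3) {k : ℕ} (hk : 2 ≤ k) :
    expect (uniformOn (Set.univ : Set (Rq q (2 ^ k)))) (fun u => ind (¬IsUnit u)) ≤
      2 * (1 / 2) ^ 2 ^ (k - 1) := by
  obtain ⟨j, rfl⟩ := Nat.exists_eq_add_of_le' hk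
  rw [expect_uniformOn_ind Set.finite_univ Set.univ_nonempty]
  simp only [Set.mem_univ, true_and]
  rw [Set.ncard_univ, card_Rq]
  have hq2 : 2 ≤ q := (Fact.out : q.Prime).two_le
  have hq0 : (q : ℝ≥0∞) ≠ 0 := by exact_mod_cast (by omega : q ≠ 0)
  calc _ ≤ ((2 * q ^ 2 ^ (j + 1) : ℕ) : ℝ≥0∞) * ((q ^ 2 ^ (j + 2) : ℕ) : ℝ≥0∞)⁻¹ := by
        gcongr
        exact ncard_not_isUnit_le hq j
    _ = 2 * ((q : ℝ≥0∞)⁻¹) ^ 2 ^ (j + 1) := by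
        push_cast
        have h2 : 2 ^ (j + 2) = 2 ^ (j + 1) + 2 ^ (j + 1) := by ring
        rw [h2, pow_add (q : ℝ≥0∞), ENNReal.mul_inv (by simp)
          (by simp), ← mul_assoc, mul_assoc 2, ENNReal.mul_inv_cancel (pow_ne_zero _ hq0) (by simp),
          mul_one, ENNReal.inv_pow]
    _ ≤ _ := by
        rw [one_div, show j + 2 - 1 = j + 1 by omega]
        gcongr
        exact_mod_cast hq2

theorem Cyc.c_injective {A : Type} [CommRing A] {n : ℕ} [NeZero n] :
    Function.Injective (Cyc.c A n) := by
  intro a b h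
  have := congrArg (fun u => coeffs (u * ofCoeffs fun _ => 1) ⟨0, NeZero.pos n⟩) h
  simpa only [coeffs_c_mul, coeffs_ofCoeffs, mul_one] using this

/-- In characteristic `q` the map `r ↦ r^(q^n)` is a ring homomorphism. It fixes the constants, and
it fixes `x` because `x^(2n) = 1` and `q^n ≡ 1` modulo `2n`. -/
theorem pow_card_Rq (hq : q % 8 = 3) (j : ℕ) (r : Rq q (2 ^ (j + 2))) :
    r ^ q ^ 2 ^ (j + 2) = r := by
  have : CharP (Rq q (2 ^ (j + 2))) q := charP_of_injective_ringHom Cyc.c_injective q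
  have hx : Cyc.x (ZMod q) (2 ^ (j + 2)) ^ q ^ 2 ^ (j + 2) = Cyc.x (ZMod q) (2 ^ (j + 2)) := by
    obtain ⟨m, -, h⟩ := exists_pow_two_pow hq (j + 1)
    have h' : q ^ 2 ^ (j + 2) = 1 + 2 ^ (j + 2) * (2 * (2 * m)) := by rw [h]; ring
    rw [h', pow_add (Cyc.x (ZMod q) (2 ^ (j + 2))), pow_one, pow_mul, Cyc.x_pow, pow_mul]
    simp
  conv_lhs => rw [eq_sum_coeffs r]
  rw [sum_pow_char_pow]
  conv_rhs => rw [eq_sum_coeffs r]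
  refine Finset.sum_congr rfl fun i _ => ?_
  rw [mul_pow, ← map_pow, ZMod.pow_card_pow, ← pow_mul, mul_comm (i : ℕ), pow_mul, hx]

/-- Inversion in `R_q` is a power. -/
theorem pow_mul_self_of_isUnit (hq : q % 8 = 3) (j : ℕ) {r : Rq q (2 ^ (j + 2))} (hr : IsUnit r) :
    r ^ (q ^ 2 ^ (j + 2) - 2) * r = 1 := by
  have hq2 : 2 ≤ q ^ 2 ^ (j + 2) :=
    (Fact.out : q.Prime).two_le.trans (Nat.le_self_pow (by positivity) q)
  refine hr.mul_right_cancel ?_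
  rw [← pow_succ, ← pow_succ, show q ^ 2 ^ (j + 2) - 2 + 1 + 1 = q ^ 2 ^ (j + 2) by omega,
    pow_card_Rq hq, one_mul]

end Units

/-! ## Negligible functions -/

section Negl

/-- Negligible functions of `2 ^ k` with values in `[0, ∞]`. -/
def Negl (f : ℕ → ℝ≥0∞) : Prop := ∀ m : ℕ, ∀ᶠ k in atTop, 2 ^ (m * k) * f k ≤ 1

variable {f g : ℕ → ℝ≥0∞}

theorem Negl.mono (hg : Negl g) (h : ∀ᶠ k in atTop, f k ≤ g k) : Negl f := fun m => by
  filter_upwards [hg m, h] with k h1 h2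
  exact (mul_le_mul_right h2 _).trans h1

theorem Negl.pow_mul (hf : Negl f) (d : ℕ) : Negl fun k => 2 ^ (d * k) * f k := fun m => by
  filter_upwards [hf (m + d)] with k h
  rwa [← mul_assoc, ← pow_add, ← add_mul]

theorem Negl.two_mul (hf : Negl f) : Negl fun k => 2 * f k :=
  (hf.pow_mul 1).mono <| by
    filter_upwards [eventually_ge_atTop 1] with k hk
    gcongr
    rw [one_mul]
    exact le_self_pow one_le_two (by omega)

theorem Negl.add (hf : Negl f) (hg : Negl g) : Negl fun k => f k + g k := fun m => by
  filter_upwards [hf.two_mul m, hg.two_mul m] with k h1 h2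
  have : 2 * (2 ^ (m * k) * (f k + g k)) ≤ 2 * 1 := by
    calc _ = 2 ^ (m * k) * (2 * f k) + 2 ^ (m * k) * (2 * g k) := by ring
      _ ≤ 1 + 1 := add_le_add h1 h2
      _ = _ := by norm_num
  exact (ENNReal.mul_le_mul_iff_right (by simp) (by simp)).1 this

theorem Negl.nat_mul (hf : Negl f) (c : ℕ) : Negl fun k => c * f k := by
  induction c with
  | zero => exact fun m => .of_forall fun k => by simp
  | succ c ih => exact (ih.add hf).mono (.of_forall fun k => by push_cast; rw [add_mul, one_mul])

/-- Needed because forking controls only the fourth power of a success probability. -/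
theorem Negl.of_pow {e : ℕ} (he : e ≠ 0) (hf : Negl fun k => f k ^ e) : Negl f := fun m => by
  filter_upwards [hf (m * e)] with k h
  rw [← pow_le_one_iff (n := e) he, mul_pow, ← _root_.pow_mul]
  rwa [show m * k * e = m * e * k by ring]

/-- In terms of `n = 2^k` this is decay like `n^(-c log n)`. Indeed `2^(mk) r^(k²) = (2^m r^k)^k`,
and the base is eventually below 1. -/
theorem negl_pow_sq {r : ℝ≥0∞} (hr : r < 1) : Negl fun k => r ^ k ^ 2 := fun m => by
  have h : Tendsto (fun k : ℕ => 2 ^ m * r ^ k) atTop (nhds (2 ^ m * 0)) :=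
    ENNReal.Tendsto.const_mul (ENNReal.tendsto_pow_atTop_nhds_zero_of_lt_one hr) (.inr (by simp))
  rw [mul_zero] at h
  filter_upwards [h.eventually (gt_mem_nhds zero_lt_one)] with k hk
  rw [pow_mul, sq, pow_mul, ← mul_pow]
  exact pow_le_one' hk.le k

theorem sq_le_two_pow {k : ℕ} (hk : 7 ≤ k) : k ^ 2 ≤ 2 ^ (k - 1) := by
  induction k, hk using Nat.le_induction with
  | base => norm_num
  | succ k hk ih =>
    rw [show k + 1 - 1 = k - 1 + 1 by omega, pow_succ 2]
    nlinarith

theorem negl_half_pow : Negl fun k => (1 / 2) ^ 2 ^ (k - 1) :=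
  (negl_pow_sq (r := 1 / 2) (by simp)).mono <| by
    filter_upwards [eventually_ge_atTop 7] with k hk
    exact pow_le_pow_right_of_le_one' (by simp) (sq_le_two_pow hk)

theorem negl_exp {c : ℝ} (hc : 0 < c) (d : ℕ) :
    Negl fun k => d * ((2 ^ k : ℕ) * ENNReal.ofReal (Real.exp (-(c * (k : ℝ) ^ 2)))) := by
  refine (((negl_pow_sq (r := ENNReal.ofReal (Real.exp (-c))) ?_).pow_mul 1).nat_mul d).mono
    (.of_forall fun k => ?_)
  · rw [ENNReal.ofReal_lt_one, Real.exp_lt_one_iff]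
    linarith
  · rw [one_mul, ← ENNReal.ofReal_pow (Real.exp_pos _).le, ← Real.exp_nat_mul]
    push_cast
    rw [show (k : ℝ) ^ 2 * -c = -(c * (k : ℝ) ^ 2) by ring]

theorem negligible_iff (f : ℕ → ℝ) : Negligible f ↔ Negl fun k => ENNReal.ofReal |f k| := by
  have key : ∀ m k : ℕ, ENNReal.ofReal |((2 : ℝ) ^ k) ^ m * f k| =
      2 ^ (m * k) * ENNReal.ofReal |f k| := by
    intro m k
    rw [abs_mul, abs_of_pos (by positivity), ENNReal.ofReal_mul (by positivity), ← pow_mul,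
      mul_comm k m, ENNReal.ofReal_pow (by norm_num)]
    simp
  unfold Negligible
  rw [Asymptotics.superpolynomialDecay_iff_abs_tendsto_zero]
  constructor
  · intro h m
    filter_upwards [(h m).eventually (gt_mem_nhds zero_lt_one)] with k hk
    rw [← key, ENNReal.ofReal_le_one]
    exact hk.le
  · intro h m
    have h2 : Tendsto (fun k : ℕ => ((1 / 2 : ℝ)) ^ k) atTop (nhds 0) :=
      tendsto_pow_atTop_nhds_zero_of_lt_one (by norm_num) (by norm_num)
    refine tendsto_of_tendsto_of_tendsto_of_le_of_le' tendsto_const_nhds h2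
      (.of_forall fun k => abs_nonneg _) ?_
    -- The spare factor `2^k` turns boundedness into convergence to zero.
    filter_upwards [h (m + 1)] with k hk
    rw [← key, ENNReal.ofReal_le_one, pow_succ, mul_right_comm, abs_mul,
      abs_of_pos (by positivity : (0 : ℝ) < 2 ^ k)] at hk
    rw [one_div, inv_pow, ← one_div, le_div_iff₀ (by positivity)]
    exact hk

theorem negligible_of_negl {f : ℕ → ℝ} {g : ℕ → ℝ≥0∞} (hg : Negl g)
    (h : ∀ᶠ k in atTop, ENNReal.ofReal |f k| ≤ g k) : Negligible f :=
  (negligible_iff f).2 (hg.mono h)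

theorem prob_nonneg (p : PMF Bool) : 0 ≤ prob p := ENNReal.toReal_nonneg

theorem ofReal_prob (p : PMF Bool) : ENNReal.ofReal (prob p) = expect p fun b => ind (b = true) := by
  rw [prob_eq_expect, ENNReal.ofReal_toReal]
  exact ne_top_of_le_ne_top ENNReal.one_ne_top (expect_le fun _ => ind_le_one _)

theorem ofReal_abs_prob (p : PMF Bool) :
    ENNReal.ofReal |prob p| = expect p fun b => ind (b = true) := by
  rw [abs_of_nonneg (prob_nonneg p), ofReal_prob]

theorem ofReal_abs_one_sub_prob (p : PMF Bool) :
    ENNReal.ofReal |1 - prob p| = expect p fun b => ind (¬b = true) := by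
  rw [expect_ind_not, ← ofReal_prob]
  have h1 : prob p ≤ 1 := by
    rw [← ENNReal.ofReal_le_one, ofReal_prob]
    exact expect_le fun _ => ind_le_one _
  rw [abs_of_nonneg (by linarith), ENNReal.ofReal_sub _ (prob_nonneg p), ENNReal.ofReal_one]

theorem expect_le_expect_add (p r : PMF Bool) : (expect p fun b => ind (b = true)) ≤
    (expect r fun b => ind (b = true)) + ENNReal.ofReal |(|prob p - prob r|)| := by
  rw [← ofReal_prob, ← ofReal_prob, ← ENNReal.ofReal_add (prob_nonneg _) (abs_nonneg _), abs_abs]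
  refine ENNReal.ofReal_le_ofReal ?_
  linarith [le_abs_self (prob p - prob r)]

end Negl

/-! ## Correctness -/

/-! ### Gaussian tails and the probability of a successful rejection step -/

section Correctness

/-- Split the sum by parity. For `y = 2m` one has `y²/2 ≥ m²`. For `y = 2m + 1`, `y²/2` is at least
`m²` if `m ≥ 0` and at least `(m+1)²` otherwise. So three copies of the original sum suffice. Half
of the exponent is thereby free to produce the tail bound, for every `σ`. -/
theorem tsum_gaussWeight_le (σ : ℝ) :
    ∑' y : ℤ, ENNReal.ofReal (Real.exp (-Real.pi * (y : ℝ) ^ 2 / σ ^ 2 / 2)) ≤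
      3 * ∑' y, gaussWeight σ y := by
  rw [← (Int.divModEquiv 2).symm.tsum_eq, ENNReal.tsum_prod']
  have h : ∀ c d : ℝ, d ≤ c → ENNReal.ofReal (Real.exp (-Real.pi * c / σ ^ 2)) ≤
      ENNReal.ofReal (Real.exp (-Real.pi * d / σ ^ 2)) := by
    intro c d hcd
    refine ENNReal.ofReal_le_ofReal (Real.exp_le_exp.2 (div_le_div_of_nonneg_right ?_ (sq_nonneg σ)))
    have := Real.pi_pos
    nlinarith
  have hm : ∀ m : ℤ, ∑' b : Fin 2, ENNReal.ofReal (Real.exp (-Real.pi *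
      (((Int.divModEquiv 2).symm (m, b) : ℤ) : ℝ) ^ 2 / σ ^ 2 / 2)) ≤
      gaussWeight σ m + (gaussWeight σ m + gaussWeight σ (m + 1)) := by
    intro m
    rw [tsum_fintype, Fin.sum_univ_two]
    have e : ∀ y : ℝ, -Real.pi * y ^ 2 / σ ^ 2 / 2 = -Real.pi * (y ^ 2 / 2) / σ ^ 2 := by
      intro y; ring
    refine add_le_add ?_ ?_
    · rw [e]
      refine h _ _ ?_
      simp
      nlinarith [sq_nonneg (m : ℝ)]
    · rw [e]
      simp only [Int.divModEquiv_symm_apply]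
      rcases le_or_gt 0 m with h0 | h0
      · refine le_add_right (h _ _ ?_)
        have : (0 : ℝ) ≤ m := by exact_mod_cast h0
        push_cast
        simp
        nlinarith
      · refine le_add_left (h _ _ ?_)
        have : (m : ℝ) + 1 ≤ 0 := by exact_mod_cast h0
        push_cast
        simp
        nlinarith
  refine (ENNReal.tsum_le_tsum hm).trans ?_
  have hs : ∑' m, gaussWeight σ (m + 1) = ∑' m, gaussWeight σ m :=
    (Equiv.addRight (1 : ℤ)).tsum_eq (gaussWeight σ)
  rw [ENNReal.tsum_add, ENNReal.tsum_add, hs]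
  apply le_of_eq
  ring

/-- The Gaussian tail bound. -/
theorem expect_gaussInt_le {σ T : ℝ} (hT : 0 ≤ T) :
    expect (gaussInt σ) (fun y => ind (¬|(y : ℝ)| ≤ T)) ≤
      3 * ENNReal.ofReal (Real.exp (-Real.pi * T ^ 2 / σ ^ 2 / 2)) := by
  unfold gaussInt
  split_ifs with h
  · unfold expect
    simp only [PMF.normalize_apply]
    set S := ∑' y, gaussWeight σ y
    calc _ ≤ ∑' y : ℤ, ENNReal.ofReal (Real.exp (-Real.pi * (y : ℝ) ^ 2 / σ ^ 2 / 2)) *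
            (S⁻¹ * ENNReal.ofReal (Real.exp (-Real.pi * T ^ 2 / σ ^ 2 / 2))) := by
          refine ENNReal.tsum_le_tsum fun y => ?_
          by_cases hy : |(y : ℝ)| ≤ T
          · rw [ind_of_not (by simpa)]; simp
          · rw [ind_of hy, mul_one, mul_comm S⁻¹, ← mul_assoc,
              ← ENNReal.ofReal_mul (Real.exp_pos _).le, ← Real.exp_add]
            unfold gaussWeight
            gcongr
            have h1 : T ^ 2 ≤ (y : ℝ) ^ 2 := by
              rw [← sq_abs (y : ℝ)]
              exact pow_le_pow_left₀ hT (le_of_not_ge hy) 2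
            have h2 : 0 ≤ Real.pi * ((y : ℝ) ^ 2 - T ^ 2) / σ ^ 2 := by
              have := Real.pi_pos
              apply div_nonneg (mul_nonneg this.le (by linarith)) (sq_nonneg σ)
            have h3 : -Real.pi * (y : ℝ) ^ 2 / σ ^ 2 / 2 + -Real.pi * T ^ 2 / σ ^ 2 / 2 -
              -Real.pi * (y : ℝ) ^ 2 / σ ^ 2 = Real.pi * ((y : ℝ) ^ 2 - T ^ 2) / σ ^ 2 / 2 := by ring
            linarith
      _ ≤ (3 * S) * (S⁻¹ * ENNReal.ofReal (Real.exp (-Real.pi * T ^ 2 / σ ^ 2 / 2))) := by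
          rw [ENNReal.tsum_mul_right]
          gcongr
          exact tsum_gaussWeight_le σ
      _ = _ := by
          rw [← mul_assoc, mul_assoc 3, ENNReal.mul_inv_cancel h.1 h.2, mul_one]
  · rw [expect_pure, ind_of_not (by simpa using hT)]
    exact zero_le

theorem expect_gaussR_le {n : ℕ} [NeZero n] {σ T : ℝ} (hT : 0 ≤ T) :
    expect (gaussR n σ) (fun s => ind (¬NormLe s T)) ≤
      n * (3 * ENNReal.ofReal (Real.exp (-Real.pi * T ^ 2 / σ ^ 2 / 2))) := by
  unfold gaussR
  rw [expect_map, iid_eq_indep]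
  have h1 : ∀ x : Fin n → ℤ, ind (¬NormLe (ofCoeffs x : Rz n) T) ≤ ∑ i, ind (¬|(x i : ℝ)| ≤ T) := by
    intro x
    refine le_trans (ind_mono fun h => ?_) (ind_exists_le _)
    by_contra! h'
    exact h fun i => by simpa using h' i
  refine (expect_mono h1).trans ?_
  rw [expect_sum]
  calc _ ≤ ∑ i : Fin n, 3 * ENNReal.ofReal (Real.exp (-Real.pi * T ^ 2 / σ ^ 2 / 2)) := by
        refine Finset.sum_le_sum fun i _ => ?_
        rw [expect_indep_apply (fun _ => gaussInt σ) i fun y : ℤ => ind (¬|(y : ℝ)| ≤ T)]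
        exact expect_gaussInt_le hT
    _ = _ := by simp

theorem normLe_iff_floor {n : ℕ} [NeZero n] {u : Rz n} {B : ℝ} (hB : 0 ≤ B) :
    NormLe u B ↔ ∀ i, |coeffs u i| ≤ (⌊B⌋₊ : ℤ) := by
  refine forall_congr' fun i => ?_
  rw [← Int.cast_abs, Int.abs_eq_natAbs, Int.cast_natCast, ← Nat.le_floor_iff hB, Nat.cast_le]

theorem setOf_normLe {n : ℕ} [NeZero n] {B : ℝ} (hB : 0 ≤ B) :
    {y : Rz n | NormLe y B} = symBox fun _ => ⌊B⌋₊ := by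
  ext u
  exact normLe_iff_floor hB

/-- Independent trials all fail. -/
theorem expect_iid_forall_not_le {α β : Type*} (p : PMF α) (r : PMF β) (m : ℕ) (Q : α → β → Prop)
    {ε : ℝ≥0∞} (h : ε ≤ expect p fun y => expect r fun y' => ind (Q y y')) :
    (expect (iid p m) fun y => expect (iid r m) fun y' => ind (∀ j, ¬Q (y j) (y' j))) ≤
      (1 - ε) ^ m := by
  classical
  have h1 : ∀ (y : Fin m → α) (y' : Fin m → β), ind (∀ j, ¬Q (y j) (y' j)) =
      ∏ j, ind (¬Q (y j) (y' j)) := by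
    intro y y'
    by_cases hy : ∀ j, ¬Q (y j) (y' j)
    · rw [ind_of hy, Finset.prod_eq_one fun j _ => ind_of (hy j)]
    · push Not at hy
      obtain ⟨j, hj⟩ := hy
      rw [ind_of_not (by push Not; exact ⟨j, hj⟩),
        Finset.prod_eq_zero (Finset.mem_univ j) (ind_of_not (by simpa))]
  simp_rw [h1, iid_eq_indep]
  simp_rw [fun y : Fin m → α => expect_indep_prod (fun _ => r) fun j y' => ind (¬Q (y j) y')]
  rw [expect_indep_prod (fun _ => p) fun _ y => expect r fun y' => ind (¬Q y y'), Finset.prod_const,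
    Finset.card_univ, Fintype.card_fin]
  refine pow_le_pow_left' ?_ m
  have h2 := expect_ind_not (p.bind fun y => r.map fun y' => (y, y')) fun z => Q z.1 z.2
  simp only [expect_bind, expect_map] at h2
  rw [h2]
  exact tsub_le_tsub_left h 1

/-- The probability that a shifted element of a box lies in a slightly smaller box. -/
theorem pow_le_expect_box {n b b' : ℕ} [NeZero n] {g : Rz n}
    (h : ∀ i, b' + (coeffs g i).natAbs ≤ b) :
    (((2 * b' + 1 : ℕ) : ℝ≥0∞) * ((2 * b + 1 : ℕ) : ℝ≥0∞)⁻¹) ^ n ≤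
      expect (uniformOn (symBox fun _ : Fin n => b)) fun y =>
        ind (∀ i, |coeffs (g + y) i| ≤ (b' : ℤ)) := by
  rw [expect_symBox]
  have h1 : ∀ x : Fin n → ℤ, ∏ i, ind (|coeffs g i + x i| ≤ (b' : ℤ)) ≤
      ind (∀ i, |coeffs (g + ofCoeffs x) i| ≤ (b' : ℤ)) := by
    intro x
    by_cases hx : ∀ i, |coeffs (g + ofCoeffs x) i| ≤ (b' : ℤ)
    · rw [ind_of hx]
      exact Finset.prod_le_one' fun i _ => ind_le_one _
    · push Not at hx
      obtain ⟨i, hi⟩ := hx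
      rw [Finset.prod_eq_zero (Finset.mem_univ i)]
      · exact zero_le
      · refine ind_of_not (not_le.2 ?_)
        simpa using hi
  refine le_trans ?_ (expect_mono h1)
  rw [expect_indep_prod _ fun i y => ind (|coeffs g i + y| ≤ (b' : ℤ))]
  calc _ = ∏ i : Fin n, (((2 * b' + 1 : ℕ) : ℝ≥0∞) * ((2 * b + 1 : ℕ) : ℝ≥0∞)⁻¹) := by simp
    _ ≤ _ := Finset.prod_le_prod' fun i _ => expect_unifI_shift b b' _ (h i)

/-- With `N = 2^k` and `B' = (1 - 1/N) B`, rounding to integers costs little as `B ≥ N`: the ratio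
of the numbers of points is at least `1 - 2/N`. -/
theorem one_div_le_ratio_pow {k : ℕ} (hk : 2 ≤ k) {B B' : ℝ} (hB : (2 : ℝ) ^ k ≤ B)
    (hB' : B' * 2 ^ k = (2 ^ k - 1) * B) :
    1 / 16 ≤ (((2 * ⌊B'⌋₊ + 1 : ℕ) : ℝ≥0∞) * ((2 * ⌊B⌋₊ + 1 : ℕ) : ℝ≥0∞)⁻¹) ^ 2 ^ k := by
  obtain ⟨j, rfl⟩ := Nat.exists_eq_add_of_le' hk
  have hN : (1 : ℝ) ≤ 2 ^ j := one_le_pow₀ (by norm_num)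
  have hn : (4 : ℝ) ≤ 2 ^ (j + 2) := by rw [pow_add]; linarith
  set N : ℝ := 2 ^ (j + 2) with hNdef
  have h1 : 1 - 2 / N ≤ (2 * ⌊B'⌋₊ + 1) * (2 * ⌊B⌋₊ + 1 : ℝ)⁻¹ := by
    have hb : (⌊B⌋₊ : ℝ) ≤ B := Nat.floor_le (by linarith)
    have hb' : B' < ⌊B'⌋₊ + 1 := Nat.lt_floor_add_one B'
    have hN0 : (0 : ℝ) < N := by linarith
    rw [← div_eq_mul_inv, le_div_iff₀ (by positivity), ← sub_nonneg]
    have h2 : 0 ≤ ((2 * ⌊B'⌋₊ + 1) - (1 - 2 / N) * (2 * ⌊B⌋₊ + 1)) * N := by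
      have : ((2 * (⌊B'⌋₊ : ℝ) + 1) - (1 - 2 / N) * (2 * ⌊B⌋₊ + 1)) * N =
        (2 * ⌊B'⌋₊ + 1) * N - (N - 2) * (2 * ⌊B⌋₊ + 1) := by field_simp
      rw [this]
      nlinarith
    exact nonneg_of_mul_nonneg_left h2 hN0
  have h2 : ENNReal.ofReal (1 - 2 / N) ≤
      ((2 * ⌊B'⌋₊ + 1 : ℕ) : ℝ≥0∞) * ((2 * ⌊B⌋₊ + 1 : ℕ) : ℝ≥0∞)⁻¹ := by
    refine (ENNReal.ofReal_le_ofReal h1).trans (le_of_eq ?_)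
    rw [ENNReal.ofReal_mul (by positivity), ENNReal.ofReal_inv_of_pos (by positivity)]
    congr
    · rw [← ENNReal.ofReal_natCast]; push_cast; rfl
    · rw [← ENNReal.ofReal_natCast]; push_cast; rfl
  refine le_trans ?_ (pow_le_pow_left' h2 _)
  have h3 : 0 ≤ 1 - 2 / N := by
    rw [sub_nonneg, div_le_one (by linarith)]; linarith
  -- Bernoulli's inequality with exponent `2^j = N/4`; the fourth power then gives `1/16`.
  have h4 : 1 / 2 ≤ (1 - 2 / N) ^ 2 ^ j := by
    have := one_add_mul_le_pow (a := -(2 / N)) (by linarith) (2 ^ j)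
    rw [← sub_eq_add_neg] at this
    refine le_trans (le_of_eq ?_) this
    rw [hNdef, pow_add]
    push_cast
    field_simp
    norm_num
  rw [← ENNReal.ofReal_pow h3, pow_add 2 j, pow_mul]
  have h5 : (1 / 16 : ℝ≥0∞) = ENNReal.ofReal ((1 / 2) ^ 2 ^ 2) := by
    rw [ENNReal.ofReal_pow (by norm_num), ENNReal.ofReal_div_of_pos (by norm_num)]
    simp [← ENNReal.inv_pow]
    norm_num
  rw [h5]
  exact ENNReal.ofReal_le_ofReal (pow_le_pow_left₀ (by norm_num) h4 _)

end Correctness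

/-! ### The honest prover -/

section Correctness

variable {P : Params} {k : ℕ}

theorem ind_and (Q R : Prop) : ind (Q ∧ R) = ind Q * ind R := by
  by_cases h : Q <;> by_cases h' : R
  · rw [ind_of h, ind_of h', ind_of ⟨h, h'⟩, one_mul]
  all_goals rw [ind_of_not (by tauto)]; simp [ind, h, h']

theorem cast_two_pow (k : ℕ) : ((2 ^ k : ℕ) : ℝ) = 2 ^ k := by push_cast; rfl

/-- The bound `√n σ log³ n`. -/
def Params.prodBound (P : Params) (k : ℕ) : ℝ := Real.sqrt (2 ^ k) * P.σ (2 ^ k) * k ^ 3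

theorem maskSet_eq (hσ : 0 < P.σ (2 ^ k)) :
    P.maskSet (2 ^ k) = symBox fun _ => ⌊2 ^ k * P.prodBound k⌋₊ := by
  have h0 : 0 ≤ P.prodBound k := by unfold Params.prodBound; positivity
  rw [← setOf_normLe (by positivity)]
  unfold Params.maskSet
  have : ((2 ^ k : ℕ) : ℝ) ^ (1.5 : ℝ) * P.σ (2 ^ k) * lg (2 ^ k) ^ 3 = 2 ^ k * P.prodBound k := by
    rw [lg_two_pow, cast_two_pow, show (1.5 : ℝ) = 1 + 1 / 2 by norm_num,
      Real.rpow_add (by positivity), Real.rpow_one, ← Real.sqrt_eq_rpow]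
    unfold Params.prodBound; ring
  rw [this]

theorem mem_respSet (hσ : 0 < P.σ (2 ^ k)) (z : Rz (2 ^ k)) :
    z ∈ P.respSet (2 ^ k) ↔ ∀ i, |coeffs z i| ≤ (⌊(2 ^ k - 1) * P.prodBound k⌋₊ : ℤ) := by
  have h0 : 0 ≤ P.prodBound k := by unfold Params.prodBound; positivity
  have h1 : (1 : ℝ) ≤ 2 ^ k := one_le_pow₀ (by norm_num)
  rw [← normLe_iff_floor (mul_nonneg (by linarith) h0)]
  unfold Params.respSet
  have : (((2 ^ k : ℕ) : ℝ) - 1) * ((2 ^ k : ℕ) : ℝ) ^ (0.5 : ℝ) * P.σ (2 ^ k) * lg (2 ^ k) ^ 3 =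
      (2 ^ k - 1) * P.prodBound k := by
    rw [lg_two_pow, cast_two_pow, show (0.5 : ℝ) = 1 / 2 by norm_num, ← Real.sqrt_eq_rpow]
    unfold Params.prodBound; ring
  rw [this]
  rfl

/-- The bounds of `𝒴` and `𝒵` differ by exactly `prodBound`, the permitted size of the shift `g`, so
the shifted box still covers `𝒵` whichever `g` is. -/
theorem expect_respSet (hk : 2 ≤ k) (hσ : 0 < P.σ (2 ^ k)) (hB : 1 ≤ P.prodBound k)
    {g : Rz (2 ^ k)} (hg : NormLe g (P.prodBound k)) :
    1 / 16 ≤ expect (uniformOn (P.maskSet (2 ^ k))) fun y => ind (g + y ∈ P.respSet (2 ^ k)) := by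
  have h1 : (1 : ℝ) ≤ 2 ^ k := one_le_pow₀ (by norm_num)
  simp_rw [mem_respSet hσ]
  rw [maskSet_eq hσ]
  refine (one_div_le_ratio_pow hk (B := 2 ^ k * P.prodBound k)
    (B' := (2 ^ k - 1) * P.prodBound k) (by nlinarith) (by ring)).trans (pow_le_expect_box ?_)
  intro i
  refine Nat.le_floor ?_
  push_cast
  have h2 := Nat.floor_le (mul_nonneg (by linarith) (by linarith) :
    0 ≤ (2 ^ k - 1) * P.prodBound k)
  have h3 := hg i
  rw [← Int.cast_abs, Int.abs_eq_natAbs, Int.cast_natCast] at h3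
  linarith

/-- The honest prover rarely aborts. -/
theorem expect_abort_le (hk : 2 ≤ k) (hσ : 0 < P.σ (2 ^ k)) (hB : 1 ≤ P.prodBound k)
    (hμ : k ^ 2 ≤ P.μ (2 ^ k)) {g₁ g₂ : Rz (2 ^ k)} (h₁ : NormLe g₁ (P.prodBound k))
    (h₂ : NormLe g₂ (P.prodBound k)) :
    (expect (iid (uniformOn (P.maskSet (2 ^ k))) (P.μ (2 ^ k))) fun y =>
      expect (iid (uniformOn (P.maskSet (2 ^ k))) (P.μ (2 ^ k))) fun y' =>
        ind (∀ j, ¬(g₁ + y j ∈ P.respSet (2 ^ k) ∧ g₂ + y' j ∈ P.respSet (2 ^ k)))) ≤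
      (1 - 1 / 16 * (1 / 16)) ^ k ^ 2 := by
  refine (expect_iid_forall_not_le _ _ _
    (fun y y' => g₁ + y ∈ P.respSet (2 ^ k) ∧ g₂ + y' ∈ P.respSet (2 ^ k))
    (ε := 1 / 16 * (1 / 16)) ?_).trans (pow_le_pow_right_of_le_one' tsub_le_self hμ)
  have : ∀ y y' : Rz (2 ^ k), ind (g₁ + y ∈ P.respSet (2 ^ k) ∧ g₂ + y' ∈ P.respSet (2 ^ k)) =
      ind (g₁ + y ∈ P.respSet (2 ^ k)) * ind (g₂ + y' ∈ P.respSet (2 ^ k)) := fun y y' => ind_and _ _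
  simp_rw [this, expect_const_mul, expect_mul_const]
  exact mul_le_mul' (expect_respSet hk hσ hB h₁) (expect_respSet hk hσ hB h₂)

/-- The bound for the sum of the masks. -/
def Params.sumBound (P : Params) (k : ℕ) : ℝ :=
  2 ^ k * P.prodBound k * Real.sqrt (P.μ (2 ^ k)) * k

theorem prodBound_add_sumBound_le (hk : 1 ≤ k) (hσ : 0 < P.σ (2 ^ k)) (hμ : 1 ≤ P.μ (2 ^ k))
    {t : ℕ} (ht : 1 ≤ t) : P.prodBound k + P.sumBound k ≤ P.eta (2 ^ k) t := by
  unfold Params.sumBound Params.eta Params.prodBound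
  rw [lg_two_pow, cast_two_pow]
  have hn : (1 : ℝ) ≤ 2 ^ k := one_le_pow₀ (by norm_num)
  have hs : Real.sqrt (2 ^ k) ≤ 2 ^ k := (Real.sqrt_le_left (by linarith)).2 (by nlinarith)
  have hk' : (1 : ℝ) ≤ k := by exact_mod_cast hk
  have hm : (1 : ℝ) ≤ Real.sqrt (P.μ (2 ^ k)) := Real.one_le_sqrt.2 (by exact_mod_cast hμ)
  have htm : Real.sqrt (P.μ (2 ^ k)) ≤ Real.sqrt (t * P.μ (2 ^ k)) := by
    refine Real.sqrt_le_sqrt ?_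
    have : (1 : ℝ) ≤ t := by exact_mod_cast ht
    have h0 : (0 : ℝ) ≤ P.μ (2 ^ k) := by positivity
    nlinarith
  have hk3 : (k : ℝ) ^ 3 ≤ k ^ 6 := pow_le_pow_right₀ hk' (by norm_num)
  have hk4 : (k : ℝ) ^ 3 * k ≤ k ^ 6 := by
    rw [← pow_succ]; exact pow_le_pow_right₀ hk' (by norm_num)
  set N : ℝ := 2 ^ k
  set s := Real.sqrt N
  set m := Real.sqrt (P.μ (2 ^ k))
  set m' := Real.sqrt (t * P.μ (2 ^ k))
  set σ := P.σ (2 ^ k)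
  have hs0 : 0 ≤ s := Real.sqrt_nonneg _
  have a1 : s * (k : ℝ) ^ 3 ≤ N ^ 2 * m' * k ^ 6 := by
    have : s ≤ N ^ 2 * m' := by nlinarith [mul_nonneg (by linarith : 0 ≤ N) (by linarith : 0 ≤ m')]
    exact mul_le_mul this hk3 (by positivity) (by positivity)
  have a2 : N * s * m * ((k : ℝ) ^ 3 * k) ≤ N ^ 2 * m' * k ^ 6 := by
    have h1 : N * s ≤ N ^ 2 := by nlinarith
    have h2 : N * s * m ≤ N ^ 2 * m' := mul_le_mul h1 htm (by linarith) (by positivity)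
    exact mul_le_mul h2 hk4 (by positivity) (by positivity)
  have a3 : 0 ≤ N ^ 2 * m' * (k : ℝ) ^ 6 := by positivity
  calc s * σ * k ^ 3 + N * (s * σ * k ^ 3) * m * k
      = σ * (s * (k : ℝ) ^ 3) + σ * (N * s * m * ((k : ℝ) ^ 3 * k)) := by ring
    _ ≤ σ * (N ^ 2 * m' * k ^ 6) + σ * (N ^ 2 * m' * k ^ 6) := by gcongr
    _ ≤ 5 * (σ * (N ^ 2 * m' * k ^ 6)) := by nlinarith [mul_nonneg hσ.le a3]
    _ = _ := by ring

/-- The tail bound for products with factors of norms `σ log n` and `log n`: the variance proxy is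
`n (σ log² n)²`, and `prodBound` is `log n` times its square root. -/
theorem expect_prod_bad_le (hk : 1 ≤ k) (hσ : 0 < P.σ (2 ^ k)) {s : Rz (2 ^ k)}
    (hs : NormLe s (P.σ (2 ^ k) * k)) :
    expect (uniformOn (chalSet (2 ^ k))) (fun c => ind (¬NormLe (s * c) (P.prodBound k))) ≤
      2 * ((2 ^ k : ℕ) * ENNReal.ofReal (Real.exp (-(1 / 2 * (k : ℝ) ^ 2)))) := by
  have hk' : (0 : ℝ) < k := by exact_mod_cast hk
  rw [chalSet_eq]
  refine (expect_mul_tail _ (K := k) (fun i => by exact_mod_cast chalBound_le k i) hk'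
    (by positivity) (by unfold Params.prodBound; positivity) hs).trans (le_of_eq ?_)
  have : -P.prodBound k ^ 2 / (2 * (((2 ^ k : ℕ) : ℝ) * (P.σ (2 ^ k) * k * k) ^ 2)) =
      -(1 / 2 * (k : ℝ) ^ 2) := by
    unfold Params.prodBound
    rw [cast_two_pow, mul_pow, mul_pow, Real.sq_sqrt (by positivity)]
    field_simp
  rw [this, ENNReal.ofReal_mul (by norm_num)]
  simp only [ENNReal.ofReal_ofNat]
  ring

theorem expect_sum_bad_le (hk : 1 ≤ k) (hσ : 0 < P.σ (2 ^ k)) (hμ : 1 ≤ P.μ (2 ^ k)) :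
    expect (iid (uniformOn (P.maskSet (2 ^ k))) (P.μ (2 ^ k)))
      (fun y => ind (¬NormLe (∑ j, y j) (P.sumBound k))) ≤
      2 * ((2 ^ k : ℕ) * ENNReal.ofReal (Real.exp (-(1 / 2 * (k : ℝ) ^ 2)))) := by
  have hk' : (0 : ℝ) < k := by exact_mod_cast hk
  have hμ' : (0 : ℝ) < P.μ (2 ^ k) := by exact_mod_cast hμ
  have h0 : 0 < P.prodBound k := by unfold Params.prodBound; positivity
  rw [maskSet_eq hσ]
  refine (expect_sum_tail _ _ (T := P.sumBound k) (B := 2 ^ k * P.prodBound k)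
    (V := P.μ (2 ^ k) * (2 ^ k * P.prodBound k) ^ 2) (by unfold Params.sumBound; positivity)
    (Nat.floor_le (by positivity)) (by positivity) le_rfl).trans (le_of_eq ?_)
  have : -P.sumBound k ^ 2 / (2 * (P.μ (2 ^ k) * (2 ^ k * P.prodBound k) ^ 2)) =
      -(1 / 2 * (k : ℝ) ^ 2) := by
    unfold Params.sumBound
    rw [mul_pow, mul_pow (2 ^ k * P.prodBound k), Real.sq_sqrt hμ'.le]
    field_simp
  rw [this, ENNReal.ofReal_mul (by norm_num)]
  simp only [ENNReal.ofReal_ofNat]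
  ring

theorem expect_key_bad_le (hσ : 0 < P.σ (2 ^ k)) :
    expect (gaussR (2 ^ k) (P.σ (2 ^ k))) (fun s => ind (¬NormLe s (P.σ (2 ^ k) * k))) ≤
      3 * ((2 ^ k : ℕ) * ENNReal.ofReal (Real.exp (-(1 / 2 * (k : ℝ) ^ 2)))) := by
  refine (expect_gaussR_le (by positivity)).trans ?_
  have : Real.exp (-Real.pi * (P.σ (2 ^ k) * k) ^ 2 / P.σ (2 ^ k) ^ 2 / 2) ≤
      Real.exp (-(1 / 2 * (k : ℝ) ^ 2)) := by
    refine Real.exp_le_exp.2 ?_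
    have h : -Real.pi * (P.σ (2 ^ k) * k) ^ 2 / P.σ (2 ^ k) ^ 2 / 2 = -Real.pi * k ^ 2 / 2 := by
      field_simp
    rw [h]
    nlinarith [Real.pi_gt_three, sq_nonneg (k : ℝ)]
  calc _ ≤ ((2 ^ k : ℕ) : ℝ≥0∞) * (3 * ENNReal.ofReal (Real.exp (-(1 / 2 * (k : ℝ) ^ 2)))) := by
        gcongr
    _ = _ := by ring

/-- The verifier accepts the reaction of the prover. -/
def Params.Accepts (P : Params) (n : ℕ) [NeZero n] (t : ℕ) (a u : Rq (P.q n) n)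
    (v : Fin (P.μ n) → Rq (P.q n) n) (c : Rz n) (rsp : Option (Rq (P.q n) n × Rq (P.q n) n)) : Prop :=
  ∃ z, rsp = some z ∧ P.Verify n t a u v c z

/-- For every `j*` the response is `s_b c + ∑ y_bj`, so the verification equation holds identically.
Rejection can only come from an abort or from one of four norms. -/
theorem expect_respond_le [NeZero (P.q (2 ^ k))] {t : ℕ}
    (ht : P.prodBound k + P.sumBound k ≤ P.eta (2 ^ k) t) (a : Rq (P.q (2 ^ k)) (2 ^ k))
    (s₁ s₂ c : Rz (2 ^ k)) (y₁ y₂ : Fin (P.μ (2 ^ k)) → Rz (2 ^ k)) :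
    expect (P.respond (2 ^ k) (s₁, s₂) (y₁, y₂) c) (fun rsp =>
      ind (¬P.Accepts (2 ^ k) t a (a * red _ s₁ + red _ s₂)
        (fun j => a * red _ (y₁ j) + red _ (y₂ j)) c rsp)) ≤
      ind (∀ j, ¬(s₁ * c + y₁ j ∈ P.respSet (2 ^ k) ∧ s₂ * c + y₂ j ∈ P.respSet (2 ^ k))) +
      (ind (¬NormLe (s₁ * c) (P.prodBound k)) + ind (¬NormLe (s₂ * c) (P.prodBound k)) +
      (ind (¬NormLe (∑ j, y₁ j) (P.sumBound k)) + ind (¬NormLe (∑ j, y₂ j) (P.sumBound k)))) := by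
  classical
  by_cases h0 : ∀ j, ¬(s₁ * c + y₁ j ∈ P.respSet (2 ^ k) ∧ s₂ * c + y₂ j ∈ P.respSet (2 ^ k))
  · rw [ind_of h0]
    exact (expect_le fun _ => ind_le_one _).trans le_self_add
  rw [ind_of_not h0, zero_add]
  have h1 : ∀ j, s₁ * c + y₁ j + ∑ i ∈ Finset.univ.erase j, y₁ i = s₁ * c + ∑ i, y₁ i := fun j => by
    rw [add_assoc, Finset.add_sum_erase _ _ (Finset.mem_univ j)]
  have h2 : ∀ j, s₂ * c + y₂ j + ∑ i ∈ Finset.univ.erase j, y₂ i = s₂ * c + ∑ i, y₂ i := fun j => by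
    rw [add_assoc, Finset.add_sum_erase _ _ (Finset.mem_univ j)]
  have hne : (Finset.univ.filter fun j => s₁ * c + y₁ j ∈ P.respSet (2 ^ k) ∧
      s₂ * c + y₂ j ∈ P.respSet (2 ^ k)).Nonempty := by
    push Not at h0
    obtain ⟨j, hj⟩ := h0
    exact ⟨j, by simpa using hj⟩
  unfold Params.respond
  simp only
  rw [dif_pos hne, expect_map]
  refine expect_le fun j => ?_
  rw [h1, h2]
  refine le_trans (ind_mono fun h => ?_) ((ind_or_le _ _).trans
    (add_le_add (ind_or_le _ _) (ind_or_le _ _)))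
  by_contra! hc
  obtain ⟨⟨c1, c2⟩, c3, c4⟩ := hc
  refine h ⟨_, rfl, ?_, ((c1.add c3).mono ht).red, ((c2.add c4).mono ht).red⟩
  simp only [map_add, map_mul, map_sum, Finset.sum_add_distrib, ← Finset.mul_sum]
  ring

theorem expect_fail_le [NeZero (P.q (2 ^ k))] (hk : 2 ≤ k) (hσ : 0 < P.σ (2 ^ k))
    (hB : 1 ≤ P.prodBound k) (hμ : k ^ 2 ≤ P.μ (2 ^ k)) {t : ℕ} (ht : 1 ≤ t)
    {δ τ : ℝ≥0∞} (hδ : δ = (2 ^ k : ℕ) * ENNReal.ofReal (Real.exp (-(1 / 2 * (k : ℝ) ^ 2))))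
    (hτ : τ = (1 - 1 / 16 * (1 / 16)) ^ k ^ 2) (a : Rq (P.q (2 ^ k)) (2 ^ k)) (s₁ s₂ : Rz (2 ^ k)) :
    (expect (iid (uniformOn (P.maskSet (2 ^ k))) (P.μ (2 ^ k))) fun y₁ =>
      expect (iid (uniformOn (P.maskSet (2 ^ k))) (P.μ (2 ^ k))) fun y₂ =>
      expect (uniformOn (chalSet (2 ^ k))) fun c =>
      expect (P.respond (2 ^ k) (s₁, s₂) (y₁, y₂) c) fun rsp =>
        ind (¬P.Accepts (2 ^ k) t a (a * red _ s₁ + red _ s₂)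
          (fun j => a * red _ (y₁ j) + red _ (y₂ j)) c rsp)) ≤
    τ + 12 * δ + (ind (¬NormLe s₁ (P.σ (2 ^ k) * k)) + ind (¬NormLe s₂ (P.σ (2 ^ k) * k))) := by
  have hμ1 : 1 ≤ P.μ (2 ^ k) := le_trans (Nat.one_le_pow _ _ (by omega)) hμ
  have hη := prodBound_add_sumBound_le (by omega) hσ hμ1 ht
  by_cases h1 : NormLe s₁ (P.σ (2 ^ k) * k)
  swap
  · rw [ind_of h1]
    refine le_trans ?_ (le_add_left le_self_add)
    exact expect_le fun _ => expect_le fun _ => expect_le fun _ => expect_le fun _ => ind_le_one _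
  by_cases h2 : NormLe s₂ (P.σ (2 ^ k) * k)
  swap
  · rw [ind_of h2]
    refine le_trans ?_ (le_add_left (le_add_left le_rfl))
    exact expect_le fun _ => expect_le fun _ => expect_le fun _ => expect_le fun _ => ind_le_one _
  rw [ind_of_not (by simpa), ind_of_not (by simpa), add_zero, add_zero]
  -- The abort is estimated for a fixed challenge over the choice of the masks; challenges for which
  -- a product `s_b c` is too long are charged separately.
  have habort : ∀ c : Rz (2 ^ k),
      (expect (iid (uniformOn (P.maskSet (2 ^ k))) (P.μ (2 ^ k))) fun y₁ =>
        expect (iid (uniformOn (P.maskSet (2 ^ k))) (P.μ (2 ^ k))) fun y₂ => ind (∀ j,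
          ¬(s₁ * c + y₁ j ∈ P.respSet (2 ^ k) ∧ s₂ * c + y₂ j ∈ P.respSet (2 ^ k)))) ≤
      τ + (ind (¬NormLe (s₁ * c) (P.prodBound k)) + ind (¬NormLe (s₂ * c) (P.prodBound k))) := by
    intro c
    by_cases g1 : NormLe (s₁ * c) (P.prodBound k)
    swap
    · rw [ind_of g1]
      refine le_trans ?_ (le_add_left le_self_add)
      exact expect_le fun _ => expect_le fun _ => ind_le_one _
    by_cases g2 : NormLe (s₂ * c) (P.prodBound k)
    swap
    · rw [ind_of g2]
      refine le_trans ?_ (le_add_left (le_add_left le_rfl))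
      exact expect_le fun _ => expect_le fun _ => ind_le_one _
    exact le_add_right (hτ ▸ expect_abort_le hk hσ hB hμ g1 g2)
  refine (expect_mono fun y₁ => expect_mono fun y₂ => expect_mono fun c =>
    expect_respond_le hη a s₁ s₂ c y₁ y₂).trans ?_
  simp only [expect_add, expect_const]
  have h3 : (expect (iid (uniformOn (P.maskSet (2 ^ k))) (P.μ (2 ^ k))) fun y₁ =>
      expect (iid (uniformOn (P.maskSet (2 ^ k))) (P.μ (2 ^ k))) fun y₂ =>
      expect (uniformOn (chalSet (2 ^ k))) fun c => ind (∀ j,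
          ¬(s₁ * c + y₁ j ∈ P.respSet (2 ^ k) ∧ s₂ * c + y₂ j ∈ P.respSet (2 ^ k)))) ≤
      τ + (2 * δ + 2 * δ) := by
    -- The challenge is moved in front of the masks, which do not depend on it.
    refine (expect_mono fun y₁ => (expect_comm _ _ _).le).trans ?_
    rw [expect_comm]
    refine (expect_mono habort).trans ?_
    simp only [expect_add, expect_const]
    gcongr
    · exact hδ ▸ expect_prod_bad_le (by omega) hσ h1
    · exact hδ ▸ expect_prod_bad_le (by omega) hσ h2
  calc _ ≤ τ + (2 * δ + 2 * δ) + (2 * δ + 2 * δ + (2 * δ + 2 * δ)) := by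
        gcongr
        · exact hδ ▸ expect_prod_bad_le (by omega) hσ h1
        · exact hδ ▸ expect_prod_bad_le (by omega) hσ h2
        · exact hδ ▸ expect_sum_bad_le (by omega) hσ hμ1
        · exact hδ ▸ expect_sum_bad_le (by omega) hσ hμ1
    _ = _ := by ring

/-- The verifier rejects the honest prover with negligible probability only. -/
theorem expect_honestRun_le [NeZero (P.q (2 ^ k))] (hk : 2 ≤ k) (hσ : 0 < P.σ (2 ^ k))
    (hB : 1 ≤ P.prodBound k) (hμ : k ^ 2 ≤ P.μ (2 ^ k)) {t : ℕ} (ht : 1 ≤ t) :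
    expect (honestRun P (2 ^ k) t) (fun b => ind (¬b = true)) ≤
      (18 : ℕ) * ((2 ^ k : ℕ) * ENNReal.ofReal (Real.exp (-(1 / 2 * (k : ℝ) ^ 2)))) +
        (1 - 1 / 16 * (1 / 16)) ^ k ^ 2 := by
  unfold honestRun Params.keyGen Params.commit
  simp only [expect_bind, expect_map]
  refine expect_le fun a => ?_
  refine le_trans (expect_mono fun s₁ => expect_mono fun s₂ => le_trans
    (expect_mono fun y₁ => expect_mono fun y₂ => expect_mono fun c => expect_mono fun rsp =>
      ind_mono fun h => ?_) (expect_fail_le hk hσ hB hμ ht rfl rfl a s₁ s₂)) ?_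
  · rintro ⟨z, rfl, hz⟩
    exact h (@decide_eq_true _ (Classical.propDecidable _) hz)
  simp only [expect_add, expect_const]
  -- Each of the two secrets contributes 3, and 12 come from `expect_fail_le`: 18 in all.
  refine (add_le_add_right (add_le_add (expect_key_bad_le hσ) (expect_key_bad_le hσ)) _).trans
    (le_of_eq ?_)
  push_cast
  ring

end Correctness

/-! ## The reductions -/

section Programs

variable (V : PPT) (𝒜 : Attacker)

/-- The attack on an honest key, played by the distinguisher. -/
def attackV (un x : Val) : PMF Val :=
  (𝒜.first.run un.toList.length x).bind fun w₁ =>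
  (V.run un.toList.length (.pair x.fst (lenV w₁.snd + .num 1))).bind fun p =>
  (sampleL un w₁.snd).bind fun l =>
  (sampleC un).bind fun l₁ =>
  (𝒜.second.run un.toList.length (.pair w₁.fst (.pair l₁ l))).bind fun w₂ =>
  (sampleC un).bind fun c =>
  (𝒜.third.run un.toList.length (.pair w₂.fst c)).bind fun w₃ =>
  PMF.pure (verV (mkCtx un p.fst) p.snd.fst p.snd.snd.fst (load (mkCtx un p.fst) x.snd.fst)
    (.pair x.snd.snd w₁.snd) (.pair l₁ l) w₂.snd c w₃.fst w₃.snd)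

/-- Every sampled variable is one application of `PP.bind`; the deterministic verification at the
end is left to `fun_prop`. -/
theorem exists_distinguisher :
    ∃ D : PPT, ∀ n x, D.run n x = attackV V 𝒜 (unary n) x := by
  have : PP fun v => attackV V 𝒜 v.fst v.snd := by
    unfold attackV
    refine PP.bind (PPT.pp_run _ (by fun_prop) (by fun_prop)) ?_
    refine PP.bind (PPT.pp_run _ (by fun_prop) (by fun_prop)) ?_
    refine PP.bind (PP.sampleL (by fun_prop) (by fun_prop)) ?_
    refine PP.bind (PP.sampleC (by fun_prop)) ?_
    refine PP.bind (PPT.pp_run _ (by fun_prop) (by fun_prop)) ?_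
    refine PP.bind (PP.sampleC (by fun_prop)) ?_
    refine PP.bind (PPT.pp_run _ (by fun_prop) (by fun_prop)) ?_
    change FP _
    fun_prop
  exact PPT.exists_of_pp this

/-- The attack after its first move, up to two responses. -/
def branchV (un w₁ l : Val) : PMF Val :=
  (sampleC un).bind fun l₁ =>
  (𝒜.second.run un.toList.length (.pair w₁.fst (.pair l₁ l))).bind fun w₂ =>
  (sampleC un).bind fun c =>
  (𝒜.third.run un.toList.length (.pair w₂.fst c)).bind fun w₃ =>
  (sampleC un).bind fun c' =>
  (𝒜.third.run un.toList.length (.pair w₂.fst c')).bind fun w₃' =>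
  PMF.pure (.pair l₁ (.pair (.pair c w₃) (.pair c' w₃')))

theorem PP.branchV {un w₁ l : Val → Val} (h1 : FP un) (h2 : FP w₁) (h3 : FP l) :
    PP fun v => branchV 𝒜 (un v) (w₁ v) (l v) := by
  unfold LatticeID.branchV
  refine PP.bind (PP.sampleC (by fun_prop)) ?_
  refine PP.bind (PPT.pp_run _ (by fun_prop) (by fun_prop)) ?_
  refine PP.bind (PP.sampleC (by fun_prop)) ?_
  refine PP.bind (PPT.pp_run _ (by fun_prop) (by fun_prop)) ?_
  refine PP.bind (PP.sampleC (by fun_prop)) ?_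
  refine PP.bind (PPT.pp_run _ (by fun_prop) (by fun_prop)) ?_
  change FP _
  fun_prop

/-- The difference of two loaded elements. -/
def diffV (K a b : Val) : Val := load K a - load K b

@[fun_prop]
theorem FP.diffV {K a b : Val → Val} (h1 : FP K) (h2 : FP a) (h3 : FP b) :
    FP fun v => diffV (K v) (a v) (b v) := by
  unfold LatticeID.diffV; fun_prop

/-- The solution that is computed from two branches. -/
def combineV (K b b' : Val) : Val :=
  let d := diffV K b.snd.fst.fst b.snd.snd.fst
  let d' := diffV K b'.snd.fst.fst b'.snd.snd.fst
  .pair (outZ K (diffV K b.snd.fst.snd.fst b.snd.snd.snd.fst * d' -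
    diffV K b'.snd.fst.snd.fst b'.snd.snd.snd.fst * d))
  (.pair (outZ K (diffV K b.snd.fst.snd.snd b.snd.snd.snd.snd * d' -
    diffV K b'.snd.fst.snd.snd b'.snd.snd.snd.snd * d))
  (.pair (outZ K (diffV K b'.fst b.fst * (d * d'))) (.num 0)))

@[fun_prop]
theorem FP.combineV {K b b' : Val → Val} (h1 : FP K) (h2 : FP b) (h3 : FP b') :
    FP fun v => combineV (K v) (b v) (b' v) := by
  unfold LatticeID.combineV; dsimp only; fun_prop

/-- The system parameter and the public key of the simulated attack. -/
def viewV (K desc As : Val) : Val :=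
  .pair desc (.pair (outZ K (fma K (load K As.fst) (invV K (load K As.snd.fst)) (.num 0)))
    (outZ K (fma K (load K As.snd.snd.fst) (invV K (load K As.snd.fst)) (.num 0))))

/-- The solver of the ring-SIS problem. -/
def solverV (un x : Val) : PMF Val :=
  (V.run un.toList.length (.pair x.fst (.num 0))).bind fun p =>
  (𝒜.first.run un.toList.length (viewV (mkCtx un p.fst) x.fst x.snd)).bind fun w₁ =>
  (sampleL un w₁.snd).bind fun l =>
  (branchV 𝒜 un w₁ l).bind fun b =>
  (branchV 𝒜 un w₁ l).bind fun b' =>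
  PMF.pure (combineV (mkCtx un p.fst) b b')

theorem exists_solver : ∃ S : PPT, ∀ n x, S.run n x = solverV V 𝒜 (unary n) x := by
  have : PP fun v => solverV V 𝒜 v.fst v.snd := by
    unfold solverV
    refine PP.bind (PPT.pp_run _ (by fun_prop) (by fun_prop)) ?_
    refine PP.bind (PPT.pp_run _ (by fun_prop) (by unfold viewV; fun_prop)) ?_
    refine PP.bind (PP.sampleL (by fun_prop) (by fun_prop)) ?_
    refine PP.bind (PP.branchV 𝒜 (by fun_prop) (by fun_prop) (by fun_prop)) ?_
    refine PP.bind (PP.branchV 𝒜 (by fun_prop) (by fun_prop) (by fun_prop)) ?_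
    change FP _
    fun_prop
  exact PPT.exists_of_pp this

/-- The solver that answers `(q, 0, 0)`. -/
theorem exists_trivial_solver : ∃ S : PPT, ∀ n x, S.run n x =
    (V.run n (.pair x.fst (.num 0))).bind fun p =>
      PMF.pure (.pair (.pair p.fst (.num 0)) (.num 0)) := by
  have : PP fun v => (V.run v.fst.toList.length (.pair v.snd.fst (.num 0))).bind fun p =>
      PMF.pure (.pair (.pair p.fst (.num 0)) (.num 0)) := by
    refine PP.bind (PPT.pp_run _ (by fun_prop) (by fun_prop)) ?_
    change FP _
    fun_prop
  obtain ⟨S, hS⟩ := PPT.exists_of_pp this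
  exact ⟨S, fun n x => by rw [hS]; simp⟩

end Programs

/-! ### The success probability of an attack on a given key -/

section Success

theorem ind_congr {Q R : Prop} (h : Q ↔ R) : ind Q = ind R := by rw [propext h]

theorem expect_iid_cast {α : Type*} (p : PMF α) {m m' : ℕ} (h : m = m') (f : (Fin m → α) → ℝ≥0∞) :
    expect (iid p m) f = expect (iid p m') fun l => f fun i => l (Fin.cast h i) := by
  subst h; rfl

theorem expect_iid_succ {α : Type*} (p : PMF α) (m : ℕ) (f : (Fin (m + 1) → α) → ℝ≥0∞) :
    expect (iid p (m + 1)) f = expect (iid p m) fun l => expect p fun a => f (Fin.cons a l) := by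
  rw [iid, expect_bind]
  simp_rw [expect_map]
  exact expect_comm _ _ _

/-- The code of a list of ring elements. -/
def encL {n m : ℕ} [NeZero n] (l : Fin m → Rz n) : Val := .ofList (List.ofFn fun i => encZ (l i))

theorem encL_cons {n m : ℕ} [NeZero n] (a : Rz n) (l : Fin m → Rz n) :
    encL (Fin.cons a l : Fin (m + 1) → Rz n) = .pair (encZ a) (encL l) := by
  unfold encL
  rw [List.ofFn_succ]
  simp [Val.ofList]

theorem encL_cast {n m m' : ℕ} [NeZero n] (h : m = m') (l : Fin m' → Rz n) :
    encL (fun i => l (Fin.cast h i)) = encL l := by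
  subst h; rfl

/-- The contribution of the attacker's keys to the aggregated key. -/
def restKey (q : ℕ) {n : ℕ} [NeZero n] (L : List Val) (l : Fin L.length → Rz n) : Rq q n :=
  ∑ i, red _ (l i) * decQ q n (L.get i)

/-- Isolates the coefficient of the honest key, which is redrawn in the forking. The function `G`
collects everything that depends on the length of the list, so that the casts between equal lengths
occur only here. -/
theorem expect_aggregate {q n : ℕ} [NeZero n] (p : PMF (Rz n)) (L : List Val) (u : Rq q n)
    (G : ℕ → Rq q n → Val → ℝ≥0∞) :
    expect (iid p (u :: L.map (decQ q n)).length) (fun l => G (u :: L.map (decQ q n)).length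
      (∑ i, red _ (l i) * (u :: L.map (decQ q n)).get i) (encL l)) =
    expect (iid p L.length) fun l => expect p fun a =>
      G (L.length + 1) (red _ a * u + restKey q L l) (.pair (encZ a) (encL l)) := by
  refine (expect_iid_succ _ _ _).trans ((expect_iid_cast p (List.length_map (decQ q n)) _).trans ?_)
  congr 1; funext l
  congr 1; funext a
  refine congr (congr (congrArg G ?_) ?_) ?_
  · rw [List.length_cons, List.length_map]
  swap
  · rw [encL_cons, encL_cast]
  refine (Fin.sum_univ_succ _).trans (congrArg₂ (· + ·) rfl ?_)
  unfold restKey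
  refine Fintype.sum_equiv (finCongr (List.length_map (decQ q n))) _ _ fun i => ?_
  simp

/-- The verifier accepts the conversation in which the attacker outputs `w₂` and `w₃`. -/
def Params.Acc (P : Params) (n : ℕ) [NeZero n] (t : ℕ) (a u : Rq (P.q n) n) (w₂ : Val) (c : Rz n)
    (w₃ : Val) : Prop :=
  P.Verify n t a u (fun j => decQ (P.q n) n (w₂.snd.toList.getD j (.num 0))) c
    (decQ (P.q n) n w₃.fst, decQ (P.q n) n w₃.snd)

/-- The probability that the attack on the honest key `u` succeeds. -/
def success (P : Params) (𝒜 : Attacker) (n : ℕ) [NeZero n] (a u : Rq (P.q n) n) : ℝ≥0∞ :=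
  expect (𝒜.first.run n (P.view n a u)) fun w₁ =>
  expect (iid (uniformOn (chalSet n)) w₁.snd.toList.length) fun l =>
  expect (uniformOn (chalSet n)) fun l₁ =>
  expect (𝒜.second.run n (.pair w₁.fst (.pair (encZ l₁) (encL l)))) fun w₂ =>
  expect (uniformOn (chalSet n)) fun c =>
  expect (𝒜.third.run n (.pair w₂.fst (encZ c))) fun w₃ =>
    ind (P.Acc n (w₁.snd.toList.length + 1) a
      (red _ l₁ * u + restKey (P.q n) w₁.snd.toList l) w₂ c w₃)

theorem success_le_one (P : Params) (𝒜 : Attacker) (n : ℕ) [NeZero n] (a u : Rq (P.q n) n) :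
    success P 𝒜 n a u ≤ 1 :=
  expect_le fun _ => expect_le fun _ => expect_le fun _ => expect_le fun _ => expect_le fun _ =>
    expect_le fun _ => ind_le_one _

theorem expect_idExp (P : Params) (𝒜 : Attacker) (n : ℕ) [NeZero n] :
    expect (idExp P 𝒜 n) (fun b => ind (b = true)) =
      expect (P.setup n) fun a => expect (gaussR n (P.σ n)) fun s₁ =>
        expect (gaussR n (P.σ n)) fun s₂ => success P 𝒜 n a (a * red _ s₁ + red _ s₂) := by
  unfold idExp Params.keyGen
  simp only [expect_bind, expect_map]
  congr 1; funext a
  congr 1; funext s₁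
  congr 1; funext s₂
  unfold success
  congr 1; funext w₁
  rw [← expect_aggregate (uniformOn (chalSet n)) w₁.snd.toList (a * red _ s₁ + red _ s₂)
    fun t ubar e => expect (𝒜.second.run n (.pair w₁.fst e)) fun w₂ =>
      expect (uniformOn (chalSet n)) fun c =>
        expect (𝒜.third.run n (.pair w₂.fst (encZ c))) fun w₃ => ind (P.Acc n t a ubar w₂ c w₃)]
  congr 1; funext l
  congr 1; funext w₂
  congr 1; funext c
  congr 1; funext w₃
  exact ind_congr (@decide_eq_true_iff _ (Classical.propDecidable _))

variable {k : ℕ}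

theorem sum_pair_keys {q n : ℕ} [NeZero n] (B : Rq q n) (w l : Val) (l₁ : Rz n)
    (f : Fin w.toList.length → Rz n) (hl : l = encL f) :
    ∑ i : Fin (Val.pair (encQ B) w).toList.length,
      decQ q n ((Val.pair (encZ l₁) l).toList.getD i (.num 0)) *
        decQ q n ((Val.pair (encQ B) w).toList.get i) =
    red _ l₁ * B + restKey q w.toList f := by
  subst hl
  change ∑ i : Fin (w.toList.length + 1), decQ q n ((encZ l₁ :: (encL f).toList).getD i (.num 0)) *
    decQ q n ((encQ B :: w.toList).get i) = _
  rw [Fin.sum_univ_succ]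
  unfold restKey
  congr 1
  · simp [decQ_encZ, decQ_encQ]
  · refine Finset.sum_congr rfl fun i _ => ?_
    simp [encL, decQ_encZ]

theorem expect_attackV (P : Params) (V : PPT) (𝒜 : Attacker)
    (hV : ∀ t : ℕ, V.run (2 ^ k) (.pair (P.desc (2 ^ k)) (.num t)) = PMF.pure (.ofList
      [.num (P.q (2 ^ k)), .num (P.μ (2 ^ k)), .num ⌊P.eta (2 ^ k) t⌋]))
    (hq : P.q (2 ^ k) % 2 = 1) (hq3 : 3 ≤ P.q (2 ^ k)) (a u : Rq (P.q (2 ^ k)) (2 ^ k)) :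
    expect (attackV V 𝒜 (unary (2 ^ k)) (P.view (2 ^ k) a u)) (fun w => ind (w.toInt = 1)) =
      success P 𝒜 (2 ^ k) a u := by
  unfold attackV success
  simp only [expect_bind, expect_pure, toList_unary, List.length_replicate]
  congr 1; funext w₁
  have h1 : lenV w₁.snd + .num 1 = .num ((w₁.snd.toList.length + 1 : ℕ) : ℤ) := by
    rw [lenV_eq]; push_cast; rfl
  have h2 : (P.view (2 ^ k) a u).fst = P.desc (2 ^ k) := rfl
  rw [h1, h2, hV, expect_pure, sampleL_eq, expect_map]
  congr 1; funext l
  rw [sampleC_eq, expect_map]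
  congr 1; funext l₁
  congr 1; funext w₂
  rw [expect_map]
  congr 1; funext c
  congr 1; funext w₃
  refine ind_congr ?_
  have h3 : (P.view (2 ^ k) a u).snd.fst = encQ a := rfl
  have h4 : (P.view (2 ^ k) a u).snd.snd = encQ u := rfl
  simp only [Val.ofList, Val.fst_pair, Val.snd_pair]
  rw [h3, h4, mkCtx_eq, load_eq hq, decQ_encQ, verV_eq hq hq3, 
    sum_pair_keys u w₁.snd (.ofList (List.ofFn fun i => encZ (l i))) l₁ l rfl, decQ_encZ]
  simp [Params.Acc, Params.Verify]

theorem expect_lweReal {P : Params} {D : PPT} {n : ℕ} [NeZero n]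
    {f : Rq (P.q n) n → Rq (P.q n) n → ℝ≥0∞}
    (hD : ∀ a u, expect (D.run n (P.view n a u)) (fun w => ind (w.toInt = 1)) = f a u) :
    expect (lweReal P D n) (fun b => ind (b = true)) =
      expect (uniformOn (Set.univ : Set (Rq (P.q n) n))) fun a =>
        expect (gaussR n (P.σ n)) fun s => expect (gaussR n (P.σ n)) fun e =>
          f a (a * red _ s + red _ e) := by
  unfold lweReal
  simp only [expect_bind, expect_map, decide_eq_true_eq]
  -- The ring-LWE experiment draws `s` before `a`, key generation draws it after `a`.
  rw [expect_comm]
  congr 1; funext a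
  congr 1; funext s
  congr 1; funext e
  exact hD _ _

theorem expect_lweIdeal {P : Params} {D : PPT} {n : ℕ} [NeZero n]
    {f : Rq (P.q n) n → Rq (P.q n) n → ℝ≥0∞}
    (hD : ∀ a u, expect (D.run n (P.view n a u)) (fun w => ind (w.toInt = 1)) = f a u) :
    expect (lweIdeal P D n) (fun b => ind (b = true)) =
      expect (uniformOn (Set.univ : Set (Rq (P.q n) n))) fun a =>
        expect (uniformOn (Set.univ : Set (Rq (P.q n) n))) fun u => f a u := by
  unfold lweIdeal
  simp only [expect_bind, expect_map, decide_eq_true_eq]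
  congr 1; funext a
  congr 1; funext u
  exact hD _ _

/-- Conditioning on an event. -/
theorem expect_ind_mul_eq {α : Type*} [Inhabited α] [Finite α] {Q : α → Prop} (hQ : ∃ a, Q a)
    (f : α → ℝ≥0∞) : expect (uniformOn (Set.univ : Set α)) (fun a => ind (Q a) * f a) =
      expect (uniformOn (Set.univ : Set α)) (fun a => ind (Q a)) *
        expect (uniformOn {a | Q a}) f := by
  rw [expect_uniformOn_ind (Set.toFinite _) Set.univ_nonempty]
  unfold expect
  rw [← ENNReal.tsum_mul_left]
  refine tsum_congr fun a => ?_
  simp only [Set.mem_univ, true_and]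
  rw [uniformOn_apply (Set.toFinite _) Set.univ_nonempty, uniformOn_apply (Set.toFinite {a | Q a}) hQ,
    ind_of (Set.mem_univ a), one_mul]
  have h0 : (({a | Q a} : Set α).ncard : ℝ≥0∞) ≠ 0 := by
    rw [Nat.cast_ne_zero]
    exact (Set.ncard_pos (Set.toFinite _)).2 hQ |>.ne'
  have hi : ind (a ∈ {a | Q a}) = ind (Q a) := rfl
  rw [hi]
  calc _ = ((Set.univ : Set α).ncard : ℝ≥0∞)⁻¹ * ind (Q a) * f a *
        ((({a | Q a} : Set α).ncard : ℝ≥0∞) * (({a | Q a} : Set α).ncard : ℝ≥0∞)⁻¹) := by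
        rw [ENNReal.mul_inv_cancel h0 (by simp)]; ring
    _ = _ := by ring

theorem half_le_expect_isUnit {q : ℕ} [Fact q.Prime] (hq : q % 8 = 3) (hk : 2 ≤ k) :
    1 / 2 ≤ expect (uniformOn (Set.univ : Set (Rq q (2 ^ k)))) fun u => ind (IsUnit u) := by
  have h := expect_ind_not (uniformOn (Set.univ : Set (Rq q (2 ^ k)))) fun u => IsUnit u
  rw [← ENNReal.sub_sub_cancel ENNReal.one_ne_top (expect_le fun u => ind_le_one (IsUnit u)), ← h]
  have h1 : expect (uniformOn (Set.univ : Set (Rq q (2 ^ k)))) (fun u => ind (¬IsUnit u)) ≤ 1 / 2 := by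
    refine (expect_not_isUnit_le hq hk).trans ?_
    calc (2 * (1 / 2) ^ 2 ^ (k - 1) : ℝ≥0∞) ≤ 2 * (1 / 2) ^ 2 := by
          have hh : (1 / 2 : ℝ≥0∞) ≤ 1 := by simp
          exact mul_le_mul_right (pow_le_pow_right_of_le_one' hh
            (Nat.le_self_pow (n := k - 1) (by omega) 2)) 2
      _ = 1 / 2 := by
          rw [sq, ← mul_assoc, one_div, ENNReal.mul_inv_cancel (by simp) (by simp), one_mul]
  refine le_trans (le_of_eq ?_) (tsub_le_tsub_left h1 1)
  rw [one_div, ENNReal.one_sub_inv_two]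

/-- At least half of `R_q` consists of units, so conditioning on a unit at most doubles an
expectation. -/
theorem expect_units_le {q : ℕ} [Fact q.Prime] (hq : q % 8 = 3) (hk : 2 ≤ k)
    (f : Rq q (2 ^ k) → ℝ≥0∞) :
    expect (uniformOn {a : Rq q (2 ^ k) | IsUnit a}) f ≤
      2 * expect (uniformOn (Set.univ : Set (Rq q (2 ^ k)))) f := by
  have h1 : 1 / 2 * expect (uniformOn {a : Rq q (2 ^ k) | IsUnit a}) f ≤
      expect (uniformOn (Set.univ : Set (Rq q (2 ^ k)))) f := by
    calc _ ≤ _ := mul_le_mul_left (half_le_expect_isUnit hq hk) _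
      _ = _ := (expect_ind_mul_eq (Q := fun a : Rq q (2 ^ k) => IsUnit a) ⟨1, isUnit_one⟩ f).symm
      _ ≤ _ := expect_mono fun a => mul_le_of_le_one_left zero_le (ind_le_one _)
  calc _ = 2 * (1 / 2 * expect (uniformOn {a : Rq q (2 ^ k) | IsUnit a}) f) := by
        rw [← mul_assoc, one_div, ENNReal.mul_inv_cancel (by simp) (by simp), one_mul]
    _ ≤ _ := by gcongr

end Success

/-! ### Forking -/

section Forking

/-- A conversation after the first move of the attacker, with responses to two challenges. -/
structure Branch (n : ℕ) where
  l : Rz n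
  w : Val
  c : Rz n
  z : Val
  c' : Rz n
  z' : Val

/-- A random conversation. -/
def branch (𝒜 : Attacker) (n : ℕ) [NeZero n] (w₁ e : Val) : PMF (Branch n) :=
  (uniformOn (chalSet n)).bind fun l =>
  (𝒜.second.run n (.pair w₁.fst (.pair (encZ l) e))).bind fun w =>
  (uniformOn (chalSet n)).bind fun c =>
  (𝒜.third.run n (.pair w.fst (encZ c))).bind fun z =>
  (uniformOn (chalSet n)).bind fun c' =>
  (𝒜.third.run n (.pair w.fst (encZ c'))).map fun z' => ⟨l, w, c, z, c', z'⟩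

def encBranch {n : ℕ} [NeZero n] (b : Branch n) : Val :=
  .pair (encZ b.l) (.pair (.pair (encZ b.c) b.z) (.pair (encZ b.c') b.z'))

variable {𝒜 : Attacker} {k : ℕ} {w₁ e : Val}

theorem branchV_eq : branchV 𝒜 (unary (2 ^ k)) w₁ e = (branch 𝒜 (2 ^ k) w₁ e).map encBranch := by
  unfold branchV branch
  simp only [sampleC_eq, toList_unary, List.length_replicate, PMF.bind_map, PMF.map_bind,
    PMF.map_comp]
  rfl

theorem expect_branch {n : ℕ} [NeZero n] (f : Branch n → ℝ≥0∞) :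
    expect (branch 𝒜 n w₁ e) f =
      expect (uniformOn (chalSet n)) fun l =>
      expect (𝒜.second.run n (.pair w₁.fst (.pair (encZ l) e))) fun w =>
      expect (uniformOn (chalSet n)) fun c =>
      expect (𝒜.third.run n (.pair w.fst (encZ c))) fun z =>
      expect (uniformOn (chalSet n)) fun c' =>
      expect (𝒜.third.run n (.pair w.fst (encZ c'))) fun z' => f ⟨l, w, c, z, c', z'⟩ := by
  unfold branch
  simp only [expect_bind, expect_map]

theorem expect_branch_l {n : ℕ} [NeZero n] (f : Rz n → ℝ≥0∞) :
    expect (branch 𝒜 n w₁ e) (fun b => f b.l) = expect (uniformOn (chalSet n)) f := by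
  simp only [expect_branch, expect_const]

theorem expect_branch_c {n : ℕ} [NeZero n] (f : Rz n → ℝ≥0∞) :
    expect (branch 𝒜 n w₁ e) (fun b => f b.c) = expect (uniformOn (chalSet n)) f := by
  simp only [expect_branch, expect_const]

theorem expect_branch_c' {n : ℕ} [NeZero n] (f : Rz n → ℝ≥0∞) :
    expect (branch 𝒜 n w₁ e) (fun b => f b.c') = expect (uniformOn (chalSet n)) f := by
  simp only [expect_branch, expect_const]

theorem expect_branch_eq_le (hk : 1 ≤ k) :
    expect (branch 𝒜 (2 ^ k) w₁ e) (fun b => ind (b.c = b.c')) ≤ (1 / 2) ^ 2 ^ (k - 1) := by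
  rw [expect_branch]
  refine expect_le fun l => expect_le fun w => expect_le fun c => expect_le fun z => ?_
  simp only [expect_const]
  exact expect_chal_eq_le hk c

theorem mem_chalSet_of_mem_support {b : Branch (2 ^ k)}
    (hb : b ∈ (branch 𝒜 (2 ^ k) w₁ e).support) :
    b.l ∈ chalSet (2 ^ k) ∧ b.c ∈ chalSet (2 ^ k) ∧ b.c' ∈ chalSet (2 ^ k) := by
  unfold branch at hb
  simp only [PMF.mem_support_bind_iff, PMF.mem_support_map_iff] at hb
  obtain ⟨l, hl, w, -, c, hc, z, -, c', hc', z', -, rfl⟩ := hb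
  have h := fun {x : Rz (2 ^ k)} =>
    mem_of_mem_support_uniformOn (finite_chalSet k) (nonempty_chalSet k) (a := x)
  exact ⟨h hl, h hc, h hc'⟩

/-- Both conversations of a branch are accepted. -/
def Params.Acc₂ (P : Params) {n : ℕ} [NeZero n] (t : ℕ) (a u r : Rq (P.q n) n) (b : Branch n) : Prop :=
  P.Acc n t a (red _ b.l * u + r) b.w b.c b.z ∧ P.Acc n t a (red _ b.l * u + r) b.w b.c' b.z'

/-- Jensen's inequality is applied level by level, and a square of an expectation is that of two
independent copies. The first squaring duplicates the challenge together with the third move. The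
second one duplicates everything after `λ₂, ..., λ_t`. Hence the exponent 4 and the four
conversations. -/
theorem success_pow_le (P : Params) (n : ℕ) [NeZero n] (a u : Rq (P.q n) n) :
    success P 𝒜 n a u ^ 4 ≤
      expect (𝒜.first.run n (P.view n a u)) fun w₁ =>
      expect (iid (uniformOn (chalSet n)) w₁.snd.toList.length) fun l =>
      expect (branch 𝒜 n w₁ (encL l)) fun b => expect (branch 𝒜 n w₁ (encL l)) fun b' =>
        ind (P.Acc₂ (w₁.snd.toList.length + 1) a u (restKey (P.q n) w₁.snd.toList l) b ∧
          P.Acc₂ (w₁.snd.toList.length + 1) a u (restKey (P.q n) w₁.snd.toList l) b') := by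
  have h1 : ∀ (w₁ : Val) (l : Fin w₁.snd.toList.length → Rz n),
      (expect (uniformOn (chalSet n)) fun l₁ =>
      expect (𝒜.second.run n (.pair w₁.fst (.pair (encZ l₁) (encL l)))) fun w₂ =>
      expect (uniformOn (chalSet n)) fun c =>
      expect (𝒜.third.run n (.pair w₂.fst (encZ c))) fun w₃ =>
        ind (P.Acc n (w₁.snd.toList.length + 1) a
          (red _ l₁ * u + restKey (P.q n) w₁.snd.toList l) w₂ c w₃)) ^ 2 ≤
      expect (branch 𝒜 n w₁ (encL l)) fun b =>
        ind (P.Acc₂ (w₁.snd.toList.length + 1) a u (restKey (P.q n) w₁.snd.toList l) b) := by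
    intro w₁ l
    rw [expect_branch]
    refine (sq_expect_le _ _ fun _ => expect_le fun _ => expect_le fun _ => expect_le fun _ =>
      ind_le_one _).trans (expect_mono fun l₁ => ?_)
    refine (sq_expect_le _ _ fun _ => expect_le fun _ => expect_le fun _ =>
      ind_le_one _).trans (expect_mono fun w₂ => ?_)
    unfold Params.Acc₂
    simp only [ind_and]
    rw [sq, ← expect_mul_const]
    refine expect_mono fun c => ?_
    rw [← expect_mul_const]
    refine expect_mono fun z => ?_
    rw [← expect_const_mul]
    refine expect_mono fun c' => ?_
    rw [← expect_const_mul]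
  have h2 : success P 𝒜 n a u ^ 2 ≤
      expect (𝒜.first.run n (P.view n a u)) fun w₁ =>
      expect (iid (uniformOn (chalSet n)) w₁.snd.toList.length) fun l =>
      expect (branch 𝒜 n w₁ (encL l)) fun b =>
        ind (P.Acc₂ (w₁.snd.toList.length + 1) a u (restKey (P.q n) w₁.snd.toList l) b) := by
    refine (sq_expect_le _ _ fun _ => expect_le fun _ => expect_le fun _ => expect_le fun _ =>
      expect_le fun _ => expect_le fun _ => ind_le_one _).trans (expect_mono fun w₁ => ?_)
    exact (sq_expect_le _ _ fun _ => expect_le fun _ => expect_le fun _ =>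
      expect_le fun _ => expect_le fun _ => ind_le_one _).trans (expect_mono fun l => h1 w₁ l)
  calc success P 𝒜 n a u ^ 4 = (success P 𝒜 n a u ^ 2) ^ 2 := by rw [← pow_mul]
    _ ≤ _ := pow_le_pow_left' h2 2
    _ ≤ _ := by
      refine (sq_expect_le _ _ fun _ => expect_le fun _ => expect_le fun _ =>
        ind_le_one _).trans (expect_mono fun w₁ => ?_)
      refine (sq_expect_le _ _ fun _ => expect_le fun _ =>
        ind_le_one _).trans (expect_mono fun l => ?_)
      simp only [ind_and]
      rw [sq, ← expect_mul_const]
      refine expect_mono fun b => ?_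
      rw [← expect_const_mul]

/-- The small lift of a response. -/
def resp (q n : ℕ) [NeZero n] (z : Val) : Rz n := liftQ (decQ q n z)

/-- The solution of the ring-SIS problem that is extracted from two branches. -/
def extract (q : ℕ) {n : ℕ} [NeZero n] (b b' : Branch n) : Fin 3 → Rz n :=
  ![(resp q n b.z.fst - resp q n b.z'.fst) * (b'.c - b'.c') -
      (resp q n b'.z.fst - resp q n b'.z'.fst) * (b.c - b.c'),
    (resp q n b.z.snd - resp q n b.z'.snd) * (b'.c - b'.c') -
      (resp q n b'.z.snd - resp q n b'.z'.snd) * (b.c - b.c'),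
    (b'.l - b.l) * ((b.c - b.c') * (b'.c - b'.c'))]

/-- Within a branch the difference of the two verification equations eliminates the commitment.
Multiplied by the difference of the challenges of the other branch, both results contain the same
multiple of `r`, the share of the other keys, and it cancels in their difference. -/
theorem extract_relation (P : Params) {n : ℕ} [NeZero n] {t : ℕ} {a u r : Rq (P.q n) n}
    {b b' : Branch n} (h : P.Acc₂ t a u r b) (h' : P.Acc₂ t a u r b') :
    a * red _ (extract (P.q n) b b' 0) + red _ (extract (P.q n) b b' 1) +
      u * red _ (extract (P.q n) b b' 2) = 0 := by
  obtain ⟨⟨h1, -, -⟩, h2, -, -⟩ := h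
  obtain ⟨⟨h3, -, -⟩, h4, -, -⟩ := h'
  simp only [extract, resp, Matrix.cons_val_zero, Matrix.cons_val_one, Matrix.cons_val_two,
    Matrix.tail_cons, Matrix.head_cons, map_sub, map_mul, red_liftQ]
  have h12 := h1.symm.trans h2
  have h34 := h3.symm.trans h4
  linear_combination (red _ b'.c - red _ b'.c') * h12 - (red _ b.c - red _ b.c') * h34

theorem normLe_of_mem_chalSet {c : Rz (2 ^ k)} (hc : c ∈ chalSet (2 ^ k)) : NormLe c k := by
  have := hc.1
  rwa [lg_two_pow] at this

/-- The coefficients of `c - d` are at most `2k < q/2` in absolute value, so `c - d` remains nonzero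
modulo `q`; its degree is less than `n/2`. -/
theorem isUnit_red_sub {q : ℕ} [Fact q.Prime] (hq : q % 8 = 3) (hk : 2 ≤ k) (hkq : 4 * k < q)
    {c d : Rz (2 ^ k)} (hc : c ∈ chalSet (2 ^ k)) (hd : d ∈ chalSet (2 ^ k)) (hcd : c ≠ d) :
    IsUnit (red q (c - d)) := by
  obtain ⟨j, rfl⟩ := Nat.exists_eq_add_of_le' hk
  refine isUnit_of_coeffs hq j (fun h0 => hcd ?_) fun i hi => ?_
  · have h1 := liftQ_red (q := q) ((normLe_of_mem_chalSet hc).sub (normLe_of_mem_chalSet hd))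
      (by have : ((4 * (j + 2) : ℕ) : ℝ) < q := by exact_mod_cast hkq
          push_cast at this ⊢; linarith)
    rw [h0] at h1
    rw [← sub_eq_zero, ← h1]
    apply coeffs_injective
    funext i
    rw [coeffs_liftQ]; simp
  · have h2 : 2 ^ (j + 2) ≤ 2 * (i : ℕ) := by
      have h3 : 2 ^ (j + 2) = 2 * 2 ^ (j + 1) := by ring
      omega
    rw [coeffs_red, coeffs_sub, hc.2 i h2, hd.2 i h2]
    simp

/-- Modulo `q` the third component is a product of three units. -/
theorem extract_ne_zero {q : ℕ} [Fact q.Prime] (hq : q % 8 = 3) (hk : 2 ≤ k) (hkq : 4 * k < q)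
    {b b' : Branch (2 ^ k)}
    (hb : b.l ∈ chalSet (2 ^ k) ∧ b.c ∈ chalSet (2 ^ k) ∧ b.c' ∈ chalSet (2 ^ k))
    (hb' : b'.l ∈ chalSet (2 ^ k) ∧ b'.c ∈ chalSet (2 ^ k) ∧ b'.c' ∈ chalSet (2 ^ k))
    (h1 : b.l ≠ b'.l) (h2 : b.c ≠ b.c') (h3 : b'.c ≠ b'.c') : extract q b b' ≠ 0 := by
  intro h0
  have h4 := congrArg (red q) (congrFun h0 2)
  have h5 : IsUnit (red q ((b'.l - b.l) * ((b.c - b.c') * (b'.c - b'.c')))) := by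
    rw [map_mul, map_mul]
    exact (isUnit_red_sub hq hk hkq hb'.1 hb.1 h1.symm).mul
      ((isUnit_red_sub hq hk hkq hb.2.1 hb.2.2 h2).mul (isUnit_red_sub hq hk hkq hb'.2.1 hb'.2.2 h3))
  have h6 : Nontrivial (Rq q (2 ^ k)) := by
    rw [← Finite.one_lt_card_iff_nontrivial, card_Rq]
    exact Nat.one_lt_pow (by positivity) (Fact.out : q.Prime).one_lt
  have h7 : extract q b b' 2 = (b'.l - b.l) * ((b.c - b.c') * (b'.c - b'.c')) := rfl
  rw [h7, Pi.zero_apply, map_zero] at h4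
  rw [h4] at h5
  exact not_isUnit_zero h5

/-- The product of `g` and `d` is large, although `g` is small. -/
def badProd {n : ℕ} [NeZero n] (G T : ℝ) (g d : Rz n) : ℝ≥0∞ :=
  ind (NormLe g G ∧ ¬NormLe (g * d) T)

/-- The products that occur in the extraction for the responses selected by `f`. -/
def badSum {n : ℕ} [NeZero n] (G T : ℝ) (f : Val → Rz n) (b b' : Branch n) : ℝ≥0∞ :=
  badProd G T (f b.z - f b.z') b'.c + badProd G T (f b.z - f b.z') b'.c' +
    (badProd G T (f b'.z - f b'.z') b.c + badProd G T (f b'.z - f b'.z') b.c')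

theorem ind_not_normLe_le {n : ℕ} [NeZero n] {G T : ℝ} {f : Val → Rz n} {b b' : Branch n}
    (h1 : NormLe (f b.z) (G / 2)) (h2 : NormLe (f b.z') (G / 2)) (h3 : NormLe (f b'.z) (G / 2))
    (h4 : NormLe (f b'.z') (G / 2)) :
    ind (¬NormLe ((f b.z - f b.z') * (b'.c - b'.c') - (f b'.z - f b'.z') * (b.c - b.c')) (4 * T)) ≤
      badSum G T f b b' := by
  unfold badSum badProd
  refine le_trans (ind_mono fun h => ?_) ((ind_or_le _ _).trans
    (add_le_add (ind_or_le _ _) (ind_or_le _ _)))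
  by_contra! hc
  obtain ⟨⟨c1, c2⟩, c3, c4⟩ := hc
  have g1 := (h1.sub h2).mono (show G / 2 + G / 2 ≤ G by linarith)
  have g2 := (h3.sub h4).mono (show G / 2 + G / 2 ≤ G by linarith)
  refine h ?_
  rw [mul_sub, mul_sub]
  exact (((c1 g1).sub (c2 g1)).sub ((c3 g2).sub (c4 g2))).mono (by linarith)

theorem expect_badProd_le (hk : 1 ≤ k) {G T : ℝ} (hG : 0 < G)
    (hT : T = G * Real.sqrt (2 ^ k) * k ^ 2) (g : Rz (2 ^ k)) :
    expect (uniformOn (chalSet (2 ^ k))) (badProd G T g) ≤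
      2 * ((2 ^ k : ℕ) * ENNReal.ofReal (Real.exp (-(1 / 2 * (k : ℝ) ^ 2)))) := by
  unfold badProd
  by_cases hg : NormLe g G
  swap
  · refine (expect_le fun d => ?_).trans zero_le
    rw [ind_of_not fun h => hg h.1]
  have hk' : (0 : ℝ) < k := by exact_mod_cast hk
  refine (expect_mono fun d => ind_mono And.right).trans ?_
  rw [chalSet_eq]
  refine (expect_mul_tail _ (K := k) (fun i => by exact_mod_cast chalBound_le k i) hk'
    hG (by rw [hT]; positivity) hg).trans (le_of_eq ?_)
  have : -T ^ 2 / (2 * (((2 ^ k : ℕ) : ℝ) * (G * k) ^ 2)) = -(1 / 2 * (k : ℝ) ^ 2) := by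
    rw [hT, cast_two_pow, mul_pow, mul_pow, Real.sq_sqrt (by positivity)]
    field_simp
  rw [this, ENNReal.ofReal_mul (by norm_num)]
  simp only [ENNReal.ofReal_ofNat]
  ring

/-- Responses depend on the challenges of their own branch, but each product pairs responses of one
branch with a challenge of the other. Once the former branch is fixed, that challenge is uniform. -/
theorem expect_badSum_le {δ : ℝ≥0∞} {G T : ℝ}
    (h : ∀ g, expect (uniformOn (chalSet (2 ^ k))) (badProd G T g) ≤ δ) (f : Val → Rz (2 ^ k)) :
    (expect (branch 𝒜 (2 ^ k) w₁ e) fun b => expect (branch 𝒜 (2 ^ k) w₁ e) fun b' =>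
      badSum G T f b b') ≤ 4 * δ := by
  unfold badSum
  simp only [expect_add]
  have h1 : ∀ b : Branch (2 ^ k), expect (branch 𝒜 (2 ^ k) w₁ e) (fun b' =>
      badProd G T (f b.z - f b.z') b'.c) ≤ δ := fun b => by
    rw [expect_branch_c (f := badProd G T (f b.z - f b.z'))]; exact h _
  have h2 : ∀ b : Branch (2 ^ k), expect (branch 𝒜 (2 ^ k) w₁ e) (fun b' =>
      badProd G T (f b.z - f b.z') b'.c') ≤ δ := fun b => by
    rw [expect_branch_c' (f := badProd G T (f b.z - f b.z'))]; exact h _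
  calc _ ≤ δ + δ + (δ + δ) := by
        refine add_le_add (add_le_add (expect_le h1) (expect_le h2)) (add_le_add ?_ ?_)
        · rw [expect_comm]; exact expect_le h1
        · rw [expect_comm]; exact expect_le h2
    _ = 4 * δ := by ring

/-- A short nonzero relation between `a`, `1` and `u`. -/
def ShortRelation {q n : ℕ} [NeZero n] (β : ℝ) (a u : Rq q n) (t : Fin 3 → Rz n) : Prop :=
  t ≠ 0 ∧ (∀ i, NormLe (t i) β) ∧ a * red _ (t 0) + red _ (t 1) + u * red _ (t 2) = 0

/-- Four accepted conversations yield a short relation, with few exceptions. -/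
theorem expect_fork_le (P : Params) [Fact (P.q (2 ^ k)).Prime] (hq : P.q (2 ^ k) % 8 = 3)
    (hk : 2 ≤ k) (hkq : 4 * k < P.q (2 ^ k)) {t : ℕ} (hη : 0 < P.eta (2 ^ k) t) {β : ℝ}
    (hβ : 8 * P.eta (2 ^ k) t * Real.sqrt (2 ^ k) * k ^ 2 ≤ β)
    (hβ' : 8 * (2 ^ k) ^ 2 * (k : ℝ) ^ 3 ≤ β) (a u r : Rq (P.q (2 ^ k)) (2 ^ k)) :
    (expect (branch 𝒜 (2 ^ k) w₁ e) fun b => expect (branch 𝒜 (2 ^ k) w₁ e) fun b' =>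
      ind (P.Acc₂ t a u r b ∧ P.Acc₂ t a u r b')) ≤
    (expect (branch 𝒜 (2 ^ k) w₁ e) fun b => expect (branch 𝒜 (2 ^ k) w₁ e) fun b' =>
      ind (ShortRelation β a u (extract (P.q (2 ^ k)) b b'))) +
    (3 * (1 / 2) ^ 2 ^ (k - 1) +
      16 * ((2 ^ k : ℕ) * ENNReal.ofReal (Real.exp (-(1 / 2 * (k : ℝ) ^ 2))))) := by
  set G := 2 * P.eta (2 ^ k) t with hG
  set T := G * Real.sqrt (2 ^ k) * k ^ 2 with hT
  set f₁ : Val → Rz (2 ^ k) := fun z => resp (P.q (2 ^ k)) (2 ^ k) z.fst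
  set f₂ : Val → Rz (2 ^ k) := fun z => resp (P.q (2 ^ k)) (2 ^ k) z.snd
  have hn : ∀ {b b' : Branch (2 ^ k)}, P.Acc₂ t a u r b → P.Acc₂ t a u r b' →
      ∀ f, f = f₁ ∨ f = f₂ → NormLe (f b.z) (G / 2) ∧ NormLe (f b.z') (G / 2) ∧
        NormLe (f b'.z) (G / 2) ∧ NormLe (f b'.z') (G / 2) := by
    rintro b b' ⟨⟨-, h1, h1'⟩, -, h2, h2'⟩ ⟨⟨-, h3, h3'⟩, -, h4, h4'⟩ f hf
    rw [hG, mul_div_cancel_left₀ _ two_ne_zero]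
    rcases hf with rfl | rfl
    · exact ⟨normLe_liftQ.2 h1, normLe_liftQ.2 h2, normLe_liftQ.2 h3, normLe_liftQ.2 h4⟩
    · exact ⟨normLe_liftQ.2 h1', normLe_liftQ.2 h2', normLe_liftQ.2 h3', normLe_liftQ.2 h4'⟩
  have step : ∀ b ∈ (branch 𝒜 (2 ^ k) w₁ e).support, ∀ b' ∈ (branch 𝒜 (2 ^ k) w₁ e).support,
      ind (P.Acc₂ t a u r b ∧ P.Acc₂ t a u r b') ≤
      ind (ShortRelation β a u (extract (P.q (2 ^ k)) b b')) +
        ((ind (b.l = b'.l) + (ind (b.c = b.c') + ind (b'.c = b'.c'))) +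
          (badSum G T f₁ b b' + badSum G T f₂ b b')) := by
    intro b hb b' hb'
    by_cases hA : P.Acc₂ t a u r b ∧ P.Acc₂ t a u r b'
    swap
    · rw [ind_of_not hA]; exact zero_le
    have m := mem_chalSet_of_mem_support hb
    have m' := mem_chalSet_of_mem_support hb'
    obtain ⟨n1, n2, n3, n4⟩ := hn hA.1 hA.2 f₁ (.inl rfl)
    obtain ⟨n1', n2', n3', n4'⟩ := hn hA.1 hA.2 f₂ (.inr rfl)
    refine le_trans (ind_mono (fun _ => ?_)) ((ind_or_le _ _).trans (add_le_add le_rfl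
      ((ind_or_le _ _).trans (add_le_add ((ind_or_le _ _).trans (add_le_add le_rfl
      (ind_or_le _ _))) ((ind_or_le _ _).trans (add_le_add
      (ind_not_normLe_le (f := f₁) (T := T) n1 n2 n3 n4)
      (ind_not_normLe_le (f := f₂) (T := T) n1' n2' n3' n4')))))))
    by_contra! hc
    obtain ⟨c0, ⟨c1, c2, c3⟩, c4, c5⟩ := hc
    -- Each of the first two components is a combination of four products bounded by `T = 2 η_t √n
    -- log² n`.
    have hTβ : 4 * T ≤ β := by rw [hT, hG]; linarith
    refine c0 ⟨extract_ne_zero hq hk hkq m m' c1 c2 c3, fun i => ?_, extract_relation P hA.1 hA.2⟩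
    have hs : ∀ {c d : Rz (2 ^ k)}, c ∈ chalSet (2 ^ k) → d ∈ chalSet (2 ^ k) →
        NormLe (c - d) (2 * k) := fun hc hd =>
      ((normLe_of_mem_chalSet hc).sub (normLe_of_mem_chalSet hd)).mono (by linarith)
    fin_cases i
    · exact c4.mono hTβ
    · exact c5.mono hTβ
    · refine ((hs m'.1 m.1).mul ((hs m.2.1 m.2.2).mul (hs m'.2.1 m'.2.2))).mono ?_
      rw [cast_two_pow]
      refine le_trans (le_of_eq ?_) hβ'
      ring
  refine (expect_mono_support fun b hb => expect_mono_support fun b' hb' => step b hb b' hb').trans ?_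
  simp only [expect_add, expect_const]
  refine add_le_add le_rfl ?_
  have hl : (expect (branch 𝒜 (2 ^ k) w₁ e) fun b => expect (branch 𝒜 (2 ^ k) w₁ e) fun b' =>
      ind (b.l = b'.l)) ≤ (1 / 2) ^ 2 ^ (k - 1) := expect_le fun b => by
    rw [expect_branch_l (f := fun l => ind (b.l = l))]
    exact expect_chal_eq_le (by omega) b.l
  have hb := expect_badSum_le (𝒜 := 𝒜) (w₁ := w₁) (e := e)
    (expect_badProd_le (k := k) (by omega) (by rw [hG]; linarith) hT)
  -- Three possible collisions (of `λ₁` and of the challenges of either branch), and two sums of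
  -- four products with probability `2 (...)` each, which makes 16.
  refine (add_le_add (add_le_add hl (add_le_add (expect_branch_eq_le (by omega))
    (expect_branch_eq_le (by omega)))) (add_le_add (hb f₁) (hb f₂))).trans (le_of_eq ?_)
  ring

end Forking

/-! ### The solver -/

section Solver

variable {k : ℕ}

/-! ### The program that combines two branches -/

section Combine

variable {n q : ℕ} [NeZero n]

theorem outZ_val {u : Rz n} (hu : NormLe u (coeffBound n q - 1)) {Z : Val} (h0 : Z = .num Z.toInt)
    (hz : (Z.toInt : ZMod ((2 * coeffBound n q) ^ n + 1)) = kronHom n (2 * coeffBound n q) u) :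
    outZ (ctx n q) Z = encZ u := by
  rw [h0]; exact outZ_eq hu hz

theorem cast_diffV (hq : q % 2 = 1) (x y : Val) :
    (((diffV (ctx n q) x y).toInt : ℤ) : ZMod ((2 * coeffBound n q) ^ n + 1)) =
      kronHom n (2 * coeffBound n q) (resp q n x - resp q n y) := by
  have h : (diffV (ctx n q) x y).toInt =
      (load (ctx n q) x).toInt - (load (ctx n q) y).toInt := rfl
  rw [h, load_eq hq, load_eq hq, Int.cast_sub, cast_repQ, cast_repQ, map_sub]
  rfl

theorem normLe_resp_sub [NeZero q] (x y : Val) : NormLe (resp q n x - resp q n y) q :=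
  ((normLe_liftQ_half _).sub (normLe_liftQ_half _)).mono (by linarith)

/-- Ring-SIS asks for elements of `R`, so the products are formed from balanced representatives and
are not reduced modulo `q`. Challenges and coefficients `λ₁` are their own representatives because
`2B < q`. -/
theorem combineV_eq (hq : q % 2 = 1) {b b' : Branch n} {B : ℝ} (hB : 2 * B < q)
    (hb : NormLe b.l B ∧ NormLe b.c B ∧ NormLe b.c' B)
    (hb' : NormLe b'.l B ∧ NormLe b'.c B ∧ NormLe b'.c' B) :
    combineV (ctx n q) (encBranch b) (encBranch b') =
      .ofList (List.ofFn fun i => encZ (extract q b b' i)) := by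
  have : NeZero q := ⟨by omega⟩
  have hr : ∀ {c : Rz n}, NormLe c B → resp q n (encZ c) = c := fun h => by
    rw [resp, decQ_encZ, liftQ_red h hB]
  obtain ⟨h1, h2⟩ := one_le_nq n q hq
  -- The size of the base is dictated here: a product of three differences has norm at most `n² q³`,
  -- and a difference of two products at most `2 n q²`.
  have hcb : (2 : ℝ) * n ^ 2 * q ^ 3 ≤ coeffBound n q - 1 := by
    have : (1 : ℝ) ≤ n ^ 2 * q ^ 3 := one_le_mul_of_one_le_of_one_le (one_le_pow₀ h1) (one_le_pow₀ h2)
    unfold coeffBound; push_cast; nlinarith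
  have hn2 : (n : ℝ) ≤ n ^ 2 := by nlinarith
  have hq2 : (q : ℝ) ^ 2 ≤ q ^ 3 := pow_le_pow_right₀ h2 (by norm_num)
  have hT : ∀ x y x' y' : Val,
      outZ (ctx n q) (diffV (ctx n q) x y * diffV (ctx n q) (encZ b'.c) (encZ b'.c') -
        diffV (ctx n q) x' y' * diffV (ctx n q) (encZ b.c) (encZ b.c')) =
      encZ ((resp q n x - resp q n y) * (b'.c - b'.c') -
        (resp q n x' - resp q n y') * (b.c - b.c')) := by
    intro x y x' y'
    refine outZ_val ?_ rfl ?_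
    · rw [← hr hb.2.1, ← hr hb.2.2, ← hr hb'.2.1, ← hr hb'.2.2]
      refine (((normLe_resp_sub _ _).mul (normLe_resp_sub _ _)).sub
        ((normLe_resp_sub _ _).mul (normLe_resp_sub _ _))).mono (le_trans ?_ hcb)
      have : (n : ℝ) * (q ^ 2) ≤ n ^ 2 * q ^ 3 := mul_le_mul hn2 hq2 (by positivity) (by positivity)
      nlinarith
    · change (((diffV (ctx n q) x y).toInt * (diffV (ctx n q) (encZ b'.c) (encZ b'.c')).toInt -
        (diffV (ctx n q) x' y').toInt * (diffV (ctx n q) (encZ b.c) (encZ b.c')).toInt : ℤ) :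
          ZMod ((2 * coeffBound n q) ^ n + 1)) = _
      push_cast
      simp only [cast_diffV hq, hr hb.2.1, hr hb.2.2, hr hb'.2.1, hr hb'.2.2, map_sub, map_mul]
  have hT3 : outZ (ctx n q) (diffV (ctx n q) (encZ b'.l) (encZ b.l) *
      (diffV (ctx n q) (encZ b.c) (encZ b.c') * diffV (ctx n q) (encZ b'.c) (encZ b'.c'))) =
      encZ ((b'.l - b.l) * ((b.c - b.c') * (b'.c - b'.c'))) := by
    refine outZ_val ?_ rfl ?_
    · rw [← hr hb.1, ← hr hb'.1, ← hr hb.2.1, ← hr hb.2.2, ← hr hb'.2.1, ← hr hb'.2.2]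
      refine ((normLe_resp_sub _ _).mul ((normLe_resp_sub _ _).mul (normLe_resp_sub _ _))).mono
        (le_trans ?_ hcb)
      have : (0 : ℝ) ≤ n ^ 2 * q ^ 3 := by positivity
      nlinarith
    · change (((diffV (ctx n q) (encZ b'.l) (encZ b.l)).toInt *
        ((diffV (ctx n q) (encZ b.c) (encZ b.c')).toInt *
          (diffV (ctx n q) (encZ b'.c) (encZ b'.c')).toInt) : ℤ) :
          ZMod ((2 * coeffBound n q) ^ n + 1)) = _
      push_cast
      simp only [cast_diffV hq, hr hb.1, hr hb'.1, hr hb.2.1, hr hb.2.2, hr hb'.2.1, hr hb'.2.2,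
        map_sub, map_mul]
  simp only [combineV, encBranch, Val.fst_pair, Val.snd_pair, hT, hT3]
  rfl

omit [NeZero n] in
theorem expect_mul_unit {i : Rq q n} (hi : IsUnit i) [Finite (Rq q n)] (f : Rq q n → ℝ≥0∞) :
    expect (uniformOn (Set.univ : Set (Rq q n))) (fun a => f (a * i)) =
      expect (uniformOn (Set.univ : Set (Rq q n))) f := by
  have h : (uniformOn (Set.univ : Set (Rq q n))).map (fun a => a * i) = uniformOn Set.univ := by
    rw [uniformOn_map Set.finite_univ Set.univ_nonempty fun _ _ _ _ h => hi.mul_right_cancel h]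
    congr 1
    rw [Set.image_univ]
    exact Set.range_eq_univ.2 fun b => by
      obtain ⟨v, rfl⟩ := hi
      exact ⟨b * ↑v⁻¹, by simp⟩
  rw [← expect_map, h]

end Combine

/-- The probability that a short relation is extracted from a simulated attack. -/
def extraction (P : Params) (𝒜 : Attacker) (n : ℕ) [NeZero n] (β : ℝ) (a u : Rq (P.q n) n) : ℝ≥0∞ :=
  expect (𝒜.first.run n (P.view n a u)) fun w₁ =>
  expect (iid (uniformOn (chalSet n)) w₁.snd.toList.length) fun l =>
  expect (branch 𝒜 n w₁ (encL l)) fun b => expect (branch 𝒜 n w₁ (encL l)) fun b' =>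
    ind (ShortRelation β a u (extract (P.q n) b b'))

variable {P : Params} {V : PPT} {𝒜 : Attacker} {β : ℝ}

/-- A triple of ring elements is a solution of the ring-SIS problem. -/
def SISSolution {q n : ℕ} [NeZero n] (β : ℝ) (a : Fin 3 → Rq q n) (w : Val) : Prop :=
  (fun i : Fin 3 => decZ n (w.toList.getD i (.num 0))) ≠ 0 ∧
    (∀ i : Fin 3, NormLe (decZ n (w.toList.getD i (.num 0))) β) ∧
    ∑ i : Fin 3, a i * red _ (decZ n (w.toList.getD i (.num 0))) = 0

theorem expect_sisExp {n : ℕ} [NeZero n] (S : PPT) :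
    expect (sisExp P 3 β S n) (fun b => ind (b = true)) =
      expect (uniformOn (Set.univ : Set (Rq (P.q n) n))) fun a₁ =>
      expect (uniformOn (Set.univ : Set (Rq (P.q n) n))) fun a₂ =>
      expect (uniformOn (Set.univ : Set (Rq (P.q n) n))) fun a₃ =>
      expect (S.run n (.pair (P.desc n) (.ofList [encQ a₁, encQ a₂, encQ a₃])))
        fun w => ind (SISSolution β ![a₁, a₂, a₃] w) := by
  unfold sisExp
  simp only [iid, expect_bind, expect_map, expect_pure]
  congr 1; funext a₁
  congr 1; funext a₂
  congr 1; funext a₃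
  have h : (Fin.cons a₁ (Fin.cons a₂ (Fin.cons a₃ Fin.elim0)) : Fin 3 → Rq (P.q n) n) =
      ![a₁, a₂, a₃] := by
    funext i; fin_cases i <;> rfl
  rw [h]
  refine congrArg₂ _ ?_ ?_
  · simp
  · funext w
    refine ind_congr ?_
    simp only [decide_eq_true_eq]
    rfl

/-- Multiply the relation between `a₁/a₂`, `1` and `a₃/a₂` by `a₂`. -/
theorem sisSolution_of_shortRelation {q n : ℕ} [NeZero n] {a₁ a₂ a₃ i : Rq q n} (hi : i * a₂ = 1)
    {t : Fin 3 → Rz n} (h : ShortRelation β (a₁ * i) (a₃ * i) t) :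
    SISSolution β ![a₁, a₂, a₃] (.ofList (List.ofFn fun i => encZ (t i))) := by
  have hd : ∀ j : Fin 3, decZ n ((Val.ofList (List.ofFn fun i => encZ (t i))).toList.getD j (.num 0)) =
      t j := fun j => by
    rw [Val.toList_ofList]
    fin_cases j <;> simp [decZ_encZ]
  unfold SISSolution
  simp only [hd]
  refine ⟨h.1, h.2.1, ?_⟩
  rw [Fin.sum_univ_three]
  have h3 := h.2.2
  simp only [Matrix.cons_val_zero, Matrix.cons_val_one, Matrix.cons_val]
  linear_combination a₂ * h3 - (a₁ * red _ (t 0) + a₃ * red _ (t 2)) * hi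

theorem viewV_eq {q : ℕ} [Fact q.Prime] (hq : q % 8 = 3) (desc : Val) (a₁ a₂ a₃ : Rq q (2 ^ k)) :
    viewV (ctx (2 ^ k) q) desc (.ofList [encQ a₁, encQ a₂, encQ a₃]) =
      .pair desc (.pair (encQ (a₁ * a₂ ^ (q ^ 2 ^ k - 2))) (encQ (a₃ * a₂ ^ (q ^ 2 ^ k - 2)))) := by
  have hq2 : q % 2 = 1 := by omega
  have hq3 : 3 ≤ q := by omega
  have h0 : ∀ x y : Rq q (2 ^ k), fma (ctx (2 ^ k) q) (repQ x) (repQ y) (.num 0) = repQ (x * y) :=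
    fun x y => by
      rw [← repQ_zero (n := 2 ^ k) (q := q), fma_eq hq2, add_zero]
  simp only [viewV, Val.ofList, Val.fst_pair, Val.snd_pair, load_eq hq2, decQ_encQ, invV_eq hq2 hq3,
    h0, outZ_repQ hq2]

theorem extraction_le_solver [Fact (P.q (2 ^ k)).Prime] (hq : P.q (2 ^ k) % 8 = 3) (hk : 2 ≤ k)
    (hkq : 2 * k < P.q (2 ^ k))
    (hV : ∀ t : ℕ, V.run (2 ^ k) (.pair (P.desc (2 ^ k)) (.num t)) = PMF.pure (.ofList
      [.num (P.q (2 ^ k)), .num (P.μ (2 ^ k)), .num ⌊P.eta (2 ^ k) t⌋]))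
    {a₁ a₂ a₃ : Rq (P.q (2 ^ k)) (2 ^ k)} (ha : IsUnit a₂) :
    extraction P 𝒜 (2 ^ k) β (a₁ * a₂ ^ (P.q (2 ^ k) ^ 2 ^ k - 2))
        (a₃ * a₂ ^ (P.q (2 ^ k) ^ 2 ^ k - 2)) ≤
      expect (solverV V 𝒜 (unary (2 ^ k))
        (.pair (P.desc (2 ^ k)) (.ofList [encQ a₁, encQ a₂, encQ a₃])))
        fun w => ind (SISSolution β ![a₁, a₂, a₃] w) := by
  have hi : a₂ ^ (P.q (2 ^ k) ^ 2 ^ k - 2) * a₂ = 1 := by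
    obtain ⟨j, rfl⟩ := Nat.exists_eq_add_of_le' hk
    exact pow_mul_self_of_isUnit hq j ha
  unfold solverV extraction
  have hV0 := hV 0
  rw [Nat.cast_zero] at hV0
  simp only [expect_bind, expect_pure, toList_unary, List.length_replicate, Val.fst_pair,
    Val.snd_pair, hV0]
  have h0 : (Val.ofList [.num (P.q (2 ^ k)), .num (P.μ (2 ^ k)), .num ⌊P.eta (2 ^ k) (0 : ℕ)⌋]).fst =
    .num (P.q (2 ^ k)) := rfl
  simp only [h0, mkCtx_eq, viewV_eq hq, sampleL_eq, expect_map, branchV_eq]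
  unfold Params.view
  refine expect_mono fun w₁ => expect_mono fun l => expect_mono_support fun b hb =>
    expect_mono_support fun b' hb' => ?_
  have m := mem_chalSet_of_mem_support hb
  have m' := mem_chalSet_of_mem_support hb'
  rw [combineV_eq (by omega) (B := k) (by exact_mod_cast hkq)
    ⟨normLe_of_mem_chalSet m.1, normLe_of_mem_chalSet m.2.1, normLe_of_mem_chalSet m.2.2⟩
    ⟨normLe_of_mem_chalSet m'.1, normLe_of_mem_chalSet m'.2.1, normLe_of_mem_chalSet m'.2.2⟩]
  exact ind_mono fun h => sisSolution_of_shortRelation hi h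

/-- The solver succeeds with the probability of an extraction, up to a factor. -/
theorem expect_extraction_le [Fact (P.q (2 ^ k)).Prime] (hq : P.q (2 ^ k) % 8 = 3) (hk : 2 ≤ k)
    (hkq : 2 * k < P.q (2 ^ k))
    (hV : ∀ t : ℕ, V.run (2 ^ k) (.pair (P.desc (2 ^ k)) (.num t)) = PMF.pure (.ofList
      [.num (P.q (2 ^ k)), .num (P.μ (2 ^ k)), .num ⌊P.eta (2 ^ k) t⌋]))
    {S : PPT} (hS : ∀ n x, S.run n x = solverV V 𝒜 (unary n) x) :
    (expect (uniformOn (Set.univ : Set (Rq (P.q (2 ^ k)) (2 ^ k)))) fun a =>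
      expect (uniformOn (Set.univ : Set (Rq (P.q (2 ^ k)) (2 ^ k)))) fun u =>
        ind (IsUnit a) * extraction P 𝒜 (2 ^ k) β a u) ≤
      2 * expect (sisExp P 3 β S (2 ^ k)) (fun b => ind (b = true)) := by
  set X := expect (uniformOn (Set.univ : Set (Rq (P.q (2 ^ k)) (2 ^ k)))) fun a =>
      expect (uniformOn (Set.univ : Set (Rq (P.q (2 ^ k)) (2 ^ k)))) fun u =>
        ind (IsUnit a) * extraction P 𝒜 (2 ^ k) β a u with hX
  have h1 : 1 / 2 * X ≤ expect (sisExp P 3 β S (2 ^ k)) (fun b => ind (b = true)) := by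
    rw [expect_sisExp, expect_comm]
    refine (mul_le_mul_left (half_le_expect_isUnit hq hk) X).trans ?_
    rw [← expect_mul_const]
    refine expect_mono fun a₂ => ?_
    by_cases ha : IsUnit a₂
    swap
    · rw [ind_of_not ha, zero_mul]; exact zero_le
    -- Division by the unit `a₂` permutes `R_q`, so the simulated parameter `a₁/a₂` and key `a₃/a₂`
    -- are uniform and independent, as in the expectation to be bounded.
    rw [ind_of ha, one_mul, hX, ← expect_mul_unit (ha.pow (P.q (2 ^ k) ^ 2 ^ k - 2))]
    refine expect_mono fun a₁ => ?_
    rw [← expect_mul_unit (ha.pow (P.q (2 ^ k) ^ 2 ^ k - 2))]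
    refine expect_mono fun a₃ => ?_
    rw [hS]
    exact (mul_le_of_le_one_left zero_le (ind_le_one _)).trans (extraction_le_solver hq hk hkq hV ha)
  calc X = 2 * (1 / 2 * X) := by
        rw [← mul_assoc, one_div, ENNReal.mul_inv_cancel (by simp) (by simp), one_mul]
    _ ≤ _ := by gcongr

/-- If the norm bound is at least `q`, then the ring-SIS problem is trivial. -/
theorem lt_of_trivial_solver (hV : ∀ t : ℕ, V.run (2 ^ k) (.pair (P.desc (2 ^ k)) (.num t)) =
      PMF.pure (.ofList [.num (P.q (2 ^ k)), .num (P.μ (2 ^ k)), .num ⌊P.eta (2 ^ k) t⌋]))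
    {S : PPT} (hS : ∀ n x, S.run n x = (V.run n (.pair x.fst (.num 0))).bind fun p =>
      PMF.pure (.pair (.pair p.fst (.num 0)) (.num 0))) (hq : P.q (2 ^ k) ≠ 0)
    (h : expect (sisExp P 3 β S (2 ^ k)) (fun b => ind (b = true)) < 1) : β < P.q (2 ^ k) := by
  by_contra! hβ
  refine absurd h (not_lt.2 ?_)
  have hV0 := hV 0
  rw [Nat.cast_zero] at hV0
  have h0 : (Val.ofList [.num (P.q (2 ^ k)), .num (P.μ (2 ^ k)), .num ⌊P.eta (2 ^ k) (0 : ℕ)⌋]).fst =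
    .num (P.q (2 ^ k)) := rfl
  rw [expect_sisExp]
  simp only [hS, Val.fst_pair, hV0, expect_bind, expect_pure, h0]
  set w : Val := .pair (.pair (.num (P.q (2 ^ k))) (.num 0)) (.num 0)
  have hc : ∀ (i : Fin 3) (j : Fin (2 ^ k)),
      coeffs (decZ (2 ^ k) (w.toList.getD i (.num 0))) j = 0 ∨
      coeffs (decZ (2 ^ k) (w.toList.getD i (.num 0))) j = P.q (2 ^ k) := by
    intro i j
    rw [decZ, coeffs_ofCoeffs]
    fin_cases i
    · rcases Nat.eq_zero_or_pos (j : ℕ) with hj | hj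
      · right; simp [w, hj, Val.toList]
      · left
        obtain ⟨m, hm⟩ : ∃ m, (j : ℕ) = m + 1 := ⟨j - 1, by omega⟩
        simp [w, hm, Val.toList]
    · left; simp [w, Val.toList]
    · left; simp [w, Val.toList]
  have hsol : ∀ a : Fin 3 → Rq (P.q (2 ^ k)) (2 ^ k), SISSolution β a w := by
    intro a
    refine ⟨fun h0 => hq ?_, fun i j => ?_, Finset.sum_eq_zero fun i _ => ?_⟩
    · have := congrArg (fun u => coeffs u (⟨0, NeZero.pos _⟩ : Fin (2 ^ k))) (congrFun h0 0)
      rw [decZ, coeffs_ofCoeffs] at this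
      simpa [w, Val.toList] using this
    · rcases hc i j with h | h <;> rw [h]
      · simpa using (Nat.cast_nonneg _).trans hβ
      · simpa using hβ
    · have : red (P.q (2 ^ k)) (decZ (2 ^ k) (w.toList.getD i (.num 0))) = 0 := by
        apply coeffs_injective
        funext j
        rw [coeffs_red, coeffs_zero]
        rcases hc i j with h | h <;> rw [h] <;> simp
      rw [this, mul_zero]
  simp only [ind_of (hsol _), expect_const, le_refl]

end Solver

/-! ## Asymptotics -/

section Asymptotics

variable {P : Params}

theorem sq_le_mu (hμ : ∀ k : ℕ, lg (2 ^ k) ^ 2 ≤ (P.μ (2 ^ k) : ℝ)) (k : ℕ) :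
    k ^ 2 ≤ P.μ (2 ^ k) := by
  have := hμ k
  rw [lg_two_pow] at this
  exact_mod_cast this

theorem eventually_one_le_sigma (hσ_pos : ∀ k : ℕ, 0 < P.σ (2 ^ k))
    (hσ : (fun k : ℕ => (2 : ℝ) ^ k) =O[atTop] fun k : ℕ => P.σ (2 ^ k)) :
    ∀ᶠ k in atTop, 1 ≤ P.σ (2 ^ k) := by
  obtain ⟨C, hC, h⟩ := hσ.exists_pos
  have h2 : Tendsto (fun k : ℕ => (2 : ℝ) ^ k) atTop atTop :=
    tendsto_pow_atTop_atTop_of_one_lt one_lt_two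
  filter_upwards [h.bound, h2.eventually_ge_atTop C] with k h3 h4
  rw [Real.norm_of_nonneg (by positivity), Real.norm_of_nonneg (hσ_pos k).le] at h3
  by_contra! h5
  nlinarith

theorem one_le_sqrt_two_pow (k : ℕ) : 1 ≤ Real.sqrt (2 ^ k) :=
  Real.one_le_sqrt.2 (one_le_pow₀ (by norm_num))

theorem correct_of_assumptions (hq : ∀ k : ℕ, (P.q (2 ^ k)).Prime)
    (hμ : ∀ k : ℕ, lg (2 ^ k) ^ 2 ≤ (P.μ (2 ^ k) : ℝ)) (hσ_pos : ∀ k : ℕ, 0 < P.σ (2 ^ k))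
    (hσ : (fun k : ℕ => (2 : ℝ) ^ k) =O[atTop] fun k : ℕ => P.σ (2 ^ k)) {t : ℕ → ℕ}
    (ht : ∀ k, 1 ≤ t (2 ^ k)) : Correct P t := by
  refine negligible_of_negl ((negl_exp (c := 1 / 2) (by norm_num) 18).add
    (negl_pow_sq (r := 1 - 1 / 16 * (1 / 16)) ?_)) ?_
  · exact ENNReal.sub_lt_self (by simp) (by simp) (by simp)
  filter_upwards [eventually_one_le_sigma hσ_pos hσ, eventually_ge_atTop 2] with k h1 hk
  rw [ofReal_abs_one_sub_prob]
  have : NeZero (P.q (2 ^ k)) := ⟨(hq k).ne_zero⟩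
  refine expect_honestRun_le hk (hσ_pos k) ?_ (sq_le_mu hμ k) (ht k)
  have hk3 : (1 : ℝ) ≤ (k : ℝ) ^ 3 := one_le_pow₀ (by exact_mod_cast (by omega : 1 ≤ k))
  exact one_le_mul_of_one_le_of_one_le
    (one_le_mul_of_one_le_of_one_le (one_le_sqrt_two_pow k) h1) hk3

theorem Negl.eventually_lt_one {f : ℕ → ℝ≥0∞} (hf : Negl f) : ∀ᶠ k in atTop, f k < 1 := by
  filter_upwards [hf 1, eventually_ge_atTop 1] with k h hk
  by_contra! h1
  have h2 : (2 : ℝ≥0∞) ≤ 1 := calc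
    (2 : ℝ≥0∞) ≤ 2 ^ (1 * k) := le_self_pow one_le_two (by omega)
    _ ≤ 2 ^ (1 * k) * f k := le_mul_of_one_le_right zero_le h1
    _ ≤ 1 := h
  exact absurd h2 (by norm_num)

variable {k : ℕ}

theorem eta_mono (hσ : 0 < P.σ (2 ^ k)) {t t' : ℕ} (h : t ≤ t') :
    P.eta (2 ^ k) t ≤ P.eta (2 ^ k) t' := by
  unfold Params.eta
  rw [lg_two_pow]
  gcongr

/-- Serves twice: it shows that the third extracted component, of norm at most `8 n² log³ n`,
respects `β`, and together with `β < q` it shows that `q` is large compared with `log n`. -/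
theorem eta_bounds (hk : 1 ≤ k) (hσ : 1 ≤ P.σ (2 ^ k)) (hμ : k ^ 2 ≤ P.μ (2 ^ k)) {t : ℕ}
    (ht : 1 ≤ t) : (2 ^ k) ^ 2 * (k : ℝ) ^ 3 ≤ P.eta (2 ^ k) t * Real.sqrt (2 ^ k) * k ^ 2 := by
  have hk' : (1 : ℝ) ≤ k := by exact_mod_cast hk
  have h1 : (1 : ℝ) ≤ Real.sqrt (t * P.μ (2 ^ k)) := by
    refine Real.one_le_sqrt.2 ?_
    have : 1 ≤ t * P.μ (2 ^ k) := Nat.mul_pos ht (lt_of_lt_of_le (by positivity) hμ)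
    exact_mod_cast this
  have h2 : (k : ℝ) ≤ k ^ 6 := le_self_pow₀ hk' (by norm_num)
  unfold Params.eta
  rw [lg_two_pow, cast_two_pow]
  calc (2 ^ k) ^ 2 * (k : ℝ) ^ 3 = 1 * 1 * (2 ^ k) ^ 2 * 1 * k * 1 * k ^ 2 := by ring
    _ ≤ 5 * P.σ (2 ^ k) * (2 ^ k) ^ 2 * Real.sqrt (t * P.μ (2 ^ k)) * k ^ 6 *
        Real.sqrt (2 ^ k) * k ^ 2 := by
      gcongr
      · norm_num
      · exact one_le_sqrt_two_pow k

theorem beta_eq (t : ℕ) : P.beta (2 ^ k) t = 16 * P.eta (2 ^ k) t * Real.sqrt (2 ^ k) * k ^ 2 := by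
  unfold Params.beta
  rw [lg_two_pow, cast_two_pow]

theorem pow_four_expect_le {α : Type*} (p : PMF α) (f : α → ℝ≥0∞) (hf : ∀ a, f a ≤ 1) :
    expect p f ^ 4 ≤ expect p fun a => f a ^ 4 :=
  calc expect p f ^ 4 = (expect p f ^ 2) ^ 2 := by rw [← pow_mul]
    _ ≤ (expect p fun a => f a ^ 2) ^ 2 := pow_le_pow_left' (sq_expect_le p f hf) 2
    _ ≤ expect p fun a => (f a ^ 2) ^ 2 := sq_expect_le p _ fun a => pow_le_one' (hf a) 2
    _ = _ := by simp only [← pow_mul]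

/-- The success probability of the attack on a random key, with a unit as the system parameter. -/
def unitSuccess (P : Params) (𝒜 : Attacker) (k : ℕ) : ℝ≥0∞ :=
  expect (uniformOn (Set.univ : Set (Rq (P.q (2 ^ k)) (2 ^ k)))) fun a =>
    expect (uniformOn (Set.univ : Set (Rq (P.q (2 ^ k)) (2 ^ k)))) fun u =>
      ind (IsUnit a) * success P 𝒜 (2 ^ k) a u

variable {𝒜 : Attacker} {tstar : ℕ → ℕ}

/-- The honest key is always counted, so the existence of an attacker excludes `t* = 0`. -/
theorem Attacker.AtMost.one_le (h : 𝒜.AtMost P tstar) (k : ℕ) : 1 ≤ tstar (2 ^ k) := by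
  obtain ⟨w, hw⟩ := (𝒜.first.run (2 ^ k) (P.view (2 ^ k) 1 0)).support_nonempty
  have := h k 1 0 isUnit_one w hw
  omega

/-- The number `t` of keys is fixed only by the output of the first move. Since `η_t` increases with
`t`, the bound `β` for `t*` covers all cases. -/
theorem success_pow_le_extraction (hA : 𝒜.AtMost P tstar) [Fact (P.q (2 ^ k)).Prime]
    (hq : P.q (2 ^ k) % 8 = 3) (hk : 2 ≤ k) (hσ : 1 ≤ P.σ (2 ^ k)) (hμ : k ^ 2 ≤ P.μ (2 ^ k))
    (hkq : 4 * k < P.q (2 ^ k)) {a : Rq (P.q (2 ^ k)) (2 ^ k)} (ha : IsUnit a)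
    (u : Rq (P.q (2 ^ k)) (2 ^ k)) :
    success P 𝒜 (2 ^ k) a u ^ 4 ≤
      extraction P 𝒜 (2 ^ k) (P.beta (2 ^ k) (tstar (2 ^ k))) a u +
      (3 * (1 / 2) ^ 2 ^ (k - 1) +
        16 * ((2 ^ k : ℕ) * ENNReal.ofReal (Real.exp (-(1 / 2 * (k : ℝ) ^ 2))))) := by
  refine (success_pow_le P (2 ^ k) a u).trans ?_
  unfold extraction
  rw [← expect_const (𝒜.first.run (2 ^ k) (P.view (2 ^ k) a u)) (3 * (1 / 2) ^ 2 ^ (k - 1) + _),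
    ← expect_add]
  refine expect_mono_support fun w₁ hw₁ => ?_
  rw [← expect_const (iid (uniformOn (chalSet (2 ^ k))) w₁.snd.toList.length)
    (3 * (1 / 2) ^ 2 ^ (k - 1) + _), ← expect_add]
  refine expect_mono fun l => ?_
  have ht := hA k a u ha w₁ hw₁
  have h1 := eta_bounds (t := w₁.snd.toList.length + 1) (by omega) hσ hμ (by omega)
  have h2 := eta_mono (P := P) (by linarith) ht
  have hk0 : (0 : ℝ) < k := by exact_mod_cast (by omega : 0 < k)
  have hs : (0 : ℝ) < Real.sqrt (2 ^ k) * k ^ 2 := by positivity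
  have h3 : 0 < (2 ^ k) ^ 2 * (k : ℝ) ^ 3 := by positivity
  rw [mul_assoc] at h1
  have h4 : 0 < P.eta (2 ^ k) (w₁.snd.toList.length + 1) :=
    pos_of_mul_pos_left (h3.trans_le h1) hs.le
  have h5 := mul_le_mul_of_nonneg_right h2 hs.le
  refine expect_fork_le P hq hk hkq h4 ?_ ?_ a u _
  · rw [beta_eq]; nlinarith
  · rw [beta_eq]; nlinarith

theorem unitSuccess_pow_le {V S : PPT} (hA : 𝒜.AtMost P tstar) [Fact (P.q (2 ^ k)).Prime]
    (hq : P.q (2 ^ k) % 8 = 3) (hk : 2 ≤ k) (hσ : 1 ≤ P.σ (2 ^ k)) (hμ : k ^ 2 ≤ P.μ (2 ^ k))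
    (hkq : 4 * k < P.q (2 ^ k))
    (hV : ∀ t : ℕ, V.run (2 ^ k) (.pair (P.desc (2 ^ k)) (.num t)) = PMF.pure (.ofList
      [.num (P.q (2 ^ k)), .num (P.μ (2 ^ k)), .num ⌊P.eta (2 ^ k) t⌋]))
    (hS : ∀ n x, S.run n x = solverV V 𝒜 (unary n) x) :
    unitSuccess P 𝒜 k ^ 4 ≤
      2 * expect (sisExp P 3 (P.beta (2 ^ k) (tstar (2 ^ k))) S (2 ^ k)) (fun b => ind (b = true)) +
      (3 * (1 / 2) ^ 2 ^ (k - 1) +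
        16 * ((2 ^ k : ℕ) * ENNReal.ofReal (Real.exp (-(1 / 2 * (k : ℝ) ^ 2))))) := by
  set κ : ℝ≥0∞ := 3 * (1 / 2) ^ 2 ^ (k - 1) +
    16 * ((2 ^ k : ℕ) * ENNReal.ofReal (Real.exp (-(1 / 2 * (k : ℝ) ^ 2))))
  have hle : ∀ a u : Rq (P.q (2 ^ k)) (2 ^ k), ind (IsUnit a) * success P 𝒜 (2 ^ k) a u ≤ 1 :=
    fun a u => mul_le_one' (ind_le_one _) (success_le_one _ _ _ _ _)
  refine le_trans ?_ (add_le_add (expect_extraction_le hq hk (by omega) hV hS) le_rfl)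
  refine (pow_four_expect_le _ _ fun a => expect_le (hle a)).trans ?_
  rw [← expect_const (uniformOn (Set.univ : Set (Rq (P.q (2 ^ k)) (2 ^ k)))) κ, ← expect_add]
  refine expect_mono fun a => (pow_four_expect_le _ _ (hle a)).trans ?_
  rw [← expect_const (uniformOn (Set.univ : Set (Rq (P.q (2 ^ k)) (2 ^ k)))) κ, ← expect_add]
  refine expect_mono fun u => ?_
  by_cases ha : IsUnit a
  · rw [ind_of ha, one_mul, one_mul]
    exact success_pow_le_extraction hA hq hk hσ hμ hkq ha u
  · rw [ind_of_not ha, zero_mul, zero_mul]; simp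

/-- A unit parameter is first replaced by a uniform one, at the cost of the outer factor 2, since
ring-LWE is stated for uniform `a`. Then the key becomes uniform, and finally the non-units are
split off, where success is bounded by 1 only. -/
theorem expect_idExp_le {V D : PPT} [Fact (P.q (2 ^ k)).Prime] (hq : P.q (2 ^ k) % 8 = 3) (hk : 2 ≤ k)
    (hV : ∀ t : ℕ, V.run (2 ^ k) (.pair (P.desc (2 ^ k)) (.num t)) = PMF.pure (.ofList
      [.num (P.q (2 ^ k)), .num (P.μ (2 ^ k)), .num ⌊P.eta (2 ^ k) t⌋]))
    (hD : ∀ n x, D.run n x = attackV V 𝒜 (unary n) x) :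
    expect (idExp P 𝒜 (2 ^ k)) (fun b => ind (b = true)) ≤
      2 * ((unitSuccess P 𝒜 k + 2 * (1 / 2) ^ 2 ^ (k - 1)) +
        ENNReal.ofReal |(|prob (lweReal P D (2 ^ k)) - prob (lweIdeal P D (2 ^ k))|)|) := by
  have hDs : ∀ a u, expect (D.run (2 ^ k) (P.view (2 ^ k) a u)) (fun w => ind (w.toInt = 1)) =
      success P 𝒜 (2 ^ k) a u := fun a u => by
    rw [hD]; exact expect_attackV P V 𝒜 hV (by omega) (by omega) a u
  rw [expect_idExp]
  refine (expect_units_le hq hk _).trans ?_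
  rw [← expect_lweReal hDs]
  gcongr
  refine (expect_le_expect_add _ (lweIdeal P D (2 ^ k))).trans ?_
  gcongr
  rw [expect_lweIdeal hDs]
  unfold unitSuccess
  refine le_trans ?_ (add_le_add le_rfl (expect_not_isUnit_le hq hk))
  rw [← expect_add]
  refine expect_mono fun a => ?_
  by_cases ha : IsUnit a
  · simp only [ind_of ha, one_mul]
    exact le_self_add
  · rw [ind_of ha]
    exact (expect_le fun u => success_le_one _ _ _ _ _).trans le_add_self

theorem negl_idExp (hq : ∀ k : ℕ, (P.q (2 ^ k)).Prime ∧ P.q (2 ^ k) % 8 = 3)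
    (hμ : ∀ k : ℕ, lg (2 ^ k) ^ 2 ≤ (P.μ (2 ^ k) : ℝ)) (hσ_pos : ∀ k : ℕ, 0 < P.σ (2 ^ k))
    (hσ : (fun k : ℕ => (2 : ℝ) ^ k) =O[atTop] fun k : ℕ => P.σ (2 ^ k)) (heff : P.Efficient)
    (hLWE : RingLWE P) (hSIS : RingSIS P 3 fun n => P.beta n (tstar n))
    (hA : 𝒜.AtMost P tstar) : Negligible fun k => prob (idExp P 𝒜 (2 ^ k)) := by
  obtain ⟨-, V, hV⟩ := heff
  obtain ⟨D, hD⟩ := exists_distinguisher V 𝒜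
  obtain ⟨S, hS⟩ := exists_solver V 𝒜
  obtain ⟨S₀, hS₀⟩ := exists_trivial_solver V
  have nS := (negligible_iff _).1 (hSIS S)
  have nS₀ := (negligible_iff _).1 (hSIS S₀)
  have nD := (negligible_iff _).1 (hLWE D)
  simp only [ofReal_abs_prob] at nS nS₀
  -- No lower bound on `q` is assumed. If `β ≥ q`, then `(q, 0, 0)` is a solution that is found with
  -- probability 1, so the ring-SIS assumption forces `β < q` eventually.
  have hev : ∀ᶠ k in atTop, 2 ≤ k ∧ 1 ≤ P.σ (2 ^ k) ∧ 4 * k < P.q (2 ^ k) := by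
    filter_upwards [eventually_ge_atTop 2, eventually_one_le_sigma hσ_pos hσ,
      nS₀.eventually_lt_one] with k hk h1 h2
    refine ⟨hk, h1, ?_⟩
    have h3 := lt_of_trivial_solver (hV k) hS₀ (hq k).1.ne_zero h2
    have h4 := eta_bounds (by omega) h1 (sq_le_mu hμ k) (hA.one_le k)
    have h5 : (k : ℝ) ≤ (2 ^ k) ^ 2 * (k : ℝ) ^ 3 := by
      have hk' : (1 : ℝ) ≤ k := by exact_mod_cast (by omega : 1 ≤ k)
      calc (k : ℝ) = 1 * k := (one_mul _).symm
        _ ≤ (2 ^ k) ^ 2 * (k : ℝ) ^ 3 := mul_le_mul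
          (one_le_pow₀ (one_le_pow₀ (by norm_num))) (le_self_pow₀ hk' (by norm_num))
          (by positivity) (by positivity)
    rw [beta_eq] at h3
    have h6 : (4 * k : ℝ) < P.q (2 ^ k) := by nlinarith
    exact_mod_cast h6
  have nU : Negl (unitSuccess P 𝒜) := by
    -- The fourth power is negligible by forking and ring-SIS, hence so is the probability itself.
    refine Negl.of_pow (e := 4) (by norm_num) ((nS.two_mul.add ((negl_half_pow.nat_mul 3).add
      (negl_exp (c := 1 / 2) (by norm_num) 16))).mono ?_)
    filter_upwards [hev] with k h
    have : Fact (P.q (2 ^ k)).Prime := ⟨(hq k).1⟩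
    exact unitSuccess_pow_le hA (hq k).2 h.1 h.2.1 (sq_le_mu hμ k) h.2.2 (hV k) hS
  refine negligible_of_negl ((nU.add negl_half_pow.two_mul).add nD).two_mul ?_
  filter_upwards [hev] with k h
  have : Fact (P.q (2 ^ k)).Prime := ⟨(hq k).1⟩
  rw [ofReal_abs_prob]
  exact expect_idExp_le (hq k).2 h.1 (hV k) hD

end Asymptotics

end LatticeID

end

theorem mainTheorem6 (P : LatticeID.Params) (tstar : ℕ → ℕ)
    (hq : ∀ k : ℕ, (P.q (2 ^ k)).Prime ∧ P.q (2 ^ k) % 8 = 3)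
    (hμ : ∀ k : ℕ, LatticeID.lg (2 ^ k) ^ 2 ≤ (P.μ (2 ^ k) : ℝ))
    (hσ_pos : ∀ k : ℕ, 0 < P.σ (2 ^ k))
    (hσ : (fun k : ℕ => (2 : ℝ) ^ k) =O[Filter.atTop] fun k : ℕ => P.σ (2 ^ k))
    (heff : P.Efficient)
    (hLWE : LatticeID.RingLWE P)
    (hSIS : LatticeID.RingSIS P 3 fun n => P.beta n (tstar n)) :
    LatticeID.TSecure P tstar := by
  exact ⟨fun _ ht => LatticeID.correct_of_assumptions (fun k => (hq k).1) hμ hσ_pos hσ fun k => (ht k).1,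
    fun _ hA => LatticeID.negl_idExp hq hμ hσ_pos hσ heff hLWE hSIS hA⟩
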